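/- Let $n\ge 2$. For $j=1,\dots,n$ and $x,a\in\{0,1\}$ let $\rho^{(j)}_{a|x}$ be qubit states, put $\mathcal A^{(j)}_x=\rho^{(j)}_{0|x}-\rho^{(j)}_{1|x}$, and let $\{\mathcal M_s\}_{s\in\{0,1\}^n}$ be a POVM on $n$ qubits. Put $$\mathcal W_s=(n-1)(-1)^{s_1}\bigl(\mathcal A^{(1)}_0+\mathcal A^{(1)}_1\bigr)\otimes\bigotimes_{j=2}^n\mathcal A^{(j)}_0+\sum_{j=2}^n(-1)^{s_j}\bigl(\mathcal A^{(1)}_0-\mathcal A^{(1)}_1\bigr)\otimes\mathcal A^{(j)}_1$$ (with the identity on the remaining qubits), $\mathcal S=\frac{1}{2^n(n-1)2\sqrt2}\sum_s\mathrm{Tr}(\mathcal M_s\mathcal W_s)$, and $|\xi_s\rangle=\frac1{\sqrt2}\bigl(|0\,s_2\cdots s_n\rangle+(-1)^{s_1}|1\,\bar s_2\cdots\bar s_n\rangle\bigr)$. The average fidelity is $$\mathcal F(\{\mathcal M_s\}_s)=\max_{\Lambda}\frac1{2^n}\sum_s\langle\xi_s|\Lambda[\mathcal M_s]|\xi_s\rangle,$$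 where $\Lambda=\bigotimes_{j=1}^n\Lambda^{(j)}$ runs over the tensor products of qubit channels. **Theorem.** For every $n\ge2$ there are $r,\mu\in\mathbb R$, depending only on $n$, with $2\sqrt2\,r(n-1)+\mu=1$, such that for all states and POVMs as above and every $\epsilon\in\mathbb R$ with $\mathcal S\ge 1-\epsilon$ the following holds. There is a local channel $\Lambda=\bigotimes_j\Lambda^{(j)}$ with $$\frac1{2^n}\sum_s\langle\xi_s|\Lambda[\mathcal M_s]|\xi_s\rangle\ \ge\ \bigl(2\sqrt2\,r(n-1)+\mu\bigr)-2\sqrt2\,r(n-1)\,\epsilon ,$$ and consequently $\mathcal F(\{\mathcal M_s\}_s)\ge 1-2\sqrt2\,r(n-1)\,\epsilon$. The channel can be taken of the form $$\Lambda^{(j)}[X]=\tfrac{1+g(\alpha_j)}2\,U_jXU_j^\dagger+\tfrac{1-g(\alpha_j)}2\,\Gamma^{(j)}(\alpha_j)\,U_jXU_j^\dagger\,\Gamma^{(j)}(\alpha_j)$$ with qubit unitaries $U_j$, angles $\alpha_j\in[0,\pi/2]$, and $g(\alpha)=(1+\sqrt2)(\sin\alpha+\cos\alpha-1)$. Here $\Gamma^{(j)}(\alpha)=\tau^{(j)}_0$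 for $\alpha\le\pi/4$ and $\Gamma^{(j)}(\alpha)=\tau^{(j)}_1$ for $\alpha>\pi/4$, where $(\tau^{(1)}_0,\tau^{(1)}_1)=(\sigma_X,\sigma_Z)$ and $(\tau^{(j)}_0,\tau^{(j)}_1)=\bigl(\tfrac{\sigma_X+\sigma_Z}{\sqrt2},\tfrac{\sigma_X-\sigma_Z}{\sqrt2}\bigr)$ for $j\ge2$. If the messages are antipodal, i.e. $\mathrm{Tr}\bigl(\rho^{(j)}_{0|x}\rho^{(j)}_{1|x}\bigr)=0$ for all $j,x$, then moreover $U_j\mathcal A^{(j)}_xU_j^\dagger=\cos\alpha_j\,\tau^{(j)}_0+(-1)^x\sin\alpha_j\,\tau^{(j)}_1$ for all $j,x$, so that the $\alpha_j$ are the angles of the messages. For $n=2$ the above holds with $r=(4+5\sqrt2)/16$ and $\mu=-(1+2\sqrt2)/4$, which gives $\mathcal F\ge 1-\frac{4+5\sqrt2}{4\sqrt2}\,\epsilon$. -/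

import Mathlib

open scoped Matrix ComplexOrder BigOperators

namespace GHZTest

noncomputable section

/-- Operators on one qubit. -/
abbrev QubitOp : Type := Matrix (Fin 2) (Fin 2) ℂ

/-- Operators on `n` qubits, in the computational basis `|b⟩`, `b : Fin n → Fin 2`.
Party `1` of the mathematical text is the index `0 : Fin n`. -/
abbrev NQubitOp (n : ℕ) : Type := Matrix (Fin n → Fin 2) (Fin n → Fin 2) ℂ

/-- The tensor product `⨂ⱼ A j` of one-qubit operators. -/
def tensorOp {n : ℕ} (A : Fin n → QubitOp) : NQubitOp n :=
  Matrix.of fun a b => ∏ j, A j (a j) (b j)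

/-- Density operators of a qubit. -/
def IsQubitState (ρ : QubitOp) : Prop := ρ.PosSemidef ∧ ρ.trace = 1

/-- A measurement on `n` qubits with outcomes `s ∈ {0,1}ⁿ`; the bit `s₁` is `s 0`. -/
def IsPOVM {n : ℕ} (M : (Fin n → Fin 2) → NQubitOp n) : Prop :=
  (∀ s, (M s).PosSemidef) ∧ ∑ s, M s = 1

/-- `A_x = ρ_{0|x} - ρ_{1|x}`, where `ρ x a` is the state `ρ_{a|x}` of one sender. -/
def senderObs (ρ : Fin 2 → Fin 2 → QubitOp) (x : Fin 2) : QubitOp := ρ x 0 - ρ x 1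

/-- The operator
`W_s = (n-1)(-1)^{s₁} (A₀⁽¹⁾ + A₁⁽¹⁾) ⊗ ⨂_{j ≥ 2} A₀⁽ʲ⁾ + ∑_{j ≥ 2} (-1)^{sⱼ} (A₀⁽¹⁾ - A₁⁽¹⁾) ⊗ A₁⁽ʲ⁾`
(identity on the parties that are not mentioned), where `ρ j x a` is the state
`ρ⁽ʲ⁾_{a|x}`. -/
def successOp {n : ℕ} [NeZero n] (ρ : Fin n → Fin 2 → Fin 2 → QubitOp) (s : Fin n → Fin 2) :
    NQubitOp n :=
  (((n : ℂ) - 1) * (-1) ^ (s 0 : ℕ)) •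
      tensorOp (fun k => if k = 0 then senderObs (ρ 0) 0 + senderObs (ρ 0) 1
        else senderObs (ρ k) 0)
    + ∑ j ∈ Finset.univ.filter (fun j : Fin n => j ≠ 0), ((-1 : ℂ) ^ (s j : ℕ)) •
        tensorOp (fun k => if k = 0 then senderObs (ρ 0) 0 - senderObs (ρ 0) 1
          else if k = j then senderObs (ρ j) 1 else 1)

/-- The success metric `S = (∑ₛ Tr(M_s W_s)) / (2ⁿ (n-1) 2√2)`. -/
def successMetric {n : ℕ} [NeZero n] (ρ : Fin n → Fin 2 → Fin 2 → QubitOp)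
    (M : (Fin n → Fin 2) → NQubitOp n) : ℝ :=
  1 / (2 ^ n * ((n : ℝ) - 1) * (2 * √2)) * ∑ s, ((M s * successOp ρ s).trace).re

/-- The GHZ basis vector `(|0 s₂ … sₙ⟩ + (-1)^{s₁} |1 s̄₂ … s̄ₙ⟩) / √2`. -/
def ghzVec {n : ℕ} [NeZero n] (s : Fin n → Fin 2) : (Fin n → Fin 2) → ℂ :=
  fun b => ((√2 : ℝ) : ℂ)⁻¹ *
    ((if b = Function.update s 0 0 then 1 else 0)
      + (-1) ^ (s 0 : ℕ) * (if b = Function.update (fun j => 1 - s j) 0 1 then 1 else 0))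

/-- The projector `|ξ_s⟩⟨ξ_s|`. -/
def ghzProj {n : ℕ} [NeZero n] (s : Fin n → Fin 2) : NQubitOp n :=
  Matrix.vecMulVec (ghzVec s) (star (ghzVec s))

/-- Qubit channels: completely positive trace preserving maps, in operator-sum form. -/
def IsQubitChannel (Φ : QubitOp →ₗ[ℂ] QubitOp) : Prop :=
  ∃ (m : ℕ) (K : Fin m → QubitOp), ∑ i, (K i)ᴴ * K i = 1 ∧
    ∀ X, Φ X = ∑ i, K i * X * (K i)ᴴ

/-- The tensor product `⨂ⱼ Φ j` of linear maps on qubit operators, applied to an operator on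
`n` qubits: expand in the matrix units `|c⟩⟨d| = ⨂ⱼ |cⱼ⟩⟨dⱼ|`. -/
def localMap {n : ℕ} (Φ : Fin n → (QubitOp →ₗ[ℂ] QubitOp)) (X : NQubitOp n) : NQubitOp n :=
  ∑ c, ∑ d, X c d • tensorOp (fun j => Φ j (Matrix.single (c j) (d j) 1))

/-- `2⁻ⁿ ∑ₛ F(|ξ_s⟩⟨ξ_s|, Λ[M_s])` for `Λ = ⨂ⱼ Φ j`; the fidelity with a pure state is
`⟨ξ_s| Λ[M_s] |ξ_s⟩ = Tr(|ξ_s⟩⟨ξ_s| Λ[M_s])`. -/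
def fidelityUnder {n : ℕ} [NeZero n] (M : (Fin n → Fin 2) → NQubitOp n)
    (Φ : Fin n → (QubitOp →ₗ[ℂ] QubitOp)) : ℝ :=
  (∑ s, ((ghzProj s * localMap Φ (M s)).trace).re) / 2 ^ n

/-- The average fidelity of a measurement: the maximum of `fidelityUnder` over all local
quantum channels. -/
def avgFidelity {n : ℕ} [NeZero n] (M : (Fin n → Fin 2) → NQubitOp n) : ℝ :=
  sSup {f : ℝ | ∃ Φ : Fin n → (QubitOp →ₗ[ℂ] QubitOp),
    (∀ j, IsQubitChannel (Φ j)) ∧ f = fidelityUnder M Φ}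

def pauliX : QubitOp := !![0, 1; 1, 0]

def pauliZ : QubitOp := !![1, 0; 0, -1]

/-- The two reference axes of party `j`: `(σ_X, σ_Z)` for the first party and
`((σ_X + σ_Z)/√2, (σ_X - σ_Z)/√2)` for the others. -/
def axis {n : ℕ} [NeZero n] (j : Fin n) (i : Fin 2) : QubitOp :=
  if j = 0 then (if i = 0 then pauliX else pauliZ)
  else ((√2 : ℝ) : ℂ)⁻¹ • (if i = 0 then pauliX + pauliZ else pauliX - pauliZ)

/-- The reference observables `cos α · axis₀ + (-1)^x sin α · axis₁` of party `j`. -/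
def refObs {n : ℕ} [NeZero n] (j : Fin n) (α : ℝ) (x : Fin 2) : QubitOp :=
  ((Real.cos α : ℝ) : ℂ) • axis j 0 + ((-1) ^ (x : ℕ) * ((Real.sin α : ℝ) : ℂ)) • axis j 1

/-- `g(α) = (1 + √2)(sin α + cos α - 1)`. -/
def dephasingWeight (α : ℝ) : ℝ := (1 + √2) * (Real.sin α + Real.cos α - 1)

open Classical in
/-- The axis `Γ(α)` along which party `j` dephases. -/
def dephasingAxis {n : ℕ} [NeZero n] (j : Fin n) (α : ℝ) : QubitOp :=
  if α ≤ Real.pi / 4 then axis j 0 else axis j 1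

/-- The dephasing map `ρ ↦ (1+g(α))/2 · ρ + (1-g(α))/2 · Γ(α) ρ Γ(α)` of party `j`. -/
def dephasing {n : ℕ} [NeZero n] (j : Fin n) (α : ℝ) (ρ : QubitOp) : QubitOp :=
  (((1 + dephasingWeight α) / 2 : ℝ) : ℂ) • ρ
    + (((1 - dephasingWeight α) / 2 : ℝ) : ℂ) • (dephasingAxis j α * ρ * dephasingAxis j α)

end

end GHZTest

/-! By duality, the fidelity of `Λ[M_s]` with the target is the trace of `M_s` against the image of
`ghzProj s` under the dual channel. So it suffices to prove one operator inequality: for all angles,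
the locally dephased projector dominates r·W_s + μ·1, with W_s built from the reference observables.
Summing over s, with total trace 2ⁿ, gives the bound linear in ε
(`le_fidelityUnder_of_operator_bound`). Operator positivity is always tested through functionals
φ(X) = Re Tr(XB) with B positive semidefinite, so most of the algebra takes place in a star ring
with a positive functional.

Reduction to reference observables. A difference of two states is λ ∈ [0,1] times an observable with
unit Bloch vector, hence a mixture of that observable and its negative. The score is affine in each
observable separately, so it does not drop for a suitable unit choice (`exists_unit_score_le`). Two
unit observables have anticommuting sum and difference; a unitary rotates these onto the reference
axes, and only the half angle α remains (`exists_unitary_conj_refObs`).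

Two parties. The dephased projector minus r·W_s − μ has the form κ + L − eN, where L combines the
four products of axes, N is the product of all four axes, and L² = q₀ − q₁N. On each eigenspace of N
the square of L is a scalar, so positivity amounts to two scalar inequalities
(`map_two_qubit_nonneg`). In terms of the dephasing weight g, cos α + sin α is affine and |cos α −
sin α| is a square root. Polynomial lower bounds for the root in the mixed terms leave polynomial
inequalities on the unit square, certified by nonnegative coefficients (`even_sector_le`,
`odd_sector_le`).

More parties. Any slope will do, so every loss is bounded by a multiple of the deficit D of W_s from
2√2(n−1). The operator W_s is a sum of n−1 CHSH operators between party 1 and the others. Their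
deficits control the angle defects (`map_chsh_le`), then the violation of the stabilizer equations
(`map_stabilizer_deficit_le`), and thereby the overlap with the GHZ vector
(`reTraceMul_one_sub_ghzProj_le`). The dephasing strength is proportional to the angle defect, which
costs one more multiple of D. -/

namespace GHZTest

/-! ### Tensor products of one-qubit operators and Kraus forms of local maps. -/

section Tensor

variable {n : ℕ}

theorem tensorOp_apply (A : Fin n → QubitOp) (a b : Fin n → Fin 2) :
    tensorOp A a b = ∏ j, A j (a j) (b j) := rfl

theorem tensorOp_mul (A B : Fin n → QubitOp) :
    tensorOp A * tensorOp B = tensorOp (fun j => A j * B j) := by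
  ext a b
  simp only [Matrix.mul_apply, tensorOp_apply, ← Finset.prod_mul_distrib]
  rw [Finset.prod_univ_sum, Fintype.piFinset_univ]

theorem tensorOp_one : tensorOp (fun _ : Fin n => (1 : QubitOp)) = 1 := by
  ext a b
  rw [tensorOp_apply, Matrix.one_apply]
  by_cases h : a = b
  · subst h; simp
  · rw [if_neg h]
    obtain ⟨j, hj⟩ := Function.ne_iff.mp h
    exact Finset.prod_eq_zero (Finset.mem_univ j) (Matrix.one_apply_ne hj)

theorem tensorOp_conjTranspose (A : Fin n → QubitOp) :
    (tensorOp A)ᴴ = tensorOp (fun j => (A j)ᴴ) := by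
  ext a b
  simp [tensorOp_apply, Matrix.conjTranspose_apply]

theorem tensorOp_smul (c : Fin n → ℂ) (A : Fin n → QubitOp) :
    tensorOp (fun j => c j • A j) = (∏ j, c j) • tensorOp A := by
  ext a b
  simp [tensorOp_apply, Finset.prod_mul_distrib]

theorem tensorOp_update_smul (A : Fin n → QubitOp) (j : Fin n) (c : ℂ) (X : QubitOp) :
    tensorOp (Function.update A j (c • X)) = c • tensorOp (Function.update A j X) := by
  ext a b
  simp only [tensorOp_apply, Matrix.smul_apply, smul_eq_mul]
  rw [← Finset.mul_prod_erase _ _ (Finset.mem_univ j),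
    ← Finset.mul_prod_erase _ (fun k => Function.update A j X k (a k) (b k)) (Finset.mem_univ j)]
  simp only [Function.update_self, Matrix.smul_apply, smul_eq_mul, mul_assoc]
  congr 2
  refine Finset.prod_congr rfl fun k hk => ?_
  rw [Function.update_of_ne (Finset.ne_of_mem_erase hk),
    Function.update_of_ne (Finset.ne_of_mem_erase hk)]

theorem tensorOp_update_add (A : Fin n → QubitOp) (j : Fin n) (X Y : QubitOp) :
    tensorOp (Function.update A j (X + Y))
      = tensorOp (Function.update A j X) + tensorOp (Function.update A j Y) := by
  ext a b
  simp only [tensorOp_apply, Matrix.add_apply]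
  have key : ∀ Z : QubitOp, ∏ k, Function.update A j Z k (a k) (b k)
      = Z (a j) (b j) * ∏ k ∈ Finset.univ.erase j, A k (a k) (b k) := fun Z => by
    rw [← Finset.mul_prod_erase _ _ (Finset.mem_univ j), Function.update_self]
    congr 1
    refine Finset.prod_congr rfl fun k hk => ?_
    rw [Function.update_of_ne (Finset.ne_of_mem_erase hk)]
  rw [key, key, key, Matrix.add_apply, add_mul]

theorem tensorOp_single (c d : Fin n → Fin 2) :
    tensorOp (fun j => Matrix.single (c j) (d j) (1 : ℂ)) = Matrix.single c d 1 := by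
  ext a b
  simp only [tensorOp_apply, Matrix.single_apply]
  by_cases h : c = a ∧ d = b
  · obtain ⟨rfl, rfl⟩ := h; simp
  · rw [if_neg h]
    have : ∃ j, ¬ (c j = a j ∧ d j = b j) := by
      by_contra hcon
      push Not at hcon
      exact h ⟨funext fun j => (hcon j).1, funext fun j => (hcon j).2⟩
    obtain ⟨j, hj⟩ := this
    exact Finset.prod_eq_zero (Finset.mem_univ j) (if_neg hj)

theorem sum_smul_tensorOp_single (X : NQubitOp n) :
    ∑ c, ∑ d, X c d • tensorOp (fun j => Matrix.single (c j) (d j) (1 : ℂ)) = X := by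
  simp only [tensorOp_single, Matrix.smul_single, smul_eq_mul, mul_one]
  exact (Matrix.matrix_eq_sum_single X).symm

/-- A sum in every tensor factor is a sum of tensor products. -/
theorem tensorOp_sum {ι : Type*} [Fintype ι] [DecidableEq ι] (B : Fin n → ι → QubitOp) :
    tensorOp (fun j => ∑ i, B j i) = ∑ f : Fin n → ι, tensorOp (fun j => B j (f j)) := by
  ext a b
  simp only [tensorOp_apply, Matrix.sum_apply]
  rw [Finset.prod_univ_sum, Fintype.piFinset_univ]

/-- Operator-sum form of a tensor product of maps in operator-sum form. -/
theorem localMap_eq_sum_kraus {ι : Type*} [Fintype ι] [DecidableEq ι]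
    (Φ : Fin n → (QubitOp →ₗ[ℂ] QubitOp)) (K : Fin n → ι → QubitOp)
    (hK : ∀ j X, Φ j X = ∑ i, K j i * X * (K j i)ᴴ) (X : NQubitOp n) :
    localMap Φ X = ∑ f : Fin n → ι,
      tensorOp (fun j => K j (f j)) * X * (tensorOp (fun j => K j (f j)))ᴴ := by
  have h1 : ∀ c d : Fin n → Fin 2, tensorOp (fun j => Φ j (Matrix.single (c j) (d j) 1))
      = ∑ f : Fin n → ι, tensorOp (fun j => K j (f j))
        * tensorOp (fun j => Matrix.single (c j) (d j) (1 : ℂ))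
        * (tensorOp (fun j => K j (f j)))ᴴ := fun c d => by
    simp only [hK, tensorOp_sum, tensorOp_conjTranspose, tensorOp_mul]
  conv_rhs => rw [← sum_smul_tensorOp_single X]
  simp only [localMap, h1, Finset.smul_sum, Finset.mul_sum, Finset.sum_mul, Matrix.mul_smul,
    Matrix.smul_mul]
  rw [Finset.sum_comm_cycle]

theorem sum_kraus_dual_tensorOp {ι : Type*} [Fintype ι] [DecidableEq ι]
    (K : Fin n → ι → QubitOp) (A : Fin n → QubitOp) :
    ∑ f : Fin n → ι,
      (tensorOp (fun j => K j (f j)))ᴴ * tensorOp A * tensorOp (fun j => K j (f j))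
      = tensorOp (fun j => ∑ i, (K j i)ᴴ * A j * K j i) := by
  simp only [tensorOp_sum, tensorOp_conjTranspose, tensorOp_mul]

end Tensor

/-! ### Trace functionals of positive semidefinite matrices. -/

section Trace

open scoped MatrixOrder Matrix.Norms.L2Operator in
theorem exists_eq_conjTranspose_mul_self {ι : Type*} [Fintype ι] [DecidableEq ι]
    {A : Matrix ι ι ℂ} (hA : A.PosSemidef) : ∃ B : Matrix ι ι ℂ, A = Bᴴ * B :=
  CStarAlgebra.nonneg_iff_eq_star_mul_self.mp hA.nonneg

theorem re_trace_mul_nonneg {ι : Type*} [Fintype ι] [DecidableEq ι] {A B : Matrix ι ι ℂ}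
    (hA : A.PosSemidef) (hB : B.PosSemidef) : 0 ≤ (A * B).trace.re := by
  obtain ⟨C, rfl⟩ := exists_eq_conjTranspose_mul_self hB
  rw [← Matrix.mul_assoc, Matrix.trace_mul_comm, ← Matrix.mul_assoc]
  exact (Complex.le_def.mp (hA.mul_mul_conjTranspose_same C).trace_nonneg).1

/-- The real functional `X ↦ Re Tr (X B)`. -/
noncomputable def reTraceMul {ι : Type*} [Fintype ι] (B : Matrix ι ι ℂ) :
    Matrix ι ι ℂ →ₗ[ℝ] ℝ where
  toFun X := (X * B).trace.re
  map_add' X Y := by simp [Matrix.add_mul]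
  map_smul' c X := by simp [Matrix.smul_mul, Matrix.trace_smul]

theorem reTraceMul_apply {ι : Type*} [Fintype ι] (B X : Matrix ι ι ℂ) :
    reTraceMul B X = (X * B).trace.re := rfl

/-- Supplies the hypothesis `hφ` of all lemmas on abstract positive functionals. -/
theorem reTraceMul_star_mul_self_nonneg {ι : Type*} [Fintype ι] [DecidableEq ι]
    {B : Matrix ι ι ℂ} (hB : B.PosSemidef) (X : Matrix ι ι ℂ) :
    0 ≤ reTraceMul B (star X * X) :=
  re_trace_mul_nonneg (Matrix.posSemidef_conjTranspose_mul_self X) hB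

end Trace

/-! ### Inequalities for positive functionals on star rings. -/

section Positive

variable {𝒜 : Type*} [Ring 𝒜] [StarRing 𝒜] [Algebra ℝ 𝒜] {φ : 𝒜 →ₗ[ℝ] ℝ}

theorem map_mul_self_nonneg (hφ : ∀ x, 0 ≤ φ (star x * x)) {x : 𝒜} (hx : star x = x) :
    0 ≤ φ (x * x) := by simpa [hx] using hφ x

theorem map_one_nonneg (hφ : ∀ x, 0 ≤ φ (star x * x)) : 0 ≤ φ 1 := by simpa using hφ 1

/-- For a self-adjoint involution, (1 − G)² = 2(1 − G), so 1 − G is half a square. -/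
theorem map_le_map_one (hφ : ∀ x, 0 ≤ φ (star x * x)) {G : 𝒜} (hG : star G = G)
    (hG2 : G * G = 1) : φ G ≤ φ 1 := by
  have h := map_mul_self_nonneg hφ (x := 1 - G) (by simp [hG])
  have : (1 - G) * (1 - G) = (2 : ℝ) • (1 : 𝒜) - (2 : ℝ) • G := by
    simp only [mul_sub, sub_mul, hG2, one_mul, mul_one]; module
  rw [this] at h
  simp only [map_sub, map_smul, smul_eq_mul] at h
  linarith

theorem map_add_three_sq_le (hφ : ∀ x, 0 ≤ φ (star x * x)) {x y z : 𝒜} (hx : star x = x)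
    (hy : star y = y) (hz : star z = z) :
    φ ((x + y + z) * (x + y + z)) ≤ 3 * (φ (x * x) + φ (y * y) + φ (z * z)) := by
  have h1 := map_mul_self_nonneg hφ (x := x - y) (by simp [hx, hy])
  have h2 := map_mul_self_nonneg hφ (x := y - z) (by simp [hy, hz])
  have h3 := map_mul_self_nonneg hφ (x := x - z) (by simp [hx, hz])
  simp only [mul_sub, sub_mul, mul_add, add_mul, map_sub, map_add] at h1 h2 h3 ⊢
  linarith

theorem map_add_sq_le (hφ : ∀ x, 0 ≤ φ (star x * x)) {x y : 𝒜} (hx : star x = x)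
    (hy : star y = y) :
    φ ((x + y) * (x + y)) ≤ 2 * (φ (x * x) + φ (y * y)) := by
  have h1 := map_mul_self_nonneg hφ (x := x - y) (by simp [hx, hy])
  simp only [mul_sub, sub_mul, mul_add, add_mul, map_sub, map_add] at h1 ⊢
  linarith

variable [StarModule ℝ 𝒜]

/-- One of the two sectors of `map_two_sector_nonneg`. -/
theorem map_sector_nonneg (hφ : ∀ x, 0 ≤ φ (star x * x)) {L N : 𝒜} (hL : star L = L)
    (hN : star N = N) (hN2 : N * N = 1) (hLN : L * N = N * L) {q₀ q₁ m : ℝ}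
    (hL2 : L * L = q₀ • (1 : 𝒜) - q₁ • N) (hm : 0 < m) (hq : q₀ + q₁ ≤ m ^ 2) :
    0 ≤ m * φ (1 - N) + φ (L * (1 - N)) := by
  -- 1 − N is twice the projection onto N = −1, where L² is the scalar q₀ + q₁ ≤ m².
  have hp2 : (1 - N) * (1 - N) = (2 : ℝ) • (1 - N) := by
    simp only [mul_sub, sub_mul, hN2, one_mul, mul_one]; module
  have hp : 0 ≤ φ (1 - N) := by
    have h := map_mul_self_nonneg hφ (x := 1 - N) (by simp [hN])
    rw [hp2, map_smul, smul_eq_mul] at h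
    linarith
  have hc : (1 - N) * (m • (1 : 𝒜) + L) = (m • (1 : 𝒜) + L) * (1 - N) := by
    simp only [mul_sub, sub_mul, mul_add, add_mul, one_mul, mul_one, hLN, smul_mul_assoc,
      mul_smul_comm]
    module
  have hq' : (m • (1 : 𝒜) + L) * (m • (1 : 𝒜) + L)
      = (m ^ 2) • (1 : 𝒜) + (2 * m) • L + (q₀ • (1 : 𝒜) - q₁ • N) := by
    simp only [mul_add, add_mul, one_mul, mul_one, hL2, smul_mul_assoc, mul_smul_comm]
    module
  -- The square of (m + L)(1 − N) equals 2(m² + q₀ + q₁)(1 − N) + 4mL(1 − N); bounding q₀ + q₁ by m²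
  -- makes it a multiple of the claim.
  have hx := hφ ((m • (1 : 𝒜) + L) * (1 - N))
  have key : star ((m • (1 : 𝒜) + L) * (1 - N)) * ((m • (1 : 𝒜) + L) * (1 - N))
      = (2 * (m ^ 2 + (q₀ + q₁))) • (1 - N) + (4 * m) • (L * (1 - N)) := by
    have hs : star ((m • (1 : 𝒜) + L) * (1 - N)) = (1 - N) * (m • (1 : 𝒜) + L) := by
      simp [hL, hN]
    rw [hs, hc, mul_assoc, ← mul_assoc (1 - N), hc, mul_assoc (m • (1 : 𝒜) + L) (1 - N), hp2,
      ← mul_assoc, hq']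
    simp only [mul_sub, sub_mul, mul_add, add_mul, one_mul, mul_one, hN2, smul_mul_assoc,
      mul_smul_comm]
    module
  rw [key] at hx
  simp only [map_add, map_smul, smul_eq_mul] at hx
  have : (m ^ 2 + (q₀ + q₁)) * φ (1 - N) ≤ (2 * m ^ 2) * φ (1 - N) :=
    mul_le_mul_of_nonneg_right (by linarith) hp
  have h2 : 0 ≤ m * (m * φ (1 - N) + φ (L * (1 - N))) := by nlinarith
  exact nonneg_of_mul_nonneg_right h2 hm

/-- If `L² = q₀ - q₁ N` for commuting self-adjoint `L`, `N` with `N² = 1`, then positivity of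
`κ + L - e N` can be read off in the two eigenspaces of `N`. -/
theorem map_two_sector_nonneg (hφ : ∀ x, 0 ≤ φ (star x * x)) {L N : 𝒜} (hL : star L = L)
    (hN : star N = N) (hN2 : N * N = 1) (hLN : L * N = N * L) {q₀ q₁ κ e : ℝ}
    (hL2 : L * L = q₀ • (1 : 𝒜) - q₁ • N) (hm : 0 < κ + e) (hm' : 0 < κ - e)
    (hq : q₀ + q₁ ≤ (κ + e) ^ 2) (hq' : q₀ - q₁ ≤ (κ - e) ^ 2) :
    0 ≤ κ * φ 1 + φ L - e * φ N := by
  have h1 := map_sector_nonneg hφ hL hN hN2 hLN hL2 hm hq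
  -- The sector N = +1 is the same statement with N and q₁ negated.
  have h2 := map_sector_nonneg hφ (N := -N) (q₀ := q₀) (q₁ := -q₁) hL (by simp [hN]) (by simp [hN2])
    (by simp [hLN]) (by rw [hL2]; module) hm' (by linarith)
  simp only [mul_sub, mul_neg, mul_one, map_sub, map_neg] at h1 h2
  linarith

/-- Two qubits: positivity of a combination of products of anticommuting observables. -/
theorem map_two_qubit_nonneg (hφ : ∀ x, 0 ≤ φ (star x * x)) {X Z X' Z' : 𝒜}
    (hX : star X = X) (hZ : star Z = Z) (hX' : star X' = X') (hZ' : star Z' = Z')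
    (hX2 : X * X = 1) (hZ2 : Z * Z = 1) (hX'2 : X' * X' = 1) (hZ'2 : Z' * Z' = 1)
    (hXZ : Z * X = -(X * Z)) (hXZ' : Z' * X' = -(X' * Z'))
    (c1 : X' * X = X * X') (c2 : X' * Z = Z * X') (c3 : Z' * X = X * Z') (c4 : Z' * Z = Z * Z')
    {a b c d κ e : ℝ} (hm : 0 < κ + e) (hm' : 0 < κ - e)
    (hq : (a + d) ^ 2 + (b + c) ^ 2 ≤ (κ + e) ^ 2)
    (hq' : (a - d) ^ 2 + (b - c) ^ 2 ≤ (κ - e) ^ 2) :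
    0 ≤ κ * φ 1 + (a * φ (X * X') + b * φ (X * Z') + c * φ (Z * X') - d * φ (Z * Z'))
      - e * φ (X * Z * (X' * Z')) := by
  -- Rewriting rules that sort words: X before Z, and unprimed letters before primed ones, with a
  -- sign from each anticommutation.
  have rX : ∀ y, X * (X * y) = y := fun y => by rw [← mul_assoc, hX2, one_mul]
  have rZ : ∀ y, Z * (Z * y) = y := fun y => by rw [← mul_assoc, hZ2, one_mul]
  have rX' : ∀ y, X' * (X' * y) = y := fun y => by rw [← mul_assoc, hX'2, one_mul]
  have rZ' : ∀ y, Z' * (Z' * y) = y := fun y => by rw [← mul_assoc, hZ'2, one_mul]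
  have rXZ : ∀ y, Z * (X * y) = -(X * (Z * y)) := fun y => by
    rw [← mul_assoc, hXZ, neg_mul, mul_assoc]
  have rXZ' : ∀ y, Z' * (X' * y) = -(X' * (Z' * y)) := fun y => by
    rw [← mul_assoc, hXZ', neg_mul, mul_assoc]
  have r1 : ∀ y, X' * (X * y) = X * (X' * y) := fun y => by rw [← mul_assoc, c1, mul_assoc]
  have r2 : ∀ y, X' * (Z * y) = Z * (X' * y) := fun y => by rw [← mul_assoc, c2, mul_assoc]
  have r3 : ∀ y, Z' * (X * y) = X * (Z' * y) := fun y => by rw [← mul_assoc, c3, mul_assoc]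
  have r4 : ∀ y, Z' * (Z * y) = Z * (Z' * y) := fun y => by rw [← mul_assoc, c4, mul_assoc]
  -- In L² the products sharing a letter cancel by anticommutation; the pairs (XX', ZZ') and (XZ',
  -- ZX') survive and give −2(ad + bc)N.
  have h := map_two_sector_nonneg (φ := φ) hφ
    (L := a • (X * X') + b • (X * Z') + c • (Z * X') - d • (Z * Z')) (N := X * Z * (X' * Z'))
    (q₀ := a ^ 2 + b ^ 2 + c ^ 2 + d ^ 2) (q₁ := 2 * (a * d + b * c)) (κ := κ) (e := e)
    (by simp [hX, hZ, hX', hZ', c1, c2, c3, c4])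
    (by simp [hX, hZ, hX', hZ', hXZ', c3, c4, r1, r2, rXZ, mul_assoc])
    (by simp only [mul_assoc, hZ'2, r1, r2, r3, r4, rX,
          rZ, rX', rXZ, rXZ', mul_neg, neg_neg])
    (by simp only [add_mul, sub_mul, mul_add, mul_sub, smul_mul_assoc, mul_smul_comm,
          mul_assoc, hZ'2, hXZ', c1, c2, r1, r2, r3, r4, rX,
          rZ, rX', rXZ, rXZ', mul_neg, neg_neg, mul_one])
    (by simp only [add_mul, sub_mul, mul_add, mul_sub, smul_mul_assoc, mul_smul_comm,
          mul_assoc, hX2, hZ2, hX'2, hZ'2, hXZ, hXZ', r1, r2, r3, r4, rX,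
          rZ, rXZ, mul_neg, neg_neg, mul_one]
        module)
    hm hm' (by linarith) (by linarith)
  simpa only [map_add, map_sub, map_smul, smul_eq_mul] using h

/-- With t = (c + s)/√2 one has 2cs = 2t² − 1, so the middle bound is t² ≤ t, that is t ≤ 1. -/
theorem angle_defect_bounds {c s : ℝ} (h : c ^ 2 + s ^ 2 = 1) (hc : 0 ≤ c) (hs : 0 ≤ s) :
    0 ≤ 1 - (c + s) / √2 ∧ 2 * (c * s) ≤ 1 - 2 * (1 - (c + s) / √2) ∧
      0 ≤ 1 - 2 * (1 - (c + s) / √2) := by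
  have h2 : √2 ^ 2 = 2 := Real.sq_sqrt (by norm_num)
  have e : ((c + s) / √2) ^ 2 = (1 + 2 * (c * s)) / 2 := by
    rw [div_pow, h2]; congr 1; linear_combination h
  have t0 : 0 ≤ (c + s) / √2 := by positivity
  set t := (c + s) / √2
  have hcs := mul_nonneg hc hs
  have t1 : t ≤ 1 := by
    have : t ^ 2 ≤ 1 := by linarith [sq_nonneg (c - s)]
    nlinarith
  refine ⟨by linarith, ?_, ?_⟩
  · nlinarith
  · nlinarith

/-- Deficit of the CHSH operator `2c X B₀ + 2s Z B₁` in terms of the angle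
`(c, s) = (cos α, sin α)` of the first party and `(c', s')` of the second one. -/
theorem map_chsh_le (hφ : ∀ x, 0 ≤ φ (star x * x)) {X Z B₀ B₁ F : 𝒜}
    (hX : star X = X) (hZ : star Z = Z) (hB₀ : star B₀ = B₀) (hB₁ : star B₁ = B₁)
    (hF : star F = -F)
    (hX2 : X * X = 1) (hZ2 : Z * Z = 1) (hB₀2 : B₀ * B₀ = 1) (hB₁2 : B₁ * B₁ = 1)
    (hF2 : F * F = -1) (hXZ : Z * X = -(X * Z))
    (c1 : B₀ * X = X * B₀) (c2 : B₀ * Z = Z * B₀) (c3 : B₁ * X = X * B₁) (c4 : B₁ * Z = Z * B₁)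
    (c5 : F * X = X * F) (c6 : F * Z = Z * F)
    {c s c' s' : ℝ} (hcs : c ^ 2 + s ^ 2 = 1) (hcs' : c' ^ 2 + s' ^ 2 = 1)
    (hc : 0 ≤ c) (hs : 0 ≤ s) (hc' : 0 ≤ c') (hs' : 0 ≤ s')
    (hB : B₀ * B₁ - B₁ * B₀ = (4 * (c' * s')) • F) :
    √2 * (2 * c * φ (X * B₀) + 2 * s * φ (Z * B₁))
      ≤ (4 - ((1 - (c + s) / √2) + (1 - (c' + s') / √2))) * φ 1 := by
  have h2 : √2 * √2 = 2 := Real.mul_self_sqrt (by norm_num)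
  have h2p : 0 < √2 := by positivity
  have rX : ∀ y, X * (X * y) = y := fun y => by rw [← mul_assoc, hX2, one_mul]
  have rZ : ∀ y, Z * (Z * y) = y := fun y => by rw [← mul_assoc, hZ2, one_mul]
  have rF : ∀ y, F * (F * y) = -y := fun y => by rw [← mul_assoc, hF2]; simp
  have rXZ : ∀ y, Z * (X * y) = -(X * (Z * y)) := fun y => by
    rw [← mul_assoc, hXZ, neg_mul, mul_assoc]
  have r1 : ∀ y, B₀ * (X * y) = X * (B₀ * y) := fun y => by rw [← mul_assoc, c1, mul_assoc]
  have r2 : ∀ y, B₀ * (Z * y) = Z * (B₀ * y) := fun y => by rw [← mul_assoc, c2, mul_assoc]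
  have r3 : ∀ y, B₁ * (X * y) = X * (B₁ * y) := fun y => by rw [← mul_assoc, c3, mul_assoc]
  have r4 : ∀ y, B₁ * (Z * y) = Z * (B₁ * y) := fun y => by rw [← mul_assoc, c4, mul_assoc]
  have r5 : ∀ y, F * (X * y) = X * (F * y) := fun y => by rw [← mul_assoc, c5, mul_assoc]
  have r6 : ∀ y, F * (Z * y) = Z * (F * y) := fun y => by rw [← mul_assoc, c6, mul_assoc]
  have hG := map_le_map_one (φ := φ) hφ (G := X * Z * F)
    (by simp [hX, hZ, hF, c5, c6, rXZ, mul_assoc])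
    (by simp [mul_assoc, hX2, hZ2, hF2, r5, r6, rXZ])
  set C : 𝒜 := (2 * c) • (X * B₀) + (2 * s) • (Z * B₁) with hC
  have hCs : star C = C := by simp [hC, hX, hZ, hB₀, hB₁, c1, c4]
  have hB' : X * Z * (B₀ * B₁ - B₁ * B₀) = (4 * (c' * s')) • (X * Z * F) := by
    rw [hB, mul_smul_comm]
  -- Tsirelson's computation: beyond the scalar 4, the square of the CHSH operator contains only the
  -- product of the two commutators.
  have hC2 : C * C = (4 : ℝ) • (1 : 𝒜) + (4 * (c * s)) • ((4 * (c' * s')) • (X * Z * F)) := by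
    rw [← hB']
    have : C * C = (4 * c ^ 2 + 4 * s ^ 2) • (1 : 𝒜)
        + (4 * (c * s)) • (X * Z * (B₀ * B₁ - B₁ * B₀)) := by
      simp only [hC, add_mul, mul_add, mul_sub, smul_mul_assoc, mul_smul_comm, mul_assoc, hX2,
        hZ2, hB₀2, hB₁2, c4, r1, r2, r3, r4, rX, rZ, rXZ, mul_neg, mul_one]
      module
    rw [this]
    congr 2
    linarith
  -- Squaring C − 2√2, with 2√2 the maximal value, gives 4√2 φ(C) ≤ φ(C²) + 8φ(1).
  have h1 := map_mul_self_nonneg hφ (x := C - (2 * √2) • (1 : 𝒜)) (by simp [hCs])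
  have h3 : (C - (2 * √2) • (1 : 𝒜)) * (C - (2 * √2) • (1 : 𝒜))
      = C * C - (4 * √2) • C + (8 : ℝ) • (1 : 𝒜) := by
    simp only [sub_mul, mul_sub, smul_mul_assoc, mul_smul_comm, one_mul, mul_one, smul_smul,
      smul_sub]
    have : 2 * √2 * (2 * √2) = 8 := by nlinarith
    rw [this]
    module
  rw [h3, hC2] at h1
  have hφC : φ C = 2 * c * φ (X * B₀) + 2 * s * φ (Z * B₁) := by simp [hC]
  simp only [map_add, map_sub, map_smul, smul_eq_mul, hφC] at h1
  have h1n := map_one_nonneg hφ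
  have e1 : 0 ≤ 4 * (c * s) * (4 * (c' * s')) := by positivity
  have e2 := mul_le_mul_of_nonneg_left hG e1
  obtain ⟨a0, a1, a2⟩ := angle_defect_bounds hcs hc hs
  obtain ⟨b0, b1, b2⟩ := angle_defect_bounds hcs' hc' hs'
  set p := 1 - (c + s) / √2
  set q := 1 - (c' + s') / √2
  -- The left side is at most (1 − 2p)(1 − 2q), and the remaining gap is p(1 − 2q) + q(1 − 2p).
  have hpq : (2 * (c * s)) * (2 * (c' * s')) ≤ 1 - p - q := by
    have := mul_le_mul a1 b1 (by positivity) a2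
    nlinarith [mul_nonneg a0 b2, mul_nonneg b0 a2]
  have e3 := mul_le_mul_of_nonneg_right hpq h1n
  nlinarith

/-- Distance of a pair of stabilizers from their reference values, in terms of the deficit of
the CHSH operator. -/
theorem map_stabilizer_deficit_le (hφ : ∀ x, 0 ≤ φ (star x * x)) {X Z B₀ B₁ R₀ R₁ : 𝒜}
    (hX : star X = X) (hZ : star Z = Z) (hB₀ : star B₀ = B₀) (hB₁ : star B₁ = B₁)
    (hR₀ : star R₀ = R₀) (hR₁ : star R₁ = R₁)
    (hX2 : X * X = 1) (hZ2 : Z * Z = 1) (hB₀2 : B₀ * B₀ = 1) (hB₁2 : B₁ * B₁ = 1)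
    (hR₀2 : R₀ * R₀ = 1) (hR₁2 : R₁ * R₁ = 1)
    (c1 : B₀ * X = X * B₀) (c2 : B₁ * Z = Z * B₁) (c3 : R₀ * X = X * R₀) (c4 : R₁ * Z = Z * R₁)
    {c s δ : ℝ} (hcs : c ^ 2 + s ^ 2 = 1)
    (h0 : φ ((B₀ - R₀) * (B₀ - R₀)) ≤ δ * φ 1) (h1 : φ ((B₁ - R₁) * (B₁ - R₁)) ≤ δ * φ 1) :
    φ (1 - X * R₀) + φ (1 - Z * R₁)
      ≤ 3 / 2 * (4 * φ 1 - √2 * (2 * c * φ (X * B₀) + 2 * s * φ (Z * B₁))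
        + (8 * (1 - (c + s) / √2) + 2 * δ) * φ 1) := by
  have h2 : √2 * √2 = 2 := Real.mul_self_sqrt (by norm_num)
  have h1n := map_one_nonneg hφ
  have hdiv : ∀ x : ℝ, x / √2 = x * √2 / 2 := fun x => by
    rw [div_eq_div_iff (by positivity) (by norm_num)]; linear_combination -x * h2
  -- X − R is split as (√2 t X − B) + (1 − √2 t)X + (B − R): the CHSH deficit, the angle error and
  -- the observable error. The left side comes from (X − R)² = 2(1 − XR).
  have main : ∀ (X B R : 𝒜) (t : ℝ), star X = X → star B = B → star R = R → X * X = 1 →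
      B * B = 1 → R * R = 1 → B * X = X * B → R * X = X * R →
      φ ((B - R) * (B - R)) ≤ δ * φ 1 →
      φ (1 - X * R) ≤ 3 / 2 * ((2 * t ^ 2 + 1) * φ 1 - 2 * √2 * t * φ (X * B)
        + (1 - √2 * t) ^ 2 * φ 1 + δ * φ 1) := by
    intro X B R t hX hB hR hX2 hB2 hR2 cB cR hδ
    have key := map_add_three_sq_le hφ (x := (√2 * t) • X - B) (y := (1 - √2 * t) • X) (z := B - R)
      (by simp [hX, hB]) (by simp [hX]) (by simp [hB, hR])
    have e1 : (√2 * t) • X - B + (1 - √2 * t) • X + (B - R) = X - R := by module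
    have e2 : (X - R) * (X - R) = (2 : ℝ) • (1 - X * R) := by
      simp only [sub_mul, mul_sub, hX2, hR2, cR]; module
    have e3 : ((√2 * t) • X - B) * ((√2 * t) • X - B)
        = (2 * t ^ 2 + 1) • (1 : 𝒜) - (2 * √2 * t) • (X * B) := by
      simp only [sub_mul, mul_sub, smul_mul_assoc, mul_smul_comm, hX2, hB2, cB, smul_smul,
        smul_sub]
      have : √2 * t * (√2 * t) = 2 * t ^ 2 := by linear_combination t ^ 2 * h2
      rw [this]; module
    have e4 : ((1 - √2 * t) • X) * ((1 - √2 * t) • X) = ((1 - √2 * t) ^ 2) • (1 : 𝒜) := by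
      simp only [smul_mul_assoc, mul_smul_comm, hX2, smul_smul, sq]
    rw [e1, e2, e3, e4] at key
    simp only [map_sub, map_smul, smul_eq_mul] at key ⊢ hδ
    linarith
  have k0 := main X B₀ R₀ c hX hB₀ hR₀ hX2 hB₀2 hR₀2 c1 c3 h0
  have k1 := main Z B₁ R₁ s hZ hB₁ hR₁ hZ2 hB₁2 hR₁2 c2 c4 h1
  -- The squares (1 − √2 c)² and (1 − √2 s)² add up to exactly four times the angle defect.
  have e0 : (1 - √2 * c) ^ 2 ≤ 4 * (1 - (c + s) / √2) := by
    rw [hdiv]; nlinarith [sq_nonneg (1 - √2 * s)]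
  have e1 : (1 - √2 * s) ^ 2 ≤ 4 * (1 - (c + s) / √2) := by
    rw [hdiv]; nlinarith [sq_nonneg (1 - √2 * c)]
  have f0 := mul_le_mul_of_nonneg_right e0 h1n
  have f1 := mul_le_mul_of_nonneg_right e1 h1n
  have f2 : 2 * c ^ 2 * φ 1 + 2 * s ^ 2 * φ 1 = 2 * φ 1 := by linear_combination 2 * φ 1 * hcs
  linarith

end Positive

/-! ### Polynomial inequalities behind the two-party constant. -/

section Scalar

/-- Here s stands for √2. Modulo s² = 2, the expression expands in the products
gⁱ(1−g)³⁻ⁱ·hʲ(1−h)³⁻ʲ with coefficients that are nonnegative for s in the given interval. The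
coefficients at the corners (0,0) and (1,1) vanish, so the inequality is tight there. -/
theorem even_sector_poly_nonneg {g h s : ℝ} (hs : s ^ 2 = 2) (hs0 : 1.4142 ≤ s) (hs1 : s ≤ 1.4143)
    (hg : 0 ≤ g) (hg1 : 0 ≤ 1 - g) (hh : 0 ≤ h) (hh1 : 0 ≤ 1 - h) :
    0 ≤ (4 + 4 * s + 2 * g * h) ^ 2
      - ((1 + g) * (1 + h) - (5 + 2 * s) * ((1 + (s - 1) * g) * (1 + (s - 1) * h))) ^ 2
      - ((1 - g) * (1 - h)) ^ 2
      + 2 * (5 + 2 * s) * ((1 - g) * (1 - h)) * (((1 - g) * (1 + (2 - s) * g))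
        * ((1 - h) * (1 + (2 - s) * h)))
      - (5 + 2 * s) ^ 2 * (((1 - g) * (1 + (3 - 2 * s) * g))
        * ((1 - h) * (1 + (3 - 2 * s) * h))) := by
  have key : (4 + 4 * s + 2 * g * h) ^ 2
      - ((1 + g) * (1 + h) - (5 + 2 * s) * ((1 + (s - 1) * g) * (1 + (s - 1) * h))) ^ 2
      - ((1 - g) * (1 - h)) ^ 2
      + 2 * (5 + 2 * s) * ((1 - g) * (1 - h)) * (((1 - g) * (1 + (2 - s) * g))
        * ((1 - h) * (1 + (2 - s) * h)))
      - (5 + 2 * s) ^ 2 * (((1 - g) * (1 + (3 - 2 * s) * g))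
        * ((1 - h) * (1 + (3 - 2 * s) * h)))
      = (-18 + 14 * s) * ((1 - g) ^ 3 * (h ^ 2 * (1 - h))) + (-6 + 12 * s) * ((1 - g) ^ 3 * (h ^
        3)) + (-104 + 80 * s) * (g * (1 - g) ^ 2 * (h * (1 - h) ^ 2)) + (-142 + 114 * s) * (g *
        (1 - g) ^ 2 * (h ^ 2 * (1 - h))) + (2 + 16 * s) * (g * (1 - g) ^ 2 * (h ^ 3)) + (-18 +
        14 * s) * (g ^ 2 * (1 - g) * ((1 - h) ^ 3)) + (-142 + 114 * s) * (g ^ 2 * (1 - g) * (h *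
        (1 - h) ^ 2)) + (-116 + 104 * s) * (g ^ 2 * (1 - g) * (h ^ 2 * (1 - h))) + (8 + 4 * s) *
        (g ^ 2 * (1 - g) * (h ^ 3)) + (-6 + 12 * s) * (g ^ 3 * 1 * ((1 - h) ^ 3)) + (2 + 16 * s)
        * (g ^ 3 * 1 * (h * (1 - h) ^ 2)) + (8 + 4 * s) * (g ^ 3 * 1 * (h ^ 2 * (1 - h))) := by
    linear_combination (8 - 13 * h ^ 2 - 20 * h ^ 2 * s - 4 * h ^ 2 * s ^ 2 - 4 * h ^ 3 + 44 * g * h - 88 * g * h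
      * s - 32 * g * h * s ^ 2 - 40 * g * h ^ 2 + 66 * g * h ^ 2 * s - 8 * g * h ^ 2 * s ^ 3 + 2
      * g * h ^ 3 + 4 * g * h ^ 3 * s - 13 * g ^ 2 - 20 * g ^ 2 * s - 4 * g ^ 2 * s ^ 2 - 40 * g
      ^ 2 * h + 66 * g ^ 2 * h * s - 8 * g ^ 2 * h * s ^ 3 + 38 * g ^ 2 * h ^ 2 - 24 * g ^ 2 * h
      ^ 2 * s + 7 * g ^ 2 * h ^ 2 * s ^ 2 - 4 * g ^ 2 * h ^ 2 * s ^ 3 - 4 * g ^ 2 * h ^ 2 * s ^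
      4 + 8 * g ^ 2 * h ^ 3 - 8 * g ^ 2 * h ^ 3 * s - 4 * g ^ 3 + 2 * g ^ 3 * h + 4 * g ^ 3 * h
      * s + 8 * g ^ 3 * h ^ 2 - 8 * g ^ 3 * h ^ 2 * s - 6 * g ^ 3 * h ^ 3 + 4 * g ^ 3 * h ^ 3 *
      s) * hs
  rw [key]
  repeat' apply add_nonneg
  all_goals exact mul_nonneg (by linarith) (by positivity)

/-- As in the even sector, now in degree four. The square (g − h)² has to be split off first, since
it contributes a negative coefficient to g(1−g)³h(1−h)³. -/
theorem odd_sector_poly_nonneg {g h s : ℝ} (hs : s ^ 2 = 2) (hs0 : 1.4142 ≤ s) (hs1 : s ≤ 1.4143)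
    (hg : 0 ≤ g) (hg1 : 0 ≤ 1 - g) (hh : 0 ≤ h) (hh1 : 0 ≤ 1 - h) :
    0 ≤ (4 + 4 * s - 2 * g * h) ^ 2 - ((1 - g) * (1 + h)) ^ 2 - ((1 + g) * (1 - h)) ^ 2
      - (5 + 2 * s) ^ 2 * ((1 - g) * (1 + (3 - 2 * s) * g) * (1 + (s - 1) * h) ^ 2
        + (1 - h) * (1 + (3 - 2 * s) * h) * (1 + (s - 1) * g) ^ 2)
      + 2 * (5 + 2 * s) * ((1 - g) * (1 + h) * (1 + (s - 1) * h)
          * ((1 - g) * (1 + (2 - s) * g + (s - 1) * g ^ 2))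
        + (1 + g) * (1 - h) * (1 + (s - 1) * g)
          * ((1 - h) * (1 + (2 - s) * h + (s - 1) * h ^ 2))) := by
  have key : (4 + 4 * s - 2 * g * h) ^ 2 - ((1 - g) * (1 + h)) ^ 2 - ((1 + g) * (1 - h)) ^ 2
      - (5 + 2 * s) ^ 2 * ((1 - g) * (1 + (3 - 2 * s) * g) * (1 + (s - 1) * h) ^ 2
        + (1 - h) * (1 + (3 - 2 * s) * h) * (1 + (s - 1) * g) ^ 2)
      + 2 * (5 + 2 * s) * ((1 - g) * (1 + h) * (1 + (s - 1) * h)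
          * ((1 - g) * (1 + (2 - s) * g + (s - 1) * g ^ 2))
        + (1 + g) * (1 - h) * (1 + (s - 1) * g)
          * ((1 - h) * (1 + (2 - s) * h + (s - 1) * h ^ 2)))
      = (40 * s - 52) * (g - h) ^ 2 + ((32 - 20 * s) * ((1 - g) ^ 4 * (h ^ 2 * (1 - h) ^ 2)) + (80 - 54 * s) * ((1 - g) ^ 4 *
        (h ^ 3 * (1 - h))) + (46 - 28 * s) * ((1 - g) ^ 4 * (h ^ 4)) + (20 + 6 * s) * (g * (1 -
        g) ^ 3 * (h ^ 2 * (1 - h) ^ 2)) + (76 - 28 * s) * (g * (1 - g) ^ 3 * (h ^ 3 * (1 - h)))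
        + (60 - 12 * s) * (g * (1 - g) ^ 3 * (h ^ 4)) + (32 - 20 * s) * (g ^ 2 * (1 - g) ^ 2 *
        ((1 - h) ^ 4)) + (20 + 6 * s) * (g ^ 2 * (1 - g) ^ 2 * (h * (1 - h) ^ 3)) + (-12 + 104 *
        s) * (g ^ 2 * (1 - g) ^ 2 * (h ^ 2 * (1 - h) ^ 2)) + (12 + 104 * s) * (g ^ 2 * (1 - g) ^
        2 * (h ^ 3 * (1 - h))) + (50 + 48 * s) * (g ^ 2 * (1 - g) ^ 2 * (h ^ 4)) + (80 - 54 * s)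
        * (g ^ 3 * (1 - g) * ((1 - h) ^ 4)) + (76 - 28 * s) * (g ^ 3 * (1 - g) * (h * (1 - h) ^
        3)) + (12 + 104 * s) * (g ^ 3 * (1 - g) * (h ^ 2 * (1 - h) ^ 2)) + (8 + 128 * s) * (g ^
        3 * (1 - g) * (h ^ 3 * (1 - h))) + (48 + 52 * s) * (g ^ 3 * (1 - g) * (h ^ 4)) + (46 -
        28 * s) * (g ^ 4 * 1 * ((1 - h) ^ 4)) + (60 - 12 * s) * (g ^ 4 * 1 * (h * (1 - h) ^ 3))
        + (50 + 48 * s) * (g ^ 4 * 1 * (h ^ 2 * (1 - h) ^ 2)) + (48 + 52 * s) * (g ^ 4 * 1 * (h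
        ^ 3 * (1 - h))) + (36 + 16 * s) * (g ^ 4 * 1 * (h ^ 4))) := by
    linear_combination (8 - 9 * h ^ 2 - 20 * h ^ 2 * s - 4 * h ^ 2 * s ^ 2 - 12 * h ^ 3 + 4 * h ^ 4 - 44 * g * h +
      88 * g * h * s + 32 * g * h * s ^ 2 + 46 * g * h ^ 2 - 62 * g * h ^ 2 * s + 8 * g * h ^ 2
      * s ^ 3 - 14 * g * h ^ 3 - 12 * g * h ^ 3 * s + 6 * g * h ^ 4 + 4 * g * h ^ 4 * s - 9 * g
      ^ 2 - 20 * g ^ 2 * s - 4 * g ^ 2 * s ^ 2 + 46 * g ^ 2 * h - 62 * g ^ 2 * h * s + 8 * g ^ 2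
      * h * s ^ 3 + 10 * g ^ 2 * h ^ 2 + 108 * g ^ 2 * h ^ 2 * s - 24 * g ^ 2 * h ^ 2 * s ^ 2 -
      16 * g ^ 2 * h ^ 2 * s ^ 3 - 2 * g ^ 2 * h ^ 3 - 12 * g ^ 2 * h ^ 3 * s + 2 * g ^ 2 * h ^
      4 + 4 * g ^ 2 * h ^ 4 * s - 12 * g ^ 3 - 14 * g ^ 3 * h - 12 * g ^ 3 * h * s - 2 * g ^ 3 *
      h ^ 2 - 12 * g ^ 3 * h ^ 2 * s + 4 * g ^ 4 + 6 * g ^ 4 * h + 4 * g ^ 4 * h * s + 2 * g ^ 4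
      * h ^ 2 + 4 * g ^ 4 * h ^ 2 * s) * hs
  rw [key]
  repeat' apply add_nonneg
  all_goals exact mul_nonneg (by linarith) (by positivity)

/-- The slope 2 − s makes the left side agree with the square root v to first order at g = 0. -/
theorem linear_le_of_sq {g s v : ℝ} (hs0 : 1.4142 ≤ s) (hs1 : s ≤ 1.4143)
    (hg : 0 ≤ g) (hg1 : 0 ≤ 1 - g) (hv : 0 ≤ v)
    (hv2 : v ^ 2 = (1 - g) * (1 + (3 - 2 * s) * g)) :
    (1 - g) * (1 + (2 - s) * g) ≤ v := by
  refine le_of_sq_le_sq ?_ hv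
  have h : 0 ≤ (1 - g) * (g ^ 2 * ((2 - s) * s) + (2 - s) ^ 2 * g ^ 3) := by
    have : 0 ≤ (2 - s) * s := mul_nonneg (by linarith) (by linarith)
    positivity
  rw [hv2]
  linarith

/-- The extra term (s − 1)g² extends the agreement with v to second order, using s² = 2. -/
theorem quadratic_le_of_sq {g s v : ℝ} (hs : s ^ 2 = 2) (hs0 : 1.4142 ≤ s) (hs1 : s ≤ 1.4143)
    (hg : 0 ≤ g) (hg1 : 0 ≤ 1 - g) (hv : 0 ≤ v)
    (hv2 : v ^ 2 = (1 - g) * (1 + (3 - 2 * s) * g)) :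
    (1 - g) * (1 + (2 - s) * g + (s - 1) * g ^ 2) ≤ v := by
  refine le_of_sq_le_sq ?_ hv
  have h : 0 ≤ (1 - g) * (g ^ 3 * ((2 - s) ^ 2 + 2 * (s - 1) ^ 2)
      + g ^ 4 * ((s - 1) * (5 - 3 * s)) + (s - 1) ^ 2 * g ^ 5) := by
    have : 0 ≤ (s - 1) * (5 - 3 * s) := mul_nonneg (by linarith) (by linarith)
    positivity
  rw [hv2]
  linear_combination h + (1 - g) * g ^ 2 * hs

/-- After expansion the roots v, w survive only in a mixed term with negative sign, so a lower bound
on vw suffices; v² and w² are polynomials. -/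
theorem even_sector_le {g h s v w : ℝ} (hs : s ^ 2 = 2) (hs0 : 1.4142 ≤ s) (hs1 : s ≤ 1.4143)
    (hg : 0 ≤ g) (hg1 : 0 ≤ 1 - g) (hh : 0 ≤ h) (hh1 : 0 ≤ 1 - h) (hv : 0 ≤ v) (hw : 0 ≤ w)
    (hv2 : v ^ 2 = (1 - g) * (1 + (3 - 2 * s) * g))
    (hw2 : w ^ 2 = (1 - h) * (1 + (3 - 2 * s) * h)) :
    ((1 + g) * (1 + h) - (5 + 2 * s) * ((1 + (s - 1) * g) * (1 + (s - 1) * h))) ^ 2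
      + ((1 - g) * (1 - h) - (5 + 2 * s) * (v * w)) ^ 2 ≤ (4 + 4 * s + 2 * g * h) ^ 2 := by
  have h1 := linear_le_of_sq hs0 hs1 hg hg1 hv hv2
  have h2 := linear_le_of_sq hs0 hs1 hh hh1 hw hw2
  have p := even_sector_poly_nonneg hs hs0 hs1 hg hg1 hh hh1
  have a : 0 ≤ 2 - s := by linarith
  have h3 := mul_le_mul h1 h2 (by positivity) hv
  have h4 := mul_le_mul_of_nonneg_left h3
    (show 0 ≤ 2 * (5 + 2 * s) * ((1 - g) * (1 - h)) by positivity)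
  rw [← hv2, ← hw2] at p
  linarith

/-- Here v and w survive in two separate mixed terms with negative signs; the second-order lower
bounds apply to both. -/
theorem odd_sector_le {g h s v w : ℝ} (hs : s ^ 2 = 2) (hs0 : 1.4142 ≤ s) (hs1 : s ≤ 1.4143)
    (hg : 0 ≤ g) (hg1 : 0 ≤ 1 - g) (hh : 0 ≤ h) (hh1 : 0 ≤ 1 - h) (hv : 0 ≤ v) (hw : 0 ≤ w)
    (hv2 : v ^ 2 = (1 - g) * (1 + (3 - 2 * s) * g))
    (hw2 : w ^ 2 = (1 - h) * (1 + (3 - 2 * s) * h)) :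
    ((1 - g) * (1 + h) - (5 + 2 * s) * (v * (1 + (s - 1) * h))) ^ 2
      + ((1 + g) * (1 - h) - (5 + 2 * s) * ((1 + (s - 1) * g) * w)) ^ 2
      ≤ (4 + 4 * s - 2 * g * h) ^ 2 := by
  have h1 := quadratic_le_of_sq hs hs0 hs1 hg hg1 hv hv2
  have h2 := quadratic_le_of_sq hs hs0 hs1 hh hh1 hw hw2
  have p := odd_sector_poly_nonneg hs hs0 hs1 hg hg1 hh hh1
  have a : 0 ≤ s - 1 := by linarith
  have h3 := mul_le_mul_of_nonneg_left h1
    (show 0 ≤ 2 * (5 + 2 * s) * ((1 - g) * (1 + h) * (1 + (s - 1) * h)) by positivity)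
  have h4 := mul_le_mul_of_nonneg_left h2
    (show 0 ≤ 2 * (5 + 2 * s) * ((1 + g) * (1 - h) * (1 + (s - 1) * g)) by positivity)
  rw [← hv2, ← hw2] at p
  linarith

end Scalar

noncomputable section

/-! ### Pauli operators, reference axes and reference observables. -/

section Qubit

theorem ofReal_sqrt_two_sq : ((√2 : ℝ) : ℂ) * ((√2 : ℝ) : ℂ) = 2 := by
  rw [← Complex.ofReal_mul, Real.mul_self_sqrt (by norm_num)]; norm_num

theorem inv_sqrt_two_mul_self : ((√2 : ℝ) : ℂ)⁻¹ * ((√2 : ℝ) : ℂ)⁻¹ = 2⁻¹ := by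
  rw [← mul_inv, ofReal_sqrt_two_sq]

theorem pauliX_conjTranspose : pauliXᴴ = pauliX := by
  ext i j; fin_cases i <;> fin_cases j <;> simp [pauliX]

theorem pauliZ_conjTranspose : pauliZᴴ = pauliZ := by
  ext i j; fin_cases i <;> fin_cases j <;> simp [pauliZ]

theorem pauliX_mul_self : pauliX * pauliX = 1 := by
  ext i j; fin_cases i <;> fin_cases j <;> simp [pauliX]

theorem pauliZ_mul_self : pauliZ * pauliZ = 1 := by
  ext i j; fin_cases i <;> fin_cases j <;> simp [pauliZ]

theorem pauliZ_mul_pauliX : pauliZ * pauliX = -(pauliX * pauliZ) := by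
  ext i j; fin_cases i <;> fin_cases j <;> simp [pauliX, pauliZ]

variable {n : ℕ} [NeZero n]

theorem axis_conjTranspose (j : Fin n) (i : Fin 2) : (axis j i)ᴴ = axis j i := by
  unfold axis
  split_ifs <;>
    simp [pauliX_conjTranspose, pauliZ_conjTranspose, Matrix.conjTranspose_smul]

theorem axis_mul_self (j : Fin n) (i : Fin 2) : axis j i * axis j i = 1 := by
  unfold axis
  split_ifs <;>
    simp only [pauliX_mul_self, pauliZ_mul_self, smul_mul_assoc, mul_smul_comm, smul_smul,
      smul_add, smul_sub, smul_neg, inv_sqrt_two_mul_self, mul_add, add_mul, mul_sub, sub_mul,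
      pauliZ_mul_pauliX] <;>
    module

theorem axis_one_mul_axis_zero (j : Fin n) : axis j 1 * axis j 0 = -(axis j 0 * axis j 1) := by
  by_cases hj : j = 0
  · simp only [axis, hj, if_true, one_ne_zero, if_false, pauliZ_mul_pauliX]
  · simp only [axis, hj, if_true, one_ne_zero, if_false, pauliX_mul_self, pauliZ_mul_self,
      smul_mul_assoc, mul_smul_comm, smul_smul, smul_add, smul_sub, smul_neg,
      inv_sqrt_two_mul_self, mul_add, add_mul, mul_sub, sub_mul, pauliZ_mul_pauliX]
    module

theorem refObs_zero (j : Fin n) (α : ℝ) : refObs j α 0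
    = ((Real.cos α : ℝ) : ℂ) • axis j 0 + ((Real.sin α : ℝ) : ℂ) • axis j 1 := by
  simp [refObs]

theorem refObs_one (j : Fin n) (α : ℝ) : refObs j α 1
    = ((Real.cos α : ℝ) : ℂ) • axis j 0 - ((Real.sin α : ℝ) : ℂ) • axis j 1 := by
  simp [refObs, sub_eq_add_neg]

theorem refObs_conjTranspose (j : Fin n) (α : ℝ) (x : Fin 2) :
    (refObs j α x)ᴴ = refObs j α x := by
  fin_cases x <;>
  simp [refObs, Matrix.conjTranspose_smul, axis_conjTranspose, ← Complex.ofReal_cos,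
    ← Complex.ofReal_sin, -Complex.ofReal_cos, -Complex.ofReal_sin]

theorem ofReal_cos_sq_add_sin_sq (α : ℝ) : ((Real.cos α : ℝ) : ℂ) * ((Real.cos α : ℝ) : ℂ)
    + ((Real.sin α : ℝ) : ℂ) * ((Real.sin α : ℝ) : ℂ) = 1 := by
  rw [← Complex.ofReal_mul, ← Complex.ofReal_mul, ← Complex.ofReal_add]
  have := Real.cos_sq_add_sin_sq α
  rw [show Real.cos α * Real.cos α + Real.sin α * Real.sin α = 1 by linarith, Complex.ofReal_one]

theorem refObs_mul_self (j : Fin n) (α : ℝ) (x : Fin 2) :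
    refObs j α x * refObs j α x = 1 := by
  have h := ofReal_cos_sq_add_sin_sq α
  rw [← one_smul ℂ (1 : QubitOp), ← h]
  fin_cases x
  · simp only [Fin.zero_eta, refObs_zero, mul_add, add_mul, smul_mul_assoc, mul_smul_comm,
      axis_mul_self, axis_one_mul_axis_zero]
    module
  · simp only [Fin.mk_one, refObs_one, mul_sub, sub_mul, smul_mul_assoc, mul_smul_comm,
      axis_mul_self, axis_one_mul_axis_zero]
    module

/-- `[A₀, A₁] = -4 cos α sin α · axis₀ axis₁`. -/
theorem refObs_commutator (j : Fin n) (α : ℝ) :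
    refObs j α 0 * refObs j α 1 - refObs j α 1 * refObs j α 0
      = -((4 * (Real.cos α * Real.sin α) : ℝ) : ℂ) • (axis j 0 * axis j 1) := by
  simp only [refObs_zero, refObs_one, mul_add, add_mul, mul_sub, sub_mul, smul_mul_assoc,
    mul_smul_comm, axis_mul_self, axis_one_mul_axis_zero]
  push_cast
  module

/-- Away from the first site, `σ_X` is the normalized sum of the two axes. -/
theorem pauliX_eq_axis {j : Fin n} (hj : j ≠ 0) :
    pauliX = ((√2 : ℝ) : ℂ)⁻¹ • (axis j 0 + axis j 1) := by
  simp only [axis, if_neg hj, if_true, one_ne_zero, if_false, ← smul_add, smul_smul,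
    inv_sqrt_two_mul_self]
  module

theorem pauliZ_eq_axis {j : Fin n} (hj : j ≠ 0) :
    pauliZ = ((√2 : ℝ) : ℂ)⁻¹ • (axis j 0 - axis j 1) := by
  simp only [axis, if_neg hj, if_true, one_ne_zero, if_false, ← smul_sub, smul_smul,
    inv_sqrt_two_mul_self]
  module

theorem pauliX_mul_pauliZ_eq_axis {j : Fin n} (hj : j ≠ 0) :
    pauliX * pauliZ = -(axis j 0 * axis j 1) := by
  rw [pauliX_eq_axis hj, pauliZ_eq_axis hj]
  simp only [mul_add, add_mul, mul_sub, sub_mul, smul_mul_assoc, mul_smul_comm, smul_smul,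
    smul_add, smul_sub, smul_neg, inv_sqrt_two_mul_self, axis_mul_self, axis_one_mul_axis_zero]
  module

theorem axis_zero_zero : axis (0 : Fin n) 0 = pauliX := by simp [axis]

theorem axis_zero_one : axis (0 : Fin n) 1 = pauliZ := by simp [axis]

/-- Defect `1 - cos (α - π/4)` of the angle `α`. -/
def angleDefect (α : ℝ) : ℝ := 1 - (Real.cos α + Real.sin α) / √2

/-- Two unit Bloch vectors at angle α − π/4 have squared distance 2 − 2cos(α − π/4). -/
theorem refObs_sub_sq {j : Fin n} {α : ℝ} {x : Fin 2} {P : QubitOp}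
    (hP : P = ((√2 : ℝ) : ℂ)⁻¹ • (axis j 0 + (-1 : ℂ) ^ (x : ℕ) • axis j 1)) :
    (refObs j α x - P) * (refObs j α x - P) = ((2 * angleDefect α : ℝ) : ℂ) • (1 : QubitOp) := by
  have h := ofReal_cos_sq_add_sin_sq α
  have hr : ((2 * angleDefect α : ℝ) : ℂ) = (((Real.cos α : ℝ) : ℂ) * ((Real.cos α : ℝ) : ℂ)
    + ((Real.sin α : ℝ) : ℂ) * ((Real.sin α : ℝ) : ℂ))
    - 2 * ((√2 : ℝ) : ℂ)⁻¹ * (((Real.cos α : ℝ) : ℂ) + ((Real.sin α : ℝ) : ℂ))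
    + 2 * (((√2 : ℝ) : ℂ)⁻¹ * ((√2 : ℝ) : ℂ)⁻¹) := by
    rw [h, inv_sqrt_two_mul_self, angleDefect]
    push_cast
    ring
  rw [hr, hP]
  generalize ((√2 : ℝ) : ℂ)⁻¹ = t
  fin_cases x
  · simp only [Fin.zero_eta, refObs_zero, mul_add, add_mul, mul_sub, sub_mul, smul_mul_assoc,
      mul_smul_comm, axis_mul_self, axis_one_mul_axis_zero, Fin.val_zero, pow_zero, one_smul]
    module
  · simp only [Fin.mk_one, refObs_one, mul_add, add_mul, mul_sub, sub_mul, smul_mul_assoc,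
      mul_smul_comm, axis_mul_self, axis_one_mul_axis_zero, Fin.val_one, pow_one]
    module

end Qubit

/-! ### The dephasing maps and their action on the axes. -/

section Dephasing

variable {n : ℕ} [NeZero n]

/-- g is affine in cos α + sin α with value 1 at α = π/4, so the strength of the dephasing is
proportional to the angle defect. -/
theorem one_sub_dephasingWeight (α : ℝ) : 1 - dephasingWeight α = (2 + √2) * angleDefect α := by
  have h2 : √2 * √2 = 2 := Real.mul_self_sqrt (by norm_num)
  have hd : (Real.cos α + Real.sin α) / √2 = (Real.cos α + Real.sin α) * √2 / 2 := by
    rw [div_eq_div_iff (by positivity) (by norm_num), mul_assoc, h2]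
  rw [dephasingWeight, angleDefect, hd]
  linear_combination (Real.sin α + Real.cos α) / 2 * h2

theorem angleDefect_nonneg {α : ℝ} : 0 ≤ angleDefect α := by
  have h2 : √2 ^ 2 = 2 := Real.sq_sqrt (by norm_num)
  rw [angleDefect, sub_nonneg, div_le_one (by positivity)]
  refine le_of_sq_le_sq ?_ (by positivity)
  nlinarith [sq_nonneg (Real.cos α - Real.sin α), Real.cos_sq_add_sin_sq α]

theorem dephasingWeight_le_one {α : ℝ} : dephasingWeight α ≤ 1 := by
  have := mul_nonneg (show 0 ≤ 2 + √2 by positivity) (angleDefect_nonneg (α := α))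
  linarith [one_sub_dephasingWeight α]

theorem sin_cos_nonneg {α : ℝ} (h : α ∈ Set.Icc 0 (Real.pi / 2)) :
    0 ≤ Real.sin α ∧ 0 ≤ Real.cos α :=
  ⟨Real.sin_nonneg_of_nonneg_of_le_pi h.1 (by linarith [h.2, Real.pi_pos]),
    Real.cos_nonneg_of_neg_pi_div_two_le_of_le (by linarith [h.1, Real.pi_pos]) h.2⟩

theorem dephasingWeight_nonneg {α : ℝ} (h : α ∈ Set.Icc 0 (Real.pi / 2)) :
    0 ≤ dephasingWeight α := by
  obtain ⟨hs, hc⟩ := sin_cos_nonneg h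
  refine mul_nonneg (by positivity) ?_
  nlinarith [Real.cos_sq_add_sin_sq α, mul_nonneg hs hc]

/-- Kraus operators of the dephasing map. -/
def dephasingKraus (j : Fin n) (α : ℝ) (i : Fin 2) : QubitOp :=
  if i = 0 then ((√((1 + dephasingWeight α) / 2) : ℝ) : ℂ) • 1
  else ((√((1 - dephasingWeight α) / 2) : ℝ) : ℂ) • dephasingAxis j α

theorem dephasingAxis_conjTranspose (j : Fin n) (α : ℝ) :
    (dephasingAxis j α)ᴴ = dephasingAxis j α := by
  unfold dephasingAxis; split_ifs <;> exact axis_conjTranspose _ _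

theorem dephasingAxis_mul_self (j : Fin n) (α : ℝ) :
    dephasingAxis j α * dephasingAxis j α = 1 := by
  unfold dephasingAxis; split_ifs <;> exact axis_mul_self _ _

theorem dephasingKraus_conjTranspose (j : Fin n) (α : ℝ) (i : Fin 2) :
    (dephasingKraus j α i)ᴴ = dephasingKraus j α i := by
  unfold dephasingKraus
  split_ifs <;> simp [Matrix.conjTranspose_smul, dephasingAxis_conjTranspose]

theorem sum_dephasingKraus {j : Fin n} {α : ℝ} (h : α ∈ Set.Icc 0 (Real.pi / 2)) (X : QubitOp) :
    ∑ i, dephasingKraus j α i * X * dephasingKraus j α i = dephasing j α X := by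
  have h0 := dephasingWeight_nonneg h
  have h1 := dephasingWeight_le_one (α := α)
  simp only [Fin.sum_univ_two, dephasingKraus, if_true, one_ne_zero, if_false, smul_mul_assoc,
    mul_smul_comm, smul_smul, one_mul, mul_one, ← Complex.ofReal_mul]
  rw [Real.mul_self_sqrt (by linarith), Real.mul_self_sqrt (by linarith), dephasing]

/-- The dephasing map as a linear map. -/
def dephasingLin (j : Fin n) (α : ℝ) : QubitOp →ₗ[ℂ] QubitOp where
  toFun := dephasing j α
  map_add' X Y := by
    simp only [dephasing, mul_add, add_mul, smul_add]; abel
  map_smul' c X := by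
    simp only [dephasing, smul_mul_assoc, mul_smul_comm, smul_add, RingHom.id_apply]
    module

theorem dephasingLin_apply (j : Fin n) (α : ℝ) (X : QubitOp) :
    dephasingLin j α X = dephasing j α X := rfl

/-- Action of the dephasing map on the axes: the axis `Γ(α)` is kept, the other one shrinks. -/
theorem dephasing_axes (j : Fin n) {α : ℝ} (h : α ∈ Set.Icc 0 (Real.pi / 2)) :
    ∃ k₀ k₁ τ v : ℝ, 0 ≤ v ∧ τ ^ 2 = 1 ∧ k₀ + k₁ = 1 + dephasingWeight α ∧
      k₀ - k₁ = τ * (1 - dephasingWeight α) ∧ Real.cos α - Real.sin α = τ * v ∧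
      dephasingLin j α 1 = 1 ∧
      dephasingLin j α (axis j 0) = (k₀ : ℂ) • axis j 0 ∧
      dephasingLin j α (axis j 1) = (k₁ : ℂ) • axis j 1 ∧
      dephasingLin j α (axis j 0 * axis j 1)
        = (dephasingWeight α : ℂ) • (axis j 0 * axis j 1) := by
  have a0 : axis j 0 * axis j 0 * axis j 0 = axis j 0 := by rw [axis_mul_self, one_mul]
  have a1 : axis j 1 * axis j 1 * axis j 1 = axis j 1 := by rw [axis_mul_self, one_mul]
  have a2 : axis j 0 * axis j 1 * axis j 0 = -axis j 1 := by
    rw [mul_assoc, axis_one_mul_axis_zero, mul_neg, ← mul_assoc, axis_mul_self, one_mul]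
  have a3 : axis j 1 * axis j 0 * axis j 1 = -axis j 0 := by
    rw [axis_one_mul_axis_zero, neg_mul, mul_assoc, axis_mul_self, mul_one]
  have a4 : axis j 0 * (axis j 0 * axis j 1) * axis j 0 = -(axis j 0 * axis j 1) := by
    rw [← mul_assoc, axis_mul_self, one_mul, axis_one_mul_axis_zero]
  have a5 : axis j 1 * (axis j 0 * axis j 1) * axis j 1 = -(axis j 0 * axis j 1) := by
    rw [mul_assoc, mul_assoc, axis_mul_self, mul_one, axis_one_mul_axis_zero]
  -- τ is a sign for cos α − sin α and v its absolute value, so both choices of Γ lead to the same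
  -- scalar problem.
  by_cases hα : α ≤ Real.pi / 4
  · have hle : Real.sin α ≤ Real.cos α := by
      rw [← Real.cos_pi_div_two_sub]
      exact Real.cos_le_cos_of_nonneg_of_le_pi h.1 (by linarith [h.1, Real.pi_pos])
        (by linarith)
    refine ⟨1, dephasingWeight α, 1, Real.cos α - Real.sin α, by linarith, by norm_num, rfl,
      by ring, by ring, ?_, ?_, ?_, ?_⟩ <;>
    simp only [dephasingLin_apply, dephasing, dephasingAxis, if_pos hα, mul_one, axis_mul_self,
      one_mul, a2, a4] <;> push_cast <;> module
  · have hle : Real.cos α ≤ Real.sin α := by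
      rw [← Real.cos_pi_div_two_sub]
      exact Real.cos_le_cos_of_nonneg_of_le_pi (by linarith [h.2]) (by linarith [h.2, h.1, Real.pi_pos])
        (by linarith)
    refine ⟨dephasingWeight α, 1, -1, Real.sin α - Real.cos α, by linarith, by norm_num,
      by ring, by ring, by ring, ?_, ?_, ?_, ?_⟩ <;>
    simp only [dephasingLin_apply, dephasing, dephasingAxis, if_neg hα, mul_one, axis_mul_self,
      one_mul, a3, a5] <;> push_cast <;> module

/-- The tensor product of the (self-dual) dephasing maps, in Kraus form. -/
def dephaseAll (α : Fin n → ℝ) (X : NQubitOp n) : NQubitOp n :=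
  ∑ f : Fin n → Fin 2, (tensorOp (fun j => dephasingKraus j (α j) (f j)))ᴴ * X
    * tensorOp (fun j => dephasingKraus j (α j) (f j))

theorem dephaseAll_tensorOp {α : Fin n → ℝ} (h : ∀ j, α j ∈ Set.Icc 0 (Real.pi / 2))
    (A : Fin n → QubitOp) :
    dephaseAll α (tensorOp A) = tensorOp (fun j => dephasingLin j (α j) (A j)) := by
  rw [dephaseAll, sum_kraus_dual_tensorOp]
  simp only [dephasingKraus_conjTranspose, sum_dephasingKraus (h _), dephasingLin_apply]

theorem dephaseAll_add (α : Fin n → ℝ) (X Y : NQubitOp n) :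
    dephaseAll α (X + Y) = dephaseAll α X + dephaseAll α Y := by
  simp only [dephaseAll, mul_add, add_mul, Finset.sum_add_distrib]

theorem dephaseAll_smul (α : Fin n → ℝ) (c : ℂ) (X : NQubitOp n) :
    dephaseAll α (c • X) = c • dephaseAll α X := by
  simp only [dephaseAll, mul_smul_comm, smul_mul_assoc, Finset.smul_sum]

end Dephasing

/-! ### Operators on a single tensor factor. -/

section Site

variable {n : ℕ}

/-- The operator `A` on the qubit `j`. -/
def siteOp (j : Fin n) (A : QubitOp) : NQubitOp n :=
  tensorOp (Function.update (fun _ => 1) j A)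

theorem siteOp_add (j : Fin n) (A B : QubitOp) : siteOp j (A + B) = siteOp j A + siteOp j B :=
  tensorOp_update_add _ _ _ _

theorem siteOp_smul (j : Fin n) (c : ℂ) (A : QubitOp) : siteOp j (c • A) = c • siteOp j A :=
  tensorOp_update_smul _ _ _ _

theorem siteOp_neg (j : Fin n) (A : QubitOp) : siteOp j (-A) = -siteOp j A := by
  rw [← neg_one_smul ℂ A, siteOp_smul, neg_one_smul]

theorem siteOp_sub (j : Fin n) (A B : QubitOp) : siteOp j (A - B) = siteOp j A - siteOp j B := by
  rw [sub_eq_add_neg, siteOp_add, siteOp_neg, sub_eq_add_neg]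

theorem siteOp_one (j : Fin n) : siteOp j 1 = 1 := by
  rw [siteOp, Function.update_eq_self_iff.mpr rfl, tensorOp_one]

theorem siteOp_mul (j : Fin n) (A B : QubitOp) : siteOp j A * siteOp j B = siteOp j (A * B) := by
  rw [siteOp, siteOp, siteOp, tensorOp_mul]
  congr 1
  funext k
  by_cases h : k = j
  · subst h; simp
  · simp [h]

theorem siteOp_star (j : Fin n) (A : QubitOp) : star (siteOp j A) = siteOp j Aᴴ := by
  rw [Matrix.star_eq_conjTranspose, siteOp, siteOp, tensorOp_conjTranspose]
  congr 1
  funext k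
  by_cases h : k = j
  · subst h; simp
  · simp [h]

/-- Operators acting on disjoint sets of qubits commute. -/
theorem tensorOp_comm {A B : Fin n → QubitOp} (h : ∀ j, A j = 1 ∨ B j = 1) :
    tensorOp A * tensorOp B = tensorOp B * tensorOp A := by
  rw [tensorOp_mul, tensorOp_mul]
  congr 1
  funext j
  rcases h j with h | h <;> simp [h]

theorem siteOp_comm {j k : Fin n} (h : j ≠ k) (A B : QubitOp) :
    siteOp j A * siteOp k B = siteOp k B * siteOp j A :=
  tensorOp_comm fun i => by
    by_cases hi : i = j
    · right; rw [Function.update_of_ne (by rw [hi]; exact h)]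
    · left; rw [Function.update_of_ne hi]

theorem tensorOp_fin_two (A : Fin 2 → QubitOp) :
    tensorOp A = siteOp 0 (A 0) * siteOp 1 (A 1) := by
  rw [siteOp, siteOp, tensorOp_mul]
  congr 1
  funext j
  fin_cases j <;> simp

end Site

/-! ### The success operator as a function of observables. -/

section Success

variable {n : ℕ} [NeZero n]

/-- `successOp` as a function of the observables `A j x` of the senders. -/
def successOpOf (A : Fin n → Fin 2 → QubitOp) (s : Fin n → Fin 2) : NQubitOp n :=
  (((n : ℂ) - 1) * (-1) ^ (s 0 : ℕ)) •
      tensorOp (fun k => if k = 0 then A 0 0 + A 0 1 else A k 0)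
    + ∑ j ∈ Finset.univ.filter (fun j : Fin n => j ≠ 0), ((-1 : ℂ) ^ (s j : ℕ)) •
        tensorOp (fun k => if k = 0 then A 0 0 - A 0 1 else if k = j then A j 1 else 1)

theorem successOp_eq (ρ : Fin n → Fin 2 → Fin 2 → QubitOp) (s : Fin n → Fin 2) :
    successOp ρ s = successOpOf (fun j => senderObs (ρ j)) s := rfl

theorem reTraceMul_ofReal_smul {ι : Type*} [Fintype ι] (B X : Matrix ι ι ℂ) (c : ℝ) :
    reTraceMul B ((c : ℂ) • X) = c * reTraceMul B X := by
  simp [reTraceMul_apply, Matrix.smul_mul, Matrix.trace_smul]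

/-- The sign `(-1)^b` of a bit. -/
def bitSign (b : Fin 2) : ℝ := (-1) ^ (b : ℕ)

theorem bitSign_mul_self (b : Fin 2) : bitSign b * bitSign b = 1 := by
  fin_cases b <;> simp [bitSign]

theorem ofReal_bitSign (b : Fin 2) : ((bitSign b : ℝ) : ℂ) = (-1) ^ (b : ℕ) := by
  simp [bitSign]

end Success

/-! ### The operator inequality for two parties. -/

section TwoQubits

/-- The stabilizer expansion: the group generated by the signed XX and ZZ, averaged over its four
elements. The identity is checked entry by entry. -/
theorem ghzProj_two (s : Fin 2 → Fin 2) :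
    ghzProj s = ((1 / 4 : ℝ) : ℂ) • (1
      + (bitSign (s 0) : ℂ) • tensorOp (fun _ => pauliX)
      + (bitSign (s 1) : ℂ) • tensorOp (fun _ => pauliZ)
      + ((bitSign (s 0) * bitSign (s 1) : ℝ) : ℂ) • tensorOp (fun _ => pauliX * pauliZ)) := by
  have hv : ∀ b : Fin 2 → Fin 2, ghzVec s b = ((√2 : ℝ) : ℂ)⁻¹ *
      ((if b 0 = 0 ∧ b 1 = s 1 then 1 else 0)
        + (-1) ^ (s 0 : ℕ) * (if b 0 = 1 ∧ b 1 = 1 - s 1 then 1 else 0)) := fun b => by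
    simp [ghzVec, funext_iff, Fin.forall_fin_two]
  rw [← tensorOp_one]
  ext a b
  have ht := inv_sqrt_two_mul_self
  have hstar : star (((√2 : ℝ) : ℂ)⁻¹) = ((√2 : ℝ) : ℂ)⁻¹ := by
    rw [Complex.star_def, ← Complex.ofReal_inv, Complex.conj_ofReal]
  simp only [ghzProj, Matrix.vecMulVec_apply, Pi.star_apply, hv, star_mul', hstar,
    Matrix.smul_apply, Matrix.add_apply, tensorOp_apply, Fin.prod_univ_two, smul_eq_mul,
    ofReal_bitSign, Complex.ofReal_mul]
  generalize ((√2 : ℝ) : ℂ)⁻¹ = t at ht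
  generalize a 0 = a0
  generalize a 1 = a1
  generalize b 0 = b0
  generalize b 1 = b1
  generalize s 0 = s0
  generalize s 1 = s1
  fin_cases s0 <;> fin_cases s1 <;> fin_cases a0 <;> fin_cases a1 <;> fin_cases b0 <;>
    fin_cases b1 <;> simp [pauliX, pauliZ, Matrix.one_apply] <;>
    first | linear_combination ht | linear_combination -ht

theorem successOpOf_refObs_two (α : Fin 2 → ℝ) (s : Fin 2 → Fin 2) :
    successOpOf (fun j : Fin 2 => refObs j (α j)) s
      = (bitSign (s 0) : ℂ) • (siteOp 0 (((2 * Real.cos (α 0) : ℝ) : ℂ) • axis (0 : Fin 2) 0)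
          * siteOp 1 (refObs (1 : Fin 2) (α 1) 0))
        + (bitSign (s 1) : ℂ) • (siteOp 0 (((2 * Real.sin (α 0) : ℝ) : ℂ) • axis (0 : Fin 2) 1)
          * siteOp 1 (refObs (1 : Fin 2) (α 1) 1)) := by
  have e0 : refObs (0 : Fin 2) (α 0) 0 + refObs (0 : Fin 2) (α 0) 1
      = ((2 * Real.cos (α 0) : ℝ) : ℂ) • axis (0 : Fin 2) 0 := by
    rw [refObs_zero, refObs_one]; push_cast; module
  have e1 : refObs (0 : Fin 2) (α 0) 0 - refObs (0 : Fin 2) (α 0) 1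
      = ((2 * Real.sin (α 0) : ℝ) : ℂ) • axis (0 : Fin 2) 1 := by
    rw [refObs_zero, refObs_one]; push_cast; module
  have hf : (Finset.univ.filter (fun j : Fin 2 => j ≠ 0)) = {1} := by decide
  rw [successOpOf, hf, Finset.sum_singleton, tensorOp_fin_two, tensorOp_fin_two]
  simp only [if_true, one_ne_zero, if_false, e0, e1, ofReal_bitSign]
  congr 2
  norm_num

theorem sqrt_two_bounds : 1.4142 ≤ √2 ∧ √2 ≤ 1.4143 :=
  ⟨Real.le_sqrt_of_sq_le (by norm_num), Real.sqrt_le_iff.mpr (by norm_num)⟩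

theorem cos_add_sin_eq (α : ℝ) :
    Real.cos α + Real.sin α = 1 + (√2 - 1) * dephasingWeight α := by
  have hS : √2 ^ 2 = 2 := Real.sq_sqrt (by norm_num)
  rw [dephasingWeight]
  linear_combination -(Real.cos α + Real.sin α - 1) * hS

/-- By the parallelogram law each sum of two squares is half a sum of squares of the sum and
difference. These factor through k₀ ± k₁, l₀ ± l₁, c ± s and c' ± s', which are known functions of
g, h, v, w up to the signs τ, τ'. -/
theorem two_qubit_scalar_le {S g h v w τ τ' k₀ k₁ l₀ l₁ c s c' s' : ℝ} (hS : S ^ 2 = 2)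
    (hS0 : 1.4142 ≤ S) (hS1 : S ≤ 1.4143) (hg : 0 ≤ g) (hg1 : 0 ≤ 1 - g) (hh : 0 ≤ h)
    (hh1 : 0 ≤ 1 - h) (hv : 0 ≤ v) (hw : 0 ≤ w) (hτ : τ ^ 2 = 1) (hτ' : τ' ^ 2 = 1)
    (hk : k₀ + k₁ = 1 + g) (hk' : k₀ - k₁ = τ * (1 - g))
    (hl : l₀ + l₁ = 1 + h) (hl' : l₀ - l₁ = τ' * (1 - h))
    (hu : c + s = 1 + (S - 1) * g) (hv' : c - s = τ * v)
    (hu' : c' + s' = 1 + (S - 1) * h) (hw' : c' - s' = τ' * w)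
    (hcs : c ^ 2 + s ^ 2 = 1) (hcs' : c' ^ 2 + s' ^ 2 = 1) :
    ((S / 8 * (k₀ * l₀) - (4 + 5 * S) / 8 * (c * c'))
        + (S / 8 * (k₁ * l₁) - (4 + 5 * S) / 8 * (s * s'))) ^ 2
      + ((S / 8 * (k₀ * l₁) - (4 + 5 * S) / 8 * (c * s'))
        + (S / 8 * (k₁ * l₀) - (4 + 5 * S) / 8 * (s * c'))) ^ 2
      ≤ ((1 + S) / 2 + g * h / 4) ^ 2 ∧
    ((S / 8 * (k₀ * l₀) - (4 + 5 * S) / 8 * (c * c'))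
        - (S / 8 * (k₁ * l₁) - (4 + 5 * S) / 8 * (s * s'))) ^ 2
      + ((S / 8 * (k₀ * l₁) - (4 + 5 * S) / 8 * (c * s'))
        - (S / 8 * (k₁ * l₀) - (4 + 5 * S) / 8 * (s * c'))) ^ 2
      ≤ ((1 + S) / 2 - g * h / 4) ^ 2 := by
  have sq_of : ∀ {c s g v τ : ℝ}, τ ^ 2 = 1 → c + s = 1 + (S - 1) * g → c - s = τ * v →
      c ^ 2 + s ^ 2 = 1 → v ^ 2 = (1 - g) * (1 + (3 - 2 * S) * g) := by
    intro c s g v τ hτ hu hv hcs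
    have e1 : (c + s) ^ 2 + (c - s) ^ 2 = 2 := by linear_combination 2 * hcs
    rw [hu, hv] at e1
    linear_combination e1 - v ^ 2 * hτ - g ^ 2 * hS
  have hv2 := sq_of hτ hu hv' hcs
  have hw2 := sq_of hτ' hu' hw' hcs'
  have p := even_sector_le hS hS0 hS1 hg hg1 hh hh1 hv hw hv2 hw2
  have q := odd_sector_le hS hS0 hS1 hg hg1 hh hh1 hv hw hv2 hw2
  -- The factor 4S clears denominators: 4S·S/8 = 1 and 4S(4 + 5S)/8 = 5 + 2S.
  have key : ∀ {m u z : ℝ}, S / 8 * m - (4 + 5 * S) / 8 * u = z →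
      4 * S * z = m - (5 + 2 * S) * u := by
    rintro m u z rfl
    linear_combination (m / 2 - 5 / 2 * u) * hS
  constructor
  · have a := key (m := (k₀ + k₁) * (l₀ + l₁)) (u := (c + s) * (c' + s')) rfl
    have b := key (m := (k₀ - k₁) * (l₀ - l₁)) (u := (c - s) * (c' - s')) rfl
    rw [hk, hl, hu, hu'] at a
    rw [hk', hl', hv', hw'] at b
    rw [← a] at p
    have b' : ((1 - g) * (1 - h) - (5 + 2 * S) * (v * w)) ^ 2
        = (τ * (1 - g) * (τ' * (1 - h)) - (5 + 2 * S) * (τ * v * (τ' * w))) ^ 2 := by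
      have : (τ * τ') ^ 2 = 1 := by rw [mul_pow, hτ, hτ', one_mul]
      linear_combination -((1 - g) * (1 - h) - (5 + 2 * S) * (v * w)) ^ 2 * this
    rw [b', ← b, mul_pow (4 * S), mul_pow (4 * S), mul_pow 4 S, hS, ← hk, ← hl, ← hu, ← hu', ← hk',
      ← hl', ← hv', ← hw'] at p
    linarith
  · have a := key (m := (k₀ - k₁) * (l₀ + l₁)) (u := (c - s) * (c' + s')) rfl
    have b := key (m := (k₀ + k₁) * (l₀ - l₁)) (u := (c + s) * (c' - s')) rfl
    rw [hk', hl, hv', hu'] at a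
    rw [hk, hl', hu, hw'] at b
    have a' : ((1 - g) * (1 + h) - (5 + 2 * S) * (v * (1 + (S - 1) * h))) ^ 2
        = (τ * (1 - g) * (1 + h) - (5 + 2 * S) * (τ * v * (1 + (S - 1) * h))) ^ 2 := by
      linear_combination -((1 - g) * (1 + h) - (5 + 2 * S) * (v * (1 + (S - 1) * h))) ^ 2 * hτ
    have b' : ((1 + g) * (1 - h) - (5 + 2 * S) * ((1 + (S - 1) * g) * w)) ^ 2
        = ((1 + g) * (τ' * (1 - h)) - (5 + 2 * S) * ((1 + (S - 1) * g) * (τ' * w))) ^ 2 := by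
      linear_combination -((1 + g) * (1 - h) - (5 + 2 * S) * ((1 + (S - 1) * g) * w)) ^ 2 * hτ'
    rw [a', b', ← a, ← b, mul_pow (4 * S), mul_pow (4 * S), mul_pow 4 S, hS, ← hk, ← hl, ← hu,
      ← hu', ← hk', ← hl', ← hv', ← hw'] at q
    linarith

theorem ghzProj_fidelity_two {B : NQubitOp 2} (hB : B.PosSemidef) {α : Fin 2 → ℝ}
    (hα : ∀ j, α j ∈ Set.Icc 0 (Real.pi / 2)) (s : Fin 2 → Fin 2) :
    (4 + 5 * √2) / 16 * reTraceMul B (successOpOf (fun j : Fin 2 => refObs j (α j)) s)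
      + -(1 + 2 * √2) / 4 * reTraceMul B 1
      ≤ reTraceMul B (dephaseAll α (ghzProj s)) := by
  obtain ⟨k₀, k₁, τ, v, hv, hτ, hk, hk', hcs, d1, d2, d3, d4⟩ :=
    dephasing_axes (0 : Fin 2) (hα 0)
  obtain ⟨l₀, l₁, τ', w, hw, hτ', hl, hl', hcs', D1, D2, D3, D4⟩ :=
    dephasing_axes (1 : Fin 2) (hα 1)
  have h10 : (1 : Fin 2) ≠ 0 := one_ne_zero
  have hP : dephaseAll α (ghzProj s) = ((1 / 4 : ℝ) : ℂ) • (1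
      + (bitSign (s 0) : ℂ) • (siteOp 0 ((k₀ : ℂ) • axis (0 : Fin 2) 0)
          * siteOp 1 (((√2 : ℝ) : ℂ)⁻¹ • ((l₀ : ℂ) • axis (1 : Fin 2) 0
            + (l₁ : ℂ) • axis (1 : Fin 2) 1)))
      + (bitSign (s 1) : ℂ) • (siteOp 0 ((k₁ : ℂ) • axis (0 : Fin 2) 1)
          * siteOp 1 (((√2 : ℝ) : ℂ)⁻¹ • ((l₀ : ℂ) • axis (1 : Fin 2) 0
            - (l₁ : ℂ) • axis (1 : Fin 2) 1)))
      + ((bitSign (s 0) * bitSign (s 1) : ℝ) : ℂ) •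
          (siteOp 0 ((dephasingWeight (α 0) : ℂ) • (axis (0 : Fin 2) 0 * axis (0 : Fin 2) 1))
          * siteOp 1 (-((dephasingWeight (α 1) : ℂ) •
            (axis (1 : Fin 2) 0 * axis (1 : Fin 2) 1))))) := by
    rw [ghzProj_two, dephaseAll_smul, dephaseAll_add, dephaseAll_add, dephaseAll_add,
      dephaseAll_smul, dephaseAll_smul, dephaseAll_smul, ← tensorOp_one,
      dephaseAll_tensorOp hα, dephaseAll_tensorOp hα, dephaseAll_tensorOp hα,
      dephaseAll_tensorOp hα, tensorOp_fin_two, tensorOp_fin_two, tensorOp_fin_two,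
      tensorOp_fin_two]
    simp only [d1, D1]
    have x1 : dephasingLin (1 : Fin 2) (α 1) pauliX = ((√2 : ℝ) : ℂ)⁻¹ • ((l₀ : ℂ) • axis (1 : Fin 2) 0
            + (l₁ : ℂ) • axis (1 : Fin 2) 1) := by
      rw [pauliX_eq_axis h10, map_smul, map_add, D2, D3]
    have z1 : dephasingLin (1 : Fin 2) (α 1) pauliZ = ((√2 : ℝ) : ℂ)⁻¹ • ((l₀ : ℂ) • axis (1 : Fin 2) 0
            - (l₁ : ℂ) • axis (1 : Fin 2) 1) := by
      rw [pauliZ_eq_axis h10, map_smul, map_sub, D2, D3]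
    have y1 : dephasingLin (1 : Fin 2) (α 1) (pauliX * pauliZ) = -((dephasingWeight (α 1) : ℂ) •
            (axis (1 : Fin 2) 0 * axis (1 : Fin 2) 1)) := by
      rw [pauliX_mul_pauliZ_eq_axis h10, map_neg, D4]
    rw [x1, z1, y1]
    simp only [← axis_zero_zero (n := 2), ← axis_zero_one (n := 2), d2, d3, d4, siteOp_one, mul_one, tensorOp_one]
  have cx : ∀ P Q : QubitOp, siteOp (1 : Fin 2) Q * siteOp 0 P = siteOp 0 P * siteOp 1 Q :=
    fun P Q => siteOp_comm h10 Q P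
  have bs0 := bitSign_mul_self (s 0)
  have bs1 := bitSign_mul_self (s 1)
  have g0 := dephasingWeight_nonneg (hα 0)
  have g1 := dephasingWeight_le_one (α := α 0)
  have h0 := dephasingWeight_nonneg (hα 1)
  have h1 := dephasingWeight_le_one (α := α 1)
  have gh0 := mul_nonneg g0 h0
  have gh1 := mul_le_one₀ g1 h0 h1
  have hS : √2 ^ 2 = 2 := Real.sq_sqrt (by norm_num)
  obtain ⟨hS0, hS1⟩ := sqrt_two_bounds
  obtain ⟨hq, hq'⟩ := two_qubit_scalar_le hS hS0 hS1 g0 (by linarith) h0 (by linarith) hv hw hτ hτ'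
    hk hk' hl hl' (cos_add_sin_eq (α 0)) hcs (cos_add_sin_eq (α 1)) hcs'
    (Real.cos_sq_add_sin_sq _) (Real.cos_sq_add_sin_sq _)
  -- The signs of s are absorbed into the axes of the first party. The constant κ is 1/4 − μ, and e
  -- = gh/4 comes from the fourth stabilizer term; its minus sign is that of XZ = −axis₀·axis₁ on
  -- the second qubit.
  have key := map_two_qubit_nonneg (φ := reTraceMul B) (reTraceMul_star_mul_self_nonneg hB)
    (X := siteOp 0 ((bitSign (s 0) : ℂ) • axis (0 : Fin 2) 0))
    (Z := siteOp 0 ((bitSign (s 1) : ℂ) • axis (0 : Fin 2) 1))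
    (X' := siteOp 1 (axis (1 : Fin 2) 0)) (Z' := siteOp 1 (axis (1 : Fin 2) 1))
    (by simp [siteOp_star, Matrix.conjTranspose_smul, axis_conjTranspose])
    (by simp [siteOp_star, Matrix.conjTranspose_smul, axis_conjTranspose])
    (by simp [siteOp_star, axis_conjTranspose])
    (by simp [siteOp_star, axis_conjTranspose])
    (by simp only [siteOp_mul, smul_mul_assoc, mul_smul_comm, smul_smul, axis_mul_self,
          ← Complex.ofReal_mul, bs0, Complex.ofReal_one, one_smul, siteOp_one])
    (by simp only [siteOp_mul, smul_mul_assoc, mul_smul_comm, smul_smul, axis_mul_self,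
          ← Complex.ofReal_mul, bs1, Complex.ofReal_one, one_smul, siteOp_one])
    (by rw [siteOp_mul, axis_mul_self, siteOp_one])
    (by rw [siteOp_mul, axis_mul_self, siteOp_one])
    (by simp only [siteOp_mul, smul_mul_assoc, mul_smul_comm, smul_smul, axis_one_mul_axis_zero,
          ← siteOp_neg, smul_neg]
        rw [mul_comm])
    (by rw [siteOp_mul, siteOp_mul, axis_one_mul_axis_zero, siteOp_neg])
    (cx _ _) (cx _ _) (cx _ _) (cx _ _)
    (κ := (1 + √2) / 2) (e := dephasingWeight (α 0) * dephasingWeight (α 1) / 4)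
    (by positivity) (by linarith) hq hq'
  have ht : ((√2 : ℝ) : ℂ)⁻¹ = ((√2 / 2 : ℝ) : ℂ) := by
    rw [← Complex.ofReal_inv]
    congr 1
    rw [inv_eq_iff_eq_inv, inv_div, eq_div_iff (by positivity)]
    linear_combination hS
  rw [hP, successOpOf_refObs_two, refObs_zero, refObs_one, ht]
  simp only [siteOp_smul, siteOp_add, siteOp_sub, siteOp_neg, smul_mul_assoc, mul_smul_comm,
    mul_add, mul_sub, mul_neg, map_add, map_sub, map_neg, reTraceMul_ofReal_smul, smul_add,
    smul_sub, smul_neg, ← siteOp_mul] at key ⊢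
  linarith

end TwoQubits

/-! ### Stabilizers of the GHZ basis. -/

section Stabilizer

variable {n : ℕ} [NeZero n]

theorem tensorOp_pauliX_apply (a b : Fin n → Fin 2) :
    tensorOp (fun _ => pauliX) a b = if b = fun j => 1 - a j then 1 else 0 := by
  have hX : ∀ x y : Fin 2, pauliX x y = if y = 1 - x then 1 else 0 := fun x y => by
    fin_cases x <;> fin_cases y <;> simp [pauliX]
  simp only [tensorOp_apply, hX]
  split_ifs with h
  · subst h; simp
  · obtain ⟨j, hj⟩ := Function.ne_iff.mp h
    exact Finset.prod_eq_zero (Finset.mem_univ j) (if_neg hj)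

theorem tensorOp_pauliX_mul_self :
    tensorOp (fun _ : Fin n => pauliX) * tensorOp (fun _ => pauliX) = 1 := by
  simp only [tensorOp_mul, pauliX_mul_self, tensorOp_one]

theorem siteOp_diagonal (j : Fin n) (d : Fin 2 → ℂ) :
    siteOp j (Matrix.diagonal d) = Matrix.diagonal (fun b => d (b j)) := by
  ext a b
  rw [siteOp, tensorOp_apply]
  by_cases h : a = b
  · subst h
    rw [Matrix.diagonal_apply_eq, Finset.prod_eq_single j]
    · simp
    · intro k _ hk; simp [hk]
    · simp
  · rw [Matrix.diagonal_apply_ne _ h]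
    obtain ⟨k, hk⟩ := Function.ne_iff.mp h
    refine Finset.prod_eq_zero (Finset.mem_univ k) ?_
    by_cases hkj : k = j
    · subst hkj; simp [hk]
    · simp [hkj, hk]

theorem siteOp_pauliZ (j : Fin n) :
    siteOp j pauliZ = Matrix.diagonal (fun b : Fin n → Fin 2 => (bitSign (b j) : ℂ)) := by
  rw [show pauliZ = Matrix.diagonal (fun x : Fin 2 => (bitSign x : ℂ)) by
    ext x y; fin_cases x <;> fin_cases y <;> simp [pauliZ, bitSign], siteOp_diagonal]

/-- The projector onto the two computational basis states that appear in `ghzVec s`. -/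
def supportProj (s : Fin n → Fin 2) : NQubitOp n :=
  Matrix.diagonal fun b =>
    if b = Function.update s 0 0 ∨ b = Function.update (fun j => 1 - s j) 0 1 then 1 else 0

theorem ghz_support_flip (s : Fin n → Fin 2) :
    (fun j => 1 - Function.update s 0 0 j) = Function.update (fun j => 1 - s j) 0 1 := by
  funext j
  by_cases h : j = 0
  · subst h; simp
  · simp [h]

theorem ghz_support_ne (s : Fin n → Fin 2) :
    Function.update s 0 0 ≠ Function.update (fun j => 1 - s j) 0 1 := fun h => by
  simpa using congrFun h 0

/-- X ⊗ ⋯ ⊗ X swaps the two basis strings of the support, so the GHZ vector is selected inside their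
span by one sign. -/
theorem ghzProj_eq (s : Fin n → Fin 2) :
    ghzProj s = ((1 / 2 : ℝ) : ℂ) • (supportProj s
      * (1 + (bitSign (s 0) : ℂ) • tensorOp (fun _ => pauliX))) := by
  have ht := inv_sqrt_two_mul_self
  have hstar : star (((√2 : ℝ) : ℂ)⁻¹) = ((√2 : ℝ) : ℂ)⁻¹ := by
    rw [Complex.star_def, ← Complex.ofReal_inv, Complex.conj_ofReal]
  have hσ : ∀ x : Fin 2, ((-1 : ℂ) ^ (x : ℕ)) * (-1 : ℂ) ^ (x : ℕ) = 1 := fun x => by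
    fin_cases x <;> simp
  have hf := ghz_support_flip s
  have hne := ghz_support_ne s
  have hf' : (fun j => 1 - Function.update (fun j => 1 - s j) 0 1 j) = Function.update s 0 0 := by
    rw [← hf]; funext j; simp
  ext a b
  simp only [ghzProj, Matrix.vecMulVec_apply, Pi.star_apply, ghzVec, star_mul', hstar,
    Matrix.smul_apply, Matrix.add_apply, smul_eq_mul, ofReal_bitSign, supportProj,
    Matrix.diagonal_mul, tensorOp_pauliX_apply, Matrix.one_apply, star_add, star_pow, star_neg,
    star_one]
  generalize Function.update s 0 0 = b₀ at *
  generalize Function.update (fun j => 1 - s j) 0 1 = b₁ at *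
  generalize ((√2 : ℝ) : ℂ)⁻¹ = t at ht
  have h1 := hσ (s 0)
  generalize (-1 : ℂ) ^ ((s 0 : Fin 2) : ℕ) = σ at h1
  by_cases ha0 : a = b₀
  · subst ha0
    rw [hf]
    by_cases hb0 : b = a
    · subst hb0; simp [hne]; linear_combination ht
    · by_cases hb1 : b = b₁
      · subst hb1; simp [hne, hne.symm]; linear_combination σ * ht
      · simp [hb0, hb1, Ne.symm hb0]
  · by_cases ha1 : a = b₁
    · subst ha1
      rw [hf']
      by_cases hb0 : b = b₀
      · subst hb0; simp [hne, hne.symm]; linear_combination σ * ht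
      · by_cases hb1 : b = a
        · subst hb1; simp [hne, hne.symm]; linear_combination σ * σ * ht + h1 / 2
        · simp [hb0, hb1, Ne.symm hb1]
    · simp [ha0, ha1]

theorem supportProj_comm (s : Fin n → Fin 2) :
    supportProj s * tensorOp (fun _ => pauliX) = tensorOp (fun _ => pauliX) * supportProj s := by
  ext a b
  simp only [supportProj, Matrix.diagonal_mul, Matrix.mul_diagonal, tensorOp_pauliX_apply]
  by_cases h : b = fun j => 1 - a j
  · have hf := ghz_support_flip s
    have inv : ∀ c d : Fin n → Fin 2, c = (fun j => 1 - d j) ↔ d = (fun j => 1 - c j) :=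
      fun c d => ⟨fun h => by rw [h]; funext j; simp, fun h => by rw [h]; funext j; simp⟩
    have hiff : (a = Function.update s 0 0 ∨ a = Function.update (fun j => 1 - s j) 0 1)
        ↔ (b = Function.update s 0 0 ∨ b = Function.update (fun j => 1 - s j) 0 1) := by
      rw [← hf, inv, ← h]
      constructor
      · rintro (h' | h')
        · right; rw [h, h']
        · left; rw [h']
      · rintro (h' | h')
        · right; rw [h']
        · left
          have := (inv b a).mp h
          rw [this, h']; funext j; simp
    simp only [if_pos h, mul_one, one_mul]
    exact if_congr hiff rfl rfl
  · simp [h]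

theorem supportProj_mul_self (s : Fin n → Fin 2) :
    supportProj s * supportProj s = supportProj s := by
  rw [supportProj, Matrix.diagonal_mul_diagonal]
  congr 1; funext b; split_ifs <;> simp

theorem supportProj_star (s : Fin n → Fin 2) : star (supportProj s) = supportProj s := by
  rw [Matrix.star_eq_conjTranspose, supportProj, Matrix.diagonal_conjTranspose]
  congr 1; funext b; simp only [Pi.star_apply]; split_ifs <;> simp

/-- The stabilizer `(-1)^{s₁} X ⊗ ⋯ ⊗ X`. -/
def stabX (s : Fin n → Fin 2) : NQubitOp n := (bitSign (s 0) : ℂ) • tensorOp (fun _ => pauliX)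

/-- The stabilizer `(-1)^{sⱼ} Z₁ Zⱼ`. -/
def stabZ (s : Fin n → Fin 2) (j : Fin n) : NQubitOp n :=
  (bitSign (s j) : ℂ) • (siteOp 0 pauliZ * siteOp j pauliZ)

/-- Both operators are diagonal. A string outside the support violates some parity check (−1)^{sⱼ}
Z₁Zⱼ, which alone contributes 2 to the sum; on the support it is enough that all terms are
nonnegative. -/
theorem reTraceMul_one_sub_supportProj_le {B : NQubitOp n} (hB : B.PosSemidef)
    (s : Fin n → Fin 2) :
    reTraceMul B (1 - supportProj s)
      ≤ 1 / 2 * ∑ j ∈ Finset.univ.filter (fun j : Fin n => j ≠ 0), reTraceMul B (1 - stabZ s j) := by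
  set d : (Fin n → Fin 2) → ℝ := fun b =>
    1 / 2 * ∑ j ∈ Finset.univ.filter (fun j : Fin n => j ≠ 0),
        (1 - bitSign (s j) * (bitSign (b 0) * bitSign (b j)))
      - (1 - if b = Function.update s 0 0 ∨ b = Function.update (fun j => 1 - s j) 0 1
          then 1 else 0) with hd
  have hle : ∀ x y z : Fin 2, 0 ≤ 1 - bitSign x * (bitSign y * bitSign z) := fun x y z => by
    fin_cases x <;> fin_cases y <;> fin_cases z <;> norm_num [bitSign]
  have hd0 : ∀ b, 0 ≤ d b := by
    intro b
    rw [hd]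
    by_cases h : b = Function.update s 0 0 ∨ b = Function.update (fun j => 1 - s j) 0 1
    · simp only [if_pos h, sub_self, sub_zero]
      exact mul_nonneg (by norm_num) (Finset.sum_nonneg fun j _ => hle _ _ _)
    · have : ∃ j : Fin n, j ≠ 0 ∧ 1 - bitSign (s j) * (bitSign (b 0) * bitSign (b j)) = 2 := by
        by_contra hcon
        push Not at hcon
        -- A string passing all parity checks is determined by its first bit, which leaves exactly
        -- the two support strings.
        have flip : ∀ x y z : Fin 2, 1 - bitSign x * (bitSign y * bitSign z) ≠ 2 →
            z = if y = 0 then x else 1 - x := fun x y z => by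
          fin_cases x <;> fin_cases y <;> fin_cases z <;> norm_num [bitSign]
        apply h
        by_cases hb : b 0 = 0
        · left
          funext j
          by_cases hj : j = 0
          · subst hj; simp [hb]
          · simpa [hb, hj] using flip _ _ _ (hcon j hj)
        · right
          funext j
          by_cases hj : j = 0
          · subst hj
            simp only [Function.update_self]
            generalize b 0 = x at hb
            fin_cases x <;> simp_all
          · simpa [hb, hj] using flip _ _ _ (hcon j hj)
      obtain ⟨j, hj, h2⟩ := this
      have := Finset.single_le_sum (s := Finset.univ.filter (fun j : Fin n => j ≠ 0)) (f := fun j : Fin n =>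
        1 - bitSign (s j) * (bitSign (b 0) * bitSign (b j))) (fun j _ => hle _ _ _)
        (Finset.mem_filter.mpr ⟨Finset.mem_univ j, hj⟩)
      simp only [h2] at this
      simp only [if_neg h, sub_zero]
      linarith
  have hpos : (Matrix.diagonal (fun b => (d b : ℂ))).PosSemidef :=
    Matrix.PosSemidef.diagonal fun b => by simpa using hd0 b
  have hφ := re_trace_mul_nonneg hpos hB
  rw [← reTraceMul_apply] at hφ
  have he : Matrix.diagonal (fun b => (d b : ℂ))
      = ((1 / 2 : ℝ) : ℂ) • (∑ j ∈ Finset.univ.filter (fun j : Fin n => j ≠ 0), (1 - stabZ s j))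
        - (1 - supportProj s) := by
    ext a b
    simp only [stabZ, siteOp_pauliZ, Matrix.diagonal_mul_diagonal, supportProj,
      ← Matrix.diagonal_one, Matrix.sub_apply, Matrix.smul_apply, Matrix.sum_apply, smul_eq_mul]
    by_cases h : a = b
    · subst h
      simp only [Matrix.diagonal_apply_eq, hd]
      push_cast
      split_ifs <;> simp
    · simp [h]
  rw [he, map_sub, reTraceMul_ofReal_smul, map_sum] at hφ
  linarith

theorem stabX_star (s : Fin n → Fin 2) : star (stabX s) = stabX s := by
  rw [stabX, star_smul, Matrix.star_eq_conjTranspose, tensorOp_conjTranspose]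
  simp [pauliX_conjTranspose]

theorem stabX_mul_self (s : Fin n → Fin 2) : stabX s * stabX s = 1 := by
  rw [stabX, smul_mul_smul_comm, tensorOp_pauliX_mul_self, ← Complex.ofReal_mul,
    bitSign_mul_self, Complex.ofReal_one, one_smul]

/-- A measure of violation of the stabilizer equations bounds the distance to the GHZ vector. -/
theorem reTraceMul_one_sub_ghzProj_le {B : NQubitOp n} (hB : B.PosSemidef)
    (s : Fin n → Fin 2) :
    reTraceMul B 1 - reTraceMul B (ghzProj s)
      ≤ 1 / 2 * (reTraceMul B (1 - stabX s)
        + ∑ j ∈ Finset.univ.filter (fun j : Fin n => j ≠ 0), reTraceMul B (1 - stabZ s j)) := by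
  have hφ := reTraceMul_star_mul_self_nonneg hB
  have h1 := reTraceMul_one_sub_supportProj_le hB s
  have hS := stabX_star s
  have hS2 := stabX_mul_self s
  have hD := supportProj_star s
  have hD2 := supportProj_mul_self s
  have hc : supportProj s * stabX s = stabX s * supportProj s := by
    rw [stabX, mul_smul_comm, smul_mul_assoc, supportProj_comm]
  have hP : ghzProj s = ((1 / 2 : ℝ) : ℂ) • (supportProj s * (1 + stabX s)) := ghzProj_eq s
  generalize supportProj s = D at *
  generalize stabX s = S at *
  -- As D and S commute, this square equals 2((1 − S) − D(1 − S)), hence φ(D(1 − S)) ≤ φ(1 − S).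
  have h2 := hφ ((1 - D) * (1 - S))
  have e : star ((1 - D) * (1 - S)) * ((1 - D) * (1 - S))
      = ((2 : ℝ) : ℂ) • ((1 - S) - D * (1 - S)) := by
    have hcc : (1 - S) * (1 - D) = (1 - D) * (1 - S) := by
      simp only [mul_sub, sub_mul, hc, mul_one, one_mul]; abel
    have hDD : (1 - D) * (1 - D) = 1 - D := by simp [mul_sub, sub_mul, hD2]
    have hSS : (1 - S) * (1 - S) = ((2 : ℝ) : ℂ) • (1 - S) := by
      simp only [mul_sub, sub_mul, hS2, mul_one, one_mul]; push_cast; module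
    have hs : star ((1 - D) * (1 - S)) = (1 - D) * (1 - S) := by
      rw [star_mul, star_sub, star_sub, star_one, hS, hD, hcc]
    rw [hs]
    calc (1 - D) * (1 - S) * ((1 - D) * (1 - S))
        = (1 - D) * ((1 - S) * (1 - D)) * (1 - S) := by simp only [mul_assoc]
      _ = ((1 - D) * (1 - D)) * ((1 - S) * (1 - S)) := by rw [hcc]; simp only [mul_assoc]
      _ = _ := by rw [hDD, hSS, mul_smul_comm, sub_mul, one_mul]
  rw [e, reTraceMul_ofReal_smul] at h2
  rw [hP, reTraceMul_ofReal_smul]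
  simp only [mul_sub, mul_add, mul_one, map_sub, map_add] at h1 h2 ⊢
  linarith

end Stabilizer

/-! ### The operator inequality for an arbitrary number of parties. -/

section ManyQubits

variable {n : ℕ} [NeZero n]

theorem one_sub_sum_le_prod {ι : Type*} (s : Finset ι) (q : ι → ℝ) (h0 : ∀ i, 0 ≤ q i)
    (h1 : ∀ i, q i ≤ 1) : 1 - ∑ i ∈ s, q i ≤ ∏ i ∈ s, (1 - q i) := by
  classical
  induction s using Finset.induction_on with
  | empty => simp
  | insert i s hi ih =>
    rw [Finset.sum_insert hi, Finset.prod_insert hi]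
    have hs : 0 ≤ ∑ i ∈ s, q i := Finset.sum_nonneg fun i _ => h0 i
    nlinarith [mul_le_mul_of_nonneg_left ih (sub_nonneg.mpr (h1 i)), mul_nonneg (h0 i) hs]

theorem ghzProj_posSemidef (s : Fin n → Fin 2) : (ghzProj s).PosSemidef :=
  Matrix.posSemidef_vecMulVec_self_star _

/-- Of all the Kraus terms only the one proportional to the identity is kept; the others are
nonnegative. -/
theorem prod_mul_reTraceMul_le_dephaseAll {B P : NQubitOp n} (hB : B.PosSemidef)
    (hP : P.PosSemidef) {α : Fin n → ℝ} (hα : ∀ j, α j ∈ Set.Icc 0 (Real.pi / 2)) :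
    (∏ j, (1 + dephasingWeight (α j)) / 2) * reTraceMul B P ≤ reTraceMul B (dephaseAll α P) := by
  rw [dephaseAll, map_sum]
  have h0 := Finset.single_le_sum (s := Finset.univ) (f := fun f : Fin n → Fin 2 =>
    reTraceMul B ((tensorOp (fun j => dephasingKraus j (α j) (f j)))ᴴ * P
      * tensorOp (fun j => dephasingKraus j (α j) (f j))))
    (fun f _ => re_trace_mul_nonneg (hP.conjTranspose_mul_mul_same _) hB) (Finset.mem_univ 0)
  refine le_of_eq_of_le ?_ h0
  simp only [Pi.zero_apply, tensorOp_conjTranspose, dephasingKraus_conjTranspose]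
  simp only [dephasingKraus, if_true, tensorOp_smul, tensorOp_one, smul_mul_assoc, one_mul,
    mul_smul_comm, mul_one, smul_smul, ← Complex.ofReal_prod, ← Complex.ofReal_mul,
    reTraceMul_ofReal_smul]
  congr 1
  rw [← Finset.prod_mul_distrib]
  refine Finset.prod_congr rfl fun j _ => ?_
  rw [Real.mul_self_sqrt (by linarith [dephasingWeight_nonneg (hα j)])]

/-- The observables `A₀⁽ᵏ⁾` of the parties `k ≥ 2`. -/
def restObs (F : Fin n → QubitOp) : Fin n → QubitOp := fun k => if k = 0 then 1 else F k

theorem tensorOp_ite_zero (A : QubitOp) (F : Fin n → QubitOp) :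
    tensorOp (fun k => if k = 0 then A else F k) = siteOp 0 A * tensorOp (restObs F) := by
  rw [siteOp, tensorOp_mul]
  congr 1; funext k
  by_cases h : k = 0
  · subst h; simp [restObs]
  · simp [restObs, h]

theorem tensorOp_ite_zero_ite {j : Fin n} (hj : j ≠ 0) (A A' : QubitOp) :
    tensorOp (fun k => if k = 0 then A else if k = j then A' else 1)
      = siteOp 0 A * siteOp j A' := by
  rw [siteOp, siteOp, tensorOp_mul]
  congr 1; funext k
  by_cases h : k = 0
  · subst h; simp [hj.symm]
  · by_cases h' : k = j
    · subst h'; simp [h]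
    · simp [h, h']

theorem tensorOp_restObs_star {F : Fin n → QubitOp} (hF : ∀ k, (F k)ᴴ = F k) :
    star (tensorOp (restObs F)) = tensorOp (restObs F) := by
  rw [Matrix.star_eq_conjTranspose, tensorOp_conjTranspose]
  congr 1; funext k; unfold restObs; split_ifs <;> simp [hF]

theorem tensorOp_restObs_mul_self {F : Fin n → QubitOp} (hF : ∀ k, F k * F k = 1) :
    tensorOp (restObs F) * tensorOp (restObs F) = 1 := by
  rw [tensorOp_mul, ← tensorOp_one]
  congr 1; funext k; unfold restObs; split_ifs <;> simp [hF]

theorem tensorOp_restObs_comm (F : Fin n → QubitOp) (A : QubitOp) :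
    tensorOp (restObs F) * siteOp 0 A = siteOp 0 A * tensorOp (restObs F) :=
  tensorOp_comm fun k => by
    by_cases h : k = 0
    · left; simp [restObs, h]
    · right; simp [h]

/-- Replacing the factors of a product of observables one after the other. -/
theorem reTraceMul_tensorOp_sub_sq_le {B : NQubitOp n} (hB : B.PosSemidef)
    {F G : Fin n → QubitOp} {η : Fin n → ℝ} (hF : ∀ k, (F k)ᴴ = F k) (hG : ∀ k, (G k)ᴴ = G k)
    (hF2 : ∀ k, F k * F k = 1) (hG2 : ∀ k, G k * G k = 1)
    (hη : ∀ k, (F k - G k) * (F k - G k) = (η k : ℂ) • (1 : QubitOp)) (hη0 : ∀ k, 0 ≤ η k)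
    (S : Finset (Fin n)) :
    reTraceMul B ((tensorOp (fun k => if k ∈ S then F k else G k) - tensorOp G)
        * (tensorOp (fun k => if k ∈ S then F k else G k) - tensorOp G))
      ≤ 2 ^ S.card * (∑ k ∈ S, η k) * reTraceMul B 1 := by
  have hφ := reTraceMul_star_mul_self_nonneg hB
  have hφ1 := map_one_nonneg hφ
  have hstar : ∀ H : Fin n → QubitOp, (∀ k, (H k)ᴴ = H k) → star (tensorOp H) = tensorOp H :=
    fun H hH => by
      rw [Matrix.star_eq_conjTranspose, tensorOp_conjTranspose]
      congr 1; funext k; exact hH k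
  have hH : ∀ T : Finset (Fin n), ∀ k, (if k ∈ T then F k else G k)ᴴ
      = if k ∈ T then F k else G k := fun T k => by split_ifs <;> simp [hF, hG]
  induction S using Finset.induction_on with
  | empty => simp
  | insert i S hi ih =>
    set H : Fin n → QubitOp := fun k => if k ∈ S then F k else G k with hHdef
    have e1 : tensorOp (fun k => if k ∈ insert i S then F k else G k)
        = tensorOp (Function.update H i (F i)) := by
      congr 1; funext k
      by_cases hk : k = i
      · subst hk; simp
      · simp [hHdef, hk]
    have e2 : tensorOp H = tensorOp (Function.update H i (G i)) := by
      congr 1; funext k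
      by_cases hk : k = i
      · subst hk; simp [hHdef, hi]
      · simp [hk]
    have e3 : tensorOp (Function.update H i (F i)) - tensorOp H
        = tensorOp (Function.update H i (F i - G i)) := by
      rw [e2, sub_eq_iff_eq_add, ← tensorOp_update_add, sub_add_cancel]
    have e4 : tensorOp (Function.update H i (F i - G i))
        * tensorOp (Function.update H i (F i - G i)) = (η i : ℂ) • (1 : NQubitOp n) := by
      have hone : (1 : NQubitOp n) = tensorOp (Function.update (fun _ => 1) i 1) :=
        (siteOp_one i).symm
      rw [tensorOp_mul, hone, ← tensorOp_update_smul]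
      congr 1; funext k
      by_cases hk : k = i
      · subst hk; simp [hη]
      · simp only [Function.update_of_ne hk, hHdef]
        split_ifs <;> simp [hF2, hG2]
    -- Exchanging factor i alone costs exactly η i, since the other factors square to one. Adding it
    -- to the earlier exchanges by (x + y)² ≤ 2(x² + y²) doubles the constant.
    have h := map_add_sq_le hφ (x := tensorOp (Function.update H i (F i)) - tensorOp H)
      (y := tensorOp H - tensorOp G)
      (by rw [star_sub, ← e1, hstar _ (hH _), hstar _ (hH _)])
      (by rw [star_sub, hstar _ (hH _), hstar _ hG])
    rw [sub_add_sub_cancel, e3, e4, reTraceMul_ofReal_smul] at h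
    rw [e1, Finset.card_insert_of_notMem hi, Finset.sum_insert hi]
    refine h.trans ?_
    have h1 : (1 : ℝ) ≤ 2 ^ S.card := one_le_pow₀ (by norm_num)
    have h2 := mul_le_mul_of_nonneg_right h1 (mul_nonneg (hη0 i) hφ1)
    rw [pow_succ]
    linarith

/-- At site 0 both products have the identity, so it costs nothing; elsewhere σ_X is the reference
observable at α = π/4. -/
theorem reTraceMul_rest_sub_sq_le {B : NQubitOp n} (hB : B.PosSemidef) (α : Fin n → ℝ) :
    reTraceMul B ((tensorOp (restObs fun k => refObs k (α k) 0)
          - tensorOp (restObs fun _ : Fin n => pauliX))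
        * (tensorOp (restObs fun k => refObs k (α k) 0) - tensorOp (restObs fun _ => pauliX)))
      ≤ 2 ^ n * (2 * ∑ k, angleDefect (α k)) * reTraceMul B 1 := by
  have h := reTraceMul_tensorOp_sub_sq_le hB (F := restObs fun k => refObs k (α k) 0)
    (G := restObs fun _ => pauliX) (η := fun k => if k = 0 then 0 else 2 * angleDefect (α k))
    (fun k => by unfold restObs; split_ifs <;> simp [refObs_conjTranspose])
    (fun k => by unfold restObs; split_ifs <;> simp [pauliX_conjTranspose])
    (fun k => by unfold restObs; split_ifs <;> simp [refObs_mul_self])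
    (fun k => by unfold restObs; split_ifs <;> simp [pauliX_mul_self])
    (fun k => by
      unfold restObs
      split_ifs with hk
      · simp
      · exact refObs_sub_sq (by simpa using pauliX_eq_axis hk))
    (fun k => by
      split_ifs
      · exact le_rfl
      · exact mul_nonneg (by norm_num) angleDefect_nonneg)
    Finset.univ
  simp only [Finset.mem_univ, if_true, Finset.card_univ, Fintype.card_fin] at h
  refine h.trans (mul_le_mul_of_nonneg_right (mul_le_mul_of_nonneg_left ?_ (by positivity))
    (map_one_nonneg (reTraceMul_star_mul_self_nonneg hB)))
  rw [Finset.mul_sum]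
  refine Finset.sum_le_sum fun k _ => ?_
  split_ifs
  · exact mul_nonneg (by norm_num) angleDefect_nonneg
  · exact le_rfl

/-- Commutator of the two observables that the other parties contribute to the CHSH operator of
the parties `1` and `j`. -/
theorem restObs_commutator {j : Fin n} (hj : j ≠ 0) (α : Fin n → ℝ) :
    ∃ F : NQubitOp n, star F = -F ∧ F * F = -1 ∧ (∀ A, F * siteOp 0 A = siteOp 0 A * F) ∧
      tensorOp (restObs fun k => refObs k (α k) 0) * siteOp j (refObs j (α j) 1)
        - siteOp j (refObs j (α j) 1) * tensorOp (restObs fun k => refObs k (α k) 0)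
        = ((4 * (Real.cos (α j) * Real.sin (α j)) : ℝ) : ℂ) • F := by
  set G : Fin n → QubitOp := restObs fun k => refObs k (α k) 0 with hG
  have hGj : G j = refObs j (α j) 0 := by simp [hG, restObs, hj]
  have hstar : ∀ k, (G k)ᴴ = G k := fun k => by
    simp only [hG, restObs]; split_ifs <;> simp [refObs_conjTranspose]
  have hsq : ∀ k, G k * G k = 1 := fun k => by
    simp only [hG, restObs]; split_ifs <;> simp [refObs_mul_self]
  -- Only the j-th factors fail to commute, so the commutator is that of `refObs_commutator` placed
  -- in slot j.
  refine ⟨-tensorOp (Function.update G j (axis j 0 * axis j 1)), ?_, ?_, ?_, ?_⟩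
  · rw [star_neg, Matrix.star_eq_conjTranspose, tensorOp_conjTranspose, neg_inj]
    have : (fun k => (Function.update G j (axis j 0 * axis j 1) k)ᴴ)
        = Function.update G j ((-1 : ℂ) • (axis j 0 * axis j 1)) := by
      funext k
      by_cases h : k = j
      · subst h
        simp [Matrix.conjTranspose_mul, axis_conjTranspose, axis_one_mul_axis_zero]
      · simp [h, hstar]
    rw [this, tensorOp_update_smul, neg_one_smul]
  · rw [neg_mul_neg, tensorOp_mul]
    have : (fun k => Function.update G j (axis j 0 * axis j 1) k
        * Function.update G j (axis j 0 * axis j 1) k)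
        = Function.update (fun _ => 1) j ((-1 : ℂ) • (1 : QubitOp)) := by
      funext k
      by_cases h : k = j
      · subst h
        simp only [Function.update_self]
        rw [mul_assoc, ← mul_assoc (axis k 1), axis_one_mul_axis_zero, neg_mul, mul_assoc,
          axis_mul_self, mul_one, mul_neg, axis_mul_self, neg_one_smul]
      · simp [h, hsq]
    rw [this, tensorOp_update_smul, neg_one_smul]
    exact congrArg _ (siteOp_one j)
  · intro A
    rw [neg_mul, mul_neg, neg_inj]
    refine tensorOp_comm fun k => ?_
    by_cases h : k = 0
    · left; subst h; simp [hj.symm, hG, restObs]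
    · right; simp [h]
  · have hl : tensorOp G * siteOp j (refObs j (α j) 1)
        = tensorOp (Function.update G j (refObs j (α j) 0 * refObs j (α j) 1)) := by
      rw [siteOp, tensorOp_mul]
      congr 1; funext k
      by_cases h : k = j
      · subst h; simp [hGj]
      · simp [h]
    have hr : siteOp j (refObs j (α j) 1) * tensorOp G
        = tensorOp (Function.update G j (refObs j (α j) 1 * refObs j (α j) 0)) := by
      rw [siteOp, tensorOp_mul]
      congr 1; funext k
      by_cases h : k = j
      · subst h; simp [hGj]
      · simp [h]
    rw [hl, hr, sub_eq_iff_eq_add, smul_neg, ← neg_smul, ← tensorOp_update_smul,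
      ← tensorOp_update_add]
    congr 2
    rw [← refObs_commutator, sub_add_cancel]

theorem card_ne_zero_filter :
    ((Finset.univ.filter (fun j : Fin n => j ≠ 0)).card : ℝ) = (n : ℝ) - 1 := by
  rw [Finset.filter_ne', Finset.card_erase_of_mem (Finset.mem_univ _), Finset.card_univ,
    Fintype.card_fin, Nat.cast_sub (NeZero.one_le), Nat.cast_one]

/-- The prefactor n − 1 shares the first term equally among the parties j ≥ 2, which exhibits the
operator as a sum of n − 1 CHSH operators. -/
theorem reTraceMul_successOpOf_refObs (B : NQubitOp n) (α : Fin n → ℝ) (s : Fin n → Fin 2) :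
    reTraceMul B (successOpOf (fun j => refObs j (α j)) s)
      = ∑ j ∈ Finset.univ.filter (fun j : Fin n => j ≠ 0),
        (2 * Real.cos (α 0) * reTraceMul B (siteOp 0 pauliX
            * ((bitSign (s 0) : ℂ) • tensorOp (restObs fun k => refObs k (α k) 0)))
          + 2 * Real.sin (α 0) * reTraceMul B (siteOp 0 pauliZ
            * ((bitSign (s j) : ℂ) • siteOp j (refObs j (α j) 1)))) := by
  have e0 : refObs (0 : Fin n) (α 0) 0 + refObs (0 : Fin n) (α 0) 1
      = ((2 * Real.cos (α 0) : ℝ) : ℂ) • pauliX := by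
    rw [refObs_zero, refObs_one, axis_zero_zero]; push_cast; module
  have e1 : refObs (0 : Fin n) (α 0) 0 - refObs (0 : Fin n) (α 0) 1
      = ((2 * Real.sin (α 0) : ℝ) : ℂ) • pauliZ := by
    rw [refObs_zero, refObs_one, axis_zero_one]; push_cast; module
  rw [Finset.sum_add_distrib, Finset.sum_const, nsmul_eq_mul, card_ne_zero_filter, successOpOf,
    map_add, map_sum, e0, e1, tensorOp_ite_zero, siteOp_smul]
  congr 1
  · rw [← ofReal_bitSign]
    simp only [smul_mul_assoc, mul_smul_comm, smul_smul]
    rw [show ((n : ℂ) - 1) * (bitSign (s 0) : ℂ) * ((2 * Real.cos (α 0) : ℝ) : ℂ)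
      = ((((n : ℝ) - 1) * bitSign (s 0) * (2 * Real.cos (α 0)) : ℝ) : ℂ) by push_cast; ring,
      reTraceMul_ofReal_smul, reTraceMul_ofReal_smul]
    ring
  · refine Finset.sum_congr rfl fun j hj => ?_
    rw [tensorOp_ite_zero_ite (Finset.mem_filter.mp hj).2, siteOp_smul, ← ofReal_bitSign]
    simp only [smul_mul_assoc, mul_smul_comm, reTraceMul_ofReal_smul]
    ring

theorem bitSign_smul_mul_self {A : NQubitOp n} (b : Fin 2) (hA : A * A = 1) :
    ((bitSign b : ℂ) • A) * ((bitSign b : ℂ) • A) = 1 := by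
  rw [smul_mul_smul_comm, hA, ← Complex.ofReal_mul, bitSign_mul_self, Complex.ofReal_one,
    one_smul]

theorem bitSign_smul_star {A : NQubitOp n} (b : Fin 2) (hA : star A = A) :
    star ((bitSign b : ℂ) • A) = (bitSign b : ℂ) • A := by
  rw [star_smul, hA]; simp

/-- The constant `r` used for an arbitrary number of parties. -/
def crudeSlope (n : ℕ) : ℝ :=
  3 / 4 * √2 * (1 + ((n : ℝ) - 1) * (8 + 4 * 2 ^ n)) + (1 + √2)

theorem ghzProj_fidelity_many (hn : 2 ≤ n) {B : NQubitOp n} (hB : B.PosSemidef) {α : Fin n → ℝ}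
    (hα : ∀ j, α j ∈ Set.Icc 0 (Real.pi / 2)) (s : Fin n → Fin 2) :
    crudeSlope n * reTraceMul B (successOpOf (fun j => refObs j (α j)) s)
      + (1 - crudeSlope n * ((n : ℝ) - 1) * (2 * √2)) * reTraceMul B 1
      ≤ reTraceMul B (dephaseAll α (ghzProj s)) := by
  have hφ := reTraceMul_star_mul_self_nonneg hB
  have hS : √2 * √2 = 2 := Real.mul_self_sqrt (by norm_num)
  have hS0 : 0 ≤ √2 := by positivity
  have hn' : (1 : ℝ) ≤ (n : ℝ) - 1 := by
    have : (2 : ℝ) ≤ n := by exact_mod_cast hn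
    linarith
  set t := reTraceMul B 1 with ht
  have ht0 : 0 ≤ t := map_one_nonneg hφ
  set H : ℝ := ∑ k, angleDefect (α k) with hH
  have hH0 : 0 ≤ H := Finset.sum_nonneg fun k _ => angleDefect_nonneg
  have hle : ∀ j, angleDefect (α j) ≤ H := fun j =>
    Finset.single_le_sum (f := fun k => angleDefect (α k)) (fun k _ => angleDefect_nonneg)
      (Finset.mem_univ j)
  set J := Finset.univ.filter (fun j : Fin n => j ≠ 0) with hJ
  have hcard : (J.card : ℝ) = (n : ℝ) - 1 := card_ne_zero_filter
  set B₀ : NQubitOp n := (bitSign (s 0) : ℂ) • tensorOp (restObs fun k => refObs k (α k) 0)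
    with hB₀
  set R₀ : NQubitOp n := (bitSign (s 0) : ℂ) • tensorOp (restObs fun _ => pauliX) with hR₀
  set C : Fin n → ℝ := fun j => 2 * Real.cos (α 0) * reTraceMul B (siteOp 0 pauliX * B₀)
      + 2 * Real.sin (α 0) * reTraceMul B (siteOp 0 pauliZ
        * ((bitSign (s j) : ℂ) • siteOp j (refObs j (α j) 1))) with hC
  have hW : reTraceMul B (successOpOf (fun j => refObs j (α j)) s) = ∑ j ∈ J, C j :=
    reTraceMul_successOpOf_refObs B α s
  have hXs : star (siteOp (0 : Fin n) pauliX) = siteOp 0 pauliX := by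
    rw [siteOp_star, pauliX_conjTranspose]
  have hZs : star (siteOp (0 : Fin n) pauliZ) = siteOp 0 pauliZ := by
    rw [siteOp_star, pauliZ_conjTranspose]
  have hX2 : siteOp (0 : Fin n) pauliX * siteOp 0 pauliX = 1 := by
    rw [siteOp_mul, pauliX_mul_self, siteOp_one]
  have hZ2 : siteOp (0 : Fin n) pauliZ * siteOp 0 pauliZ = 1 := by
    rw [siteOp_mul, pauliZ_mul_self, siteOp_one]
  have hZX : siteOp (0 : Fin n) pauliZ * siteOp 0 pauliX
      = -(siteOp 0 pauliX * siteOp 0 pauliZ) := by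
    rw [siteOp_mul, siteOp_mul, pauliZ_mul_pauliX, siteOp_neg]
  have hB₀s : star B₀ = B₀ := bitSign_smul_star _
    (tensorOp_restObs_star fun k => refObs_conjTranspose _ _ _)
  have hR₀s : star R₀ = R₀ := bitSign_smul_star _
    (tensorOp_restObs_star fun k => pauliX_conjTranspose)
  have hB₀2 : B₀ * B₀ = 1 := bitSign_smul_mul_self _
    (tensorOp_restObs_mul_self fun k => refObs_mul_self _ _ _)
  have hR₀2 : R₀ * R₀ = 1 := bitSign_smul_mul_self _
    (tensorOp_restObs_mul_self fun k => pauliX_mul_self)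
  have hB₀c : ∀ A, B₀ * siteOp 0 A = siteOp 0 A * B₀ := fun A => by
    rw [hB₀, smul_mul_assoc, mul_smul_comm, tensorOp_restObs_comm]
  have hR₀c : ∀ A, R₀ * siteOp 0 A = siteOp 0 A * R₀ := fun A => by
    rw [hR₀, smul_mul_assoc, mul_smul_comm, tensorOp_restObs_comm]
  have hB₁c : ∀ j : Fin n, j ≠ 0 → ∀ A A' : QubitOp, ((bitSign (s j) : ℂ) • siteOp j A')
      * siteOp 0 A = siteOp 0 A * ((bitSign (s j) : ℂ) • siteOp j A') := fun j hj A A' => by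
    rw [smul_mul_assoc, mul_smul_comm, siteOp_comm hj]
  have hB₁s : ∀ j : Fin n, star ((bitSign (s j) : ℂ) • siteOp j (refObs j (α j) 1))
      = (bitSign (s j) : ℂ) • siteOp j (refObs j (α j) 1) := fun j =>
    bitSign_smul_star _ (by rw [siteOp_star, refObs_conjTranspose])
  have hB₁2 : ∀ j : Fin n, ((bitSign (s j) : ℂ) • siteOp j (refObs j (α j) 1))
      * ((bitSign (s j) : ℂ) • siteOp j (refObs j (α j) 1)) = 1 := fun j =>
    bitSign_smul_mul_self _ (by rw [siteOp_mul, refObs_mul_self, siteOp_one])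
  have hcs := Real.cos_sq_add_sin_sq (α 0)
  have chsh : ∀ j ∈ J, √2 * C j ≤ (4 - (angleDefect (α 0) + angleDefect (α j))) * t := by
    intro j hj
    have hj0 : j ≠ 0 := (Finset.mem_filter.mp hj).2
    obtain ⟨F, hFs, hF2, hFc, hFB⟩ := restObs_commutator hj0 α
    obtain ⟨s0, c0⟩ := sin_cos_nonneg (hα 0)
    obtain ⟨sj, cj⟩ := sin_cos_nonneg (hα j)
    have hσ : bitSign (s 0) * bitSign (s j) * (bitSign (s 0) * bitSign (s j)) = 1 := by
      rw [mul_mul_mul_comm, bitSign_mul_self, bitSign_mul_self, one_mul]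
    refine map_chsh_le hφ (X := siteOp 0 pauliX) (Z := siteOp 0 pauliZ) (B₀ := B₀)
      (B₁ := (bitSign (s j) : ℂ) • siteOp j (refObs j (α j) 1))
      (F := ((bitSign (s 0) * bitSign (s j) : ℝ) : ℂ) • F) hXs hZs hB₀s (hB₁s j) ?_ hX2 hZ2 hB₀2
      (hB₁2 j) ?_ hZX (hB₀c _) (hB₀c _) (hB₁c j hj0 _ _) (hB₁c j hj0 _ _) ?_ ?_ hcs
      (Real.cos_sq_add_sin_sq (α j)) c0 s0 cj sj ?_
    · rw [star_smul, hFs, smul_neg]; simp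
    · rw [smul_mul_smul_comm, ← Complex.ofReal_mul, hσ, Complex.ofReal_one, one_smul, hF2]
    · rw [smul_mul_assoc, hFc, mul_smul_comm]
    · rw [smul_mul_assoc, hFc, mul_smul_comm]
    · rw [hB₀, smul_mul_smul_comm, smul_mul_smul_comm, mul_comm (bitSign (s j) : ℂ), ← smul_sub,
        hFB, ← Complex.coe_smul, smul_smul, smul_smul]
      push_cast
      ring_nf
  have stab : ∀ j ∈ J, reTraceMul B (1 - stabX s) + reTraceMul B (1 - stabZ s j)
      ≤ 3 / 2 * (4 * t - √2 * C j + (8 * angleDefect (α 0) + 2 * (2 ^ n * (2 * H))) * t) := by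
    intro j hj
    have hj0 : j ≠ 0 := (Finset.mem_filter.mp hj).2
    have hX : stabX s = siteOp 0 pauliX * R₀ := by
      rw [stabX, hR₀, mul_smul_comm, ← tensorOp_ite_zero]
      simp
    have hZ : stabZ s j = siteOp 0 pauliZ * ((bitSign (s j) : ℂ) • siteOp j pauliZ) := by
      rw [stabZ, mul_smul_comm]
    rw [hX, hZ]
    refine map_stabilizer_deficit_le hφ hXs hZs hB₀s (hB₁s j) hR₀s
      (bitSign_smul_star _ (by rw [siteOp_star, pauliZ_conjTranspose])) hX2 hZ2 hB₀2 (hB₁2 j)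
      hR₀2 (bitSign_smul_mul_self _ (by rw [siteOp_mul, pauliZ_mul_self, siteOp_one]))
      (hB₀c _) (hB₁c j hj0 _ _) (hR₀c _) (hB₁c j hj0 _ _) hcs ?_ ?_
    · rw [hB₀, hR₀, ← smul_sub, smul_mul_smul_comm, ← Complex.ofReal_mul, bitSign_mul_self,
        Complex.ofReal_one, one_smul]
      exact reTraceMul_rest_sub_sq_le hB α
    · rw [← smul_sub, smul_mul_smul_comm, ← Complex.ofReal_mul, bitSign_mul_self,
        Complex.ofReal_one, one_smul, ← siteOp_sub, siteOp_mul,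
        refObs_sub_sq (by simpa [sub_eq_add_neg] using pauliZ_eq_axis hj0), siteOp_smul,
        siteOp_one, reTraceMul_ofReal_smul]
      refine mul_le_mul_of_nonneg_right ?_ ht0
      have : (1 : ℝ) ≤ 2 ^ n := one_le_pow₀ (by norm_num)
      nlinarith [hle j]
  set D : ℝ := ((n : ℝ) - 1) * (2 * √2) * t - ∑ j ∈ J, C j with hD
  have hsum4 : ∑ j ∈ J, (4 * t - √2 * C j) = √2 * D := by
    have hm : ∑ j ∈ J, √2 * C j = √2 * ∑ j ∈ J, C j := (Finset.mul_sum _ _ _).symm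
    rw [Finset.sum_sub_distrib, hm, Finset.sum_const, nsmul_eq_mul, hcard, hD]
    linear_combination -2 * ((n : ℝ) - 1) * t * hS
  -- In the sum of the CHSH bounds the defect of party 1 occurs n − 1 ≥ 1 times and each other
  -- defect once.
  have hHD : H * t ≤ √2 * D := by
    rw [← hsum4]
    have h1 : H ≤ ∑ j ∈ J, (angleDefect (α 0) + angleDefect (α j)) := by
      rw [Finset.sum_add_distrib, Finset.sum_const, nsmul_eq_mul, hcard, hH,
        ← Finset.sum_filter_add_sum_filter_not Finset.univ (fun j : Fin n => j ≠ 0), add_comm]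
      have : Finset.univ.filter (fun j : Fin n => ¬ j ≠ 0) = {0} := by ext; simp
      rw [this, Finset.sum_singleton]
      have := angleDefect_nonneg (α := α 0)
      nlinarith
    refine (mul_le_mul_of_nonneg_right h1 ht0).trans ?_
    rw [Finset.sum_mul]
    exact Finset.sum_le_sum fun j hj => by linarith [chsh j hj]
  have hX0 : 0 ≤ reTraceMul B (1 - stabX s) := by
    rw [map_sub, sub_nonneg]
    exact map_le_map_one hφ (stabX_star s) (stabX_mul_self s)
  have hP := reTraceMul_one_sub_ghzProj_le hB s
  have hstab : reTraceMul B (1 - stabX s) + ∑ j ∈ J, reTraceMul B (1 - stabZ s j)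
      ≤ 3 / 2 * (√2 * D + ((n : ℝ) - 1) * (8 + 4 * 2 ^ n) * (H * t)) := by
    have h1 := Finset.sum_le_sum stab
    rw [Finset.sum_add_distrib, Finset.sum_const, nsmul_eq_mul, hcard, ← Finset.mul_sum,
      Finset.sum_add_distrib, hsum4, Finset.sum_const, nsmul_eq_mul, hcard] at h1
    have h2 : (8 * angleDefect (α 0) + 2 * (2 ^ n * (2 * H))) * t
        ≤ (8 + 4 * 2 ^ n) * (H * t) := by
      nlinarith [mul_le_mul_of_nonneg_right (hle 0) ht0]
    have h3 := mul_le_mul_of_nonneg_left h2 (show (0 : ℝ) ≤ (n : ℝ) - 1 by linarith)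
    -- The sum over j counts the X-stabilizer deficit n − 1 times; one copy is enough.
    have h4 := mul_le_mul_of_nonneg_right hn' hX0
    linarith
  have hK := prod_mul_reTraceMul_le_dephaseAll hB (ghzProj_posSemidef s) hα
  have hprod := one_sub_sum_le_prod Finset.univ (fun j => (1 - dephasingWeight (α j)) / 2)
    (fun j => by linarith [dephasingWeight_le_one (α := α j)])
    (fun j => by linarith [dephasingWeight_nonneg (hα j)])
  have hp : ∏ j, (1 - (1 - dephasingWeight (α j)) / 2) = ∏ j, (1 + dephasingWeight (α j)) / 2 :=
    Finset.prod_congr rfl fun j _ => by ring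
  have hq : ∑ j, (1 - dephasingWeight (α j)) / 2 = (2 + √2) / 2 * H := by
    rw [hH, Finset.mul_sum]
    exact Finset.sum_congr rfl fun j _ => by rw [one_sub_dephasingWeight]; ring
  rw [hp, hq] at hprod
  have hZ0 : 0 ≤ ∑ j ∈ J, reTraceMul B (1 - stabZ s j) := by
    refine Finset.sum_nonneg fun j hj => ?_
    have hj0 : j ≠ 0 := (Finset.mem_filter.mp hj).2
    rw [map_sub, sub_nonneg]
    refine map_le_map_one hφ (bitSign_smul_star _ ?_) (bitSign_smul_mul_self _ ?_)
    · rw [star_mul, siteOp_star, siteOp_star, pauliZ_conjTranspose, siteOp_comm hj0]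
    · rw [mul_assoc, ← mul_assoc (siteOp j pauliZ), siteOp_comm hj0, mul_assoc, siteOp_mul j,
        pauliZ_mul_self, siteOp_one, mul_one, hZ2]
  have hprod0 : 0 ≤ ∏ j, (1 + dephasingWeight (α j)) / 2 :=
    Finset.prod_nonneg fun j _ => by linarith [dephasingWeight_nonneg (hα j)]
  have hprod1 : ∏ j, (1 + dephasingWeight (α j)) / 2 ≤ 1 :=
    Finset.prod_le_one (fun j _ => by linarith [dephasingWeight_nonneg (hα j)])
      fun j _ => by linarith [dephasingWeight_le_one (α := α j)]
  -- With Π the product of the weights (1+g)/2, the overlap is at least Π(t − deficit/2). The bound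
  -- Π ≥ 1 − (2+√2)H/2 is applied to t and Π ≤ 1 to the deficit.
  have h4 := mul_le_mul_of_nonneg_left hP hprod0
  have h5 := mul_le_mul_of_nonneg_right hprod ht0
  have h6 := mul_le_mul_of_nonneg_right hprod1 (add_nonneg hX0 hZ0)
  have h7 := mul_le_mul_of_nonneg_left hHD
    (show 0 ≤ 3 / 4 * (((n : ℝ) - 1) * (8 + 4 * 2 ^ n)) + (2 + √2) / 2 by positivity)
  -- This is where `crudeSlope` comes from: H·t is replaced by √2·D in both losses.
  have h8 : (3 / 4 * (((n : ℝ) - 1) * (8 + 4 * 2 ^ n)) + (2 + √2) / 2) * (√2 * D)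
      + 3 / 4 * (√2 * D) = crudeSlope n * D := by
    rw [crudeSlope]; linear_combination D / 2 * hS
  rw [hW]
  have h9 : crudeSlope n * D = crudeSlope n * ((n : ℝ) - 1) * (2 * √2) * t
      - crudeSlope n * ∑ j ∈ J, C j := by rw [hD]; ring
  linarith

end ManyQubits

/-! ### Normal form of a pair of unit observables. -/

section Observables

/-- Traceless Hermitian qubit operators of square one: observables with unit Bloch vector. -/
structure IsUnitObs (A : QubitOp) : Prop where
  herm : Aᴴ = A
  trace : A.trace = 0
  sq : A * A = 1

theorem IsUnitObs.neg {A : QubitOp} (h : IsUnitObs A) : IsUnitObs (-A) :=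
  ⟨by simp [h.herm], by simp [h.trace], by simp [h.sq]⟩

theorem isUnitObs_pauliX : IsUnitObs pauliX :=
  ⟨pauliX_conjTranspose, by simp [pauliX, Matrix.trace_fin_two], pauliX_mul_self⟩

theorem apply_one_one_of_trace {A : QubitOp} (h : A.trace = 0) : A 1 1 = -A 0 0 := by
  rw [Matrix.trace_fin_two] at h; linear_combination h

/-- Cayley–Hamilton for a matrix of trace zero. -/
theorem traceless_mul_self {A : QubitOp} (h : A.trace = 0) :
    A * A = (-A.det) • (1 : QubitOp) := by
  have h1 := apply_one_one_of_trace h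
  ext i j
  fin_cases i <;> fin_cases j <;>
    simp [Matrix.mul_apply, Fin.sum_univ_two, Matrix.det_fin_two, h1] <;> ring

theorem traceless_anticommutator {A B : QubitOp} (hA : A.trace = 0) (hB : B.trace = 0) :
    A * B + B * A = (A * B).trace • (1 : QubitOp) := by
  have h1 := apply_one_one_of_trace hA
  have h2 := apply_one_one_of_trace hB
  ext i j
  fin_cases i <;> fin_cases j <;>
    simp [Matrix.mul_apply, Fin.sum_univ_two, Matrix.trace_fin_two, h1, h2] <;> ring

theorem hermitian_mul_self_apply {A : QubitOp} (h : Aᴴ = A) :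
    (A * A) 0 0 = ((Complex.normSq (A 0 0) + Complex.normSq (A 1 0) : ℝ) : ℂ) := by
  nth_rewrite 1 [← h]
  simp [Matrix.mul_apply, Fin.sum_univ_two, Matrix.conjTranspose_apply,
    Complex.normSq_eq_conj_mul_self]

theorem nonneg_of_hermitian_mul_self {A : QubitOp} (h : Aᴴ = A) {t : ℝ}
    (ht : A * A = (t : ℂ) • (1 : QubitOp)) : 0 ≤ t := by
  have := hermitian_mul_self_apply h
  rw [ht] at this
  simp only [Matrix.smul_apply, Matrix.one_apply_eq, smul_eq_mul, mul_one,
    Complex.ofReal_inj] at this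
  rw [this]
  exact add_nonneg (Complex.normSq_nonneg _) (Complex.normSq_nonneg _)

theorem eq_zero_of_hermitian_mul_self {A : QubitOp} (h : Aᴴ = A) (h0 : A * A = 0) : A = 0 := by
  have : Aᴴ * A = 0 := by rw [h, h0]
  exact Matrix.conjTranspose_mul_self_eq_zero.mp this

theorem isUnitObs_inv_smul {A : QubitOp} (h : Aᴴ = A) (htr : A.trace = 0) {t : ℝ} (ht : t ≠ 0)
    (h2 : A * A = ((t ^ 2 : ℝ) : ℂ) • (1 : QubitOp)) : IsUnitObs ((t⁻¹ : ℂ) • A) := by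
  have ht' : (t : ℂ) ≠ 0 := by exact_mod_cast ht
  refine ⟨by simp [Matrix.conjTranspose_smul, h], by simp [Matrix.trace_smul, htr], ?_⟩
  rw [smul_mul_smul_comm, h2, smul_smul]
  push_cast
  rw [show (t : ℂ)⁻¹ * (t : ℂ)⁻¹ * (t : ℂ) ^ 2 = 1 by field_simp, one_smul]

/-- A Bloch vector orthogonal to that of Q is needed. For diagonal Q the X axis serves; otherwise
the equatorial part of Q is turned by a right angle and normalized. -/
theorem exists_anticommuting {Q : QubitOp} (hQ : IsUnitObs Q) :
    ∃ P, IsUnitObs P ∧ Q * P = -(P * Q) := by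
  have h11 := apply_one_one_of_trace hQ.trace
  have h10 : Q 1 0 = star (Q 0 1) := by
    conv_lhs => rw [← hQ.herm]
    rfl
  by_cases hb : Q 0 1 = 0
  · refine ⟨pauliX, isUnitObs_pauliX, ?_⟩
    ext i j
    fin_cases i <;> fin_cases j <;>
      simp [Matrix.mul_apply, Matrix.vecMul, dotProduct, Fin.sum_univ_two, pauliX, h11, h10, hb]
  · set P : QubitOp := !![0, Complex.I * Q 0 1; -Complex.I * star (Q 0 1), 0] with hP
    have hPh : Pᴴ = P := by
      ext i j; fin_cases i <;> fin_cases j <;> simp [hP]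
    have hPt : P.trace = 0 := by simp [hP, Matrix.trace_fin_two]
    have hP2 : P * P = ((‖Q 0 1‖ ^ 2 : ℝ) : ℂ) • (1 : QubitOp) := by
      have hn : ((‖Q 0 1‖ ^ 2 : ℝ) : ℂ) = Q 0 1 * star (Q 0 1) := by
        rw [Complex.star_def, Complex.mul_conj, Complex.normSq_eq_norm_sq]
      rw [hn]
      ext i j
      fin_cases i <;> fin_cases j <;>
        simp [hP, Matrix.mul_apply, Fin.sum_univ_two] <;>
        linear_combination (-(Q 0 1 * (starRingEnd ℂ) (Q 0 1))) * Complex.I_mul_I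
    refine ⟨_, isUnitObs_inv_smul hPh hPt (norm_ne_zero_iff.mpr hb) hP2, ?_⟩
    rw [mul_smul_comm, smul_mul_assoc, ← smul_neg]
    congr 1
    ext i j
    fin_cases i <;> fin_cases j <;>
      simp [hP, Matrix.mul_apply, Matrix.vecMul, dotProduct, Fin.sum_univ_two, h11, h10] <;> ring

/-- Two anticommuting observables are unitarily equivalent to `σ_X` and `σ_Z`. -/
theorem exists_unitary_conj_pauli {P Q : QubitOp} (hP : IsUnitObs P) (hQ : IsUnitObs Q)
    (hPQ : Q * P = -(P * Q)) :
    ∃ U ∈ Matrix.unitaryGroup (Fin 2) ℂ, U * P * Uᴴ = pauliX ∧ U * Q * Uᴴ = pauliZ := by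
  have hne : 1 + Q ≠ 0 := fun h => by
    have := congrArg Matrix.trace h
    rw [Matrix.trace_add, hQ.trace] at this
    simp at this
  -- Since Q(1 + Q) = 1 + Q, a nonzero column of 1 + Q is an eigenvector of Q with eigenvalue 1.
  obtain ⟨i, k, hik⟩ : ∃ i k, (1 + Q) i k ≠ 0 := by
    by_contra hcon
    push Not at hcon
    exact hne (Matrix.ext hcon)
  set w : Fin 2 → ℂ := (1 + Q).col k with hw
  have hQw : Q *ᵥ w = w := by
    have : Q * (1 + Q) = 1 + Q := by rw [mul_add, mul_one, hQ.sq, add_comm]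
    ext l
    exact congrFun (congrFun this l) k
  have hww : 0 < star w ⬝ᵥ w := by
    rw [Matrix.dotProduct_star_self_pos_iff]
    exact fun h => hik (congrFun h i)
  obtain ⟨N, hN0, hN⟩ : ∃ N : ℝ, 0 < N ∧ star w ⬝ᵥ w = (N : ℂ) := by
    obtain ⟨h1, h2⟩ := Complex.lt_def.mp hww
    exact ⟨(star w ⬝ᵥ w).re, h1, Complex.ext rfl (by simpa using h2.symm)⟩
  set v : Fin 2 → ℂ := ((√N : ℝ) : ℂ)⁻¹ • w with hv
  have hvv : star v ⬝ᵥ v = 1 := by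
    have hs : ((√N : ℝ) : ℂ) * ((√N : ℝ) : ℂ) = N := by
      rw [← Complex.ofReal_mul, Real.mul_self_sqrt hN0.le]
    have h0 : ((√N : ℝ) : ℂ) ≠ 0 := by
      simpa using (Real.sqrt_pos.mpr hN0).ne'
    rw [hv, star_smul, smul_dotProduct, dotProduct_smul, hN, ← hs]
    simp
    field_simp
  have hQv : Q *ᵥ v = v := by rw [hv, Matrix.mulVec_smul, hQw]
  -- By anticommutation P maps v to an eigenvector for −1, so v and Pv form an orthonormal basis in
  -- which P is σ_X and Q is σ_Z.
  set u : Fin 2 → ℂ := P *ᵥ v with hu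
  have hPu : P *ᵥ u = v := by rw [hu, Matrix.mulVec_mulVec, hP.sq, Matrix.one_mulVec]
  have hQu : Q *ᵥ u = -u := by
    rw [hu, Matrix.mulVec_mulVec, hPQ, Matrix.neg_mulVec, ← Matrix.mulVec_mulVec, hQv]
  have adj : ∀ (A : QubitOp) (x y : Fin 2 → ℂ), Aᴴ = A → star (A *ᵥ x) ⬝ᵥ y = star x ⬝ᵥ (A *ᵥ y) :=
    fun A x y hA => by
      rw [Matrix.star_mulVec, hA, Matrix.dotProduct_mulVec]
  have huu : star u ⬝ᵥ u = 1 := by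
    rw [hu, adj P _ _ hP.herm, ← hu, hPu, hvv]
  have hvu : star v ⬝ᵥ u = 0 := by
    have h1 : star v ⬝ᵥ u = -(star v ⬝ᵥ u) := by
      calc star v ⬝ᵥ u = star (Q *ᵥ v) ⬝ᵥ u := by rw [hQv]
        _ = -(star v ⬝ᵥ u) := by rw [adj Q _ _ hQ.herm, hQu, dotProduct_neg]
    linear_combination h1 / 2
  have huv : star u ⬝ᵥ v = 0 := by
    rw [hu, adj P _ _ hP.herm, ← hu, hvu]
  set V : QubitOp := Matrix.of fun i j => if j = 0 then v i else u i with hV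
  have hVV : Vᴴ * V = 1 := by
    simp only [dotProduct, Fin.sum_univ_two, Pi.star_apply] at hvv huu hvu huv
    ext i j
    fin_cases i <;> fin_cases j <;>
      simpa [hV, Matrix.mul_apply, Fin.sum_univ_two, Matrix.conjTranspose_apply]
  have hVV' : V * Vᴴ = 1 := mul_eq_one_comm.mp hVV
  have hPV : P * V = V * pauliX := by
    ext i j
    have h1 := congrFun hu i
    have h2 := congrFun hPu i
    simp only [Matrix.mulVec, dotProduct, Fin.sum_univ_two] at h1 h2
    fin_cases j
    · simp [hV, Matrix.mul_apply, Fin.sum_univ_two, pauliX, h1]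
    · simp [hV, Matrix.mul_apply, Fin.sum_univ_two, pauliX, h2]
  have hQV : Q * V = V * pauliZ := by
    ext i j
    have h1 := congrFun hQv i
    have h2 := congrFun hQu i
    simp only [Matrix.mulVec, dotProduct, Fin.sum_univ_two] at h1 h2
    fin_cases j
    · simp [hV, Matrix.mul_apply, Fin.sum_univ_two, pauliZ, h1]
    · simp [hV, Matrix.mul_apply, Fin.sum_univ_two, pauliZ, h2]
  refine ⟨Vᴴ, ?_, ?_, ?_⟩
  · rw [Matrix.mem_unitaryGroup_iff, Matrix.star_eq_conjTranspose,
      Matrix.conjTranspose_conjTranspose, hVV]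
  · rw [Matrix.conjTranspose_conjTranspose, mul_assoc, hPV, ← mul_assoc, hVV, one_mul]
  · rw [Matrix.conjTranspose_conjTranspose, mul_assoc, hQV, ← mul_assoc, hVV, one_mul]

/-- Two observables of unit length in terms of an orthonormal pair and half of their angle. -/
theorem exists_angle_decomposition {A₀ A₁ : QubitOp} (h₀ : IsUnitObs A₀) (h₁ : IsUnitObs A₁) :
    ∃ (E₀ E₁ : QubitOp) (α : ℝ), α ∈ Set.Icc 0 (Real.pi / 2) ∧ IsUnitObs E₀ ∧ IsUnitObs E₁ ∧
      E₁ * E₀ = -(E₀ * E₁) ∧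
      A₀ = ((Real.cos α : ℝ) : ℂ) • E₀ + ((Real.sin α : ℝ) : ℂ) • E₁ ∧
      A₁ = ((Real.cos α : ℝ) : ℂ) • E₀ - ((Real.sin α : ℝ) : ℂ) • E₁ := by
  obtain ⟨x, hx⟩ : ∃ x : ℝ, A₀ * A₁ + A₁ * A₀ = ((2 * x : ℝ) : ℂ) • (1 : QubitOp) := by
    refine ⟨(A₀ * A₁).trace.re / 2, ?_⟩
    rw [traceless_anticommutator h₀.trace h₁.trace]
    congr 1
    have : (starRingEnd ℂ) (A₀ * A₁).trace = (A₀ * A₁).trace := by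
      rw [← Complex.star_def, ← Matrix.trace_conjTranspose, Matrix.conjTranspose_mul, h₀.herm,
        h₁.herm, Matrix.trace_mul_comm]
    rw [mul_div_cancel₀ _ (two_ne_zero)]
    exact (Complex.conj_eq_iff_re.mp this).symm
  have hp : (A₀ + A₁) * (A₀ + A₁) = ((2 + 2 * x : ℝ) : ℂ) • (1 : QubitOp) := by
    have : (A₀ + A₁) * (A₀ + A₁) = (2 : ℂ) • (1 : QubitOp) + (A₀ * A₁ + A₁ * A₀) := by
      simp only [mul_add, add_mul, h₀.sq, h₁.sq]; module
    rw [this, hx]; push_cast; module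
  have hm : (A₀ - A₁) * (A₀ - A₁) = ((2 - 2 * x : ℝ) : ℂ) • (1 : QubitOp) := by
    have : (A₀ - A₁) * (A₀ - A₁) = (2 : ℂ) • (1 : QubitOp) - (A₀ * A₁ + A₁ * A₀) := by
      simp only [mul_sub, sub_mul, h₀.sq, h₁.sq]; module
    rw [this, hx]; push_cast; module
  have hps : (A₀ + A₁)ᴴ = A₀ + A₁ := by simp [h₀.herm, h₁.herm]
  have hms : (A₀ - A₁)ᴴ = A₀ - A₁ := by simp [h₀.herm, h₁.herm]
  have hpt : (A₀ + A₁).trace = 0 := by simp [h₀.trace, h₁.trace]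
  have hmt : (A₀ - A₁).trace = 0 := by simp [h₀.trace, h₁.trace]
  have hp0 := nonneg_of_hermitian_mul_self hps hp
  have hm0 := nonneg_of_hermitian_mul_self hms hm
  -- x is the inner product of the two Bloch vectors, so c is the cosine of half their angle.
  set c : ℝ := √((1 + x) / 2) with hc
  have hc2 : c ^ 2 = (1 + x) / 2 := Real.sq_sqrt (by linarith)
  have hc0 : 0 ≤ c := Real.sqrt_nonneg _
  have hc1 : c ≤ 1 := by nlinarith
  set α := Real.arccos c with hα
  have hcos : Real.cos α = c := Real.cos_arccos (by linarith) hc1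
  have hαm : α ∈ Set.Icc 0 (Real.pi / 2) :=
    ⟨Real.arccos_nonneg _, Real.arccos_le_pi_div_two.mpr hc0⟩
  have hs0 := (sin_cos_nonneg hαm).1
  have hs2 : Real.sin α ^ 2 = (1 - x) / 2 := by
    have := Real.cos_sq_add_sin_sq α
    rw [hcos] at this; linarith
  set s := Real.sin α with hs
  have hp' : (A₀ + A₁) * (A₀ + A₁) = (((2 * c) ^ 2 : ℝ) : ℂ) • (1 : QubitOp) := by
    rw [hp]; congr 2; linarith
  have hm' : (A₀ - A₁) * (A₀ - A₁) = (((2 * s) ^ 2 : ℝ) : ℂ) • (1 : QubitOp) := by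
    rw [hm]; congr 2; linarith
  have fin : ∀ E₀ E₁ : QubitOp, IsUnitObs E₀ → IsUnitObs E₁ → E₁ * E₀ = -(E₀ * E₁) →
      A₀ + A₁ = ((2 * c : ℝ) : ℂ) • E₀ → A₀ - A₁ = ((2 * s : ℝ) : ℂ) • E₁ →
      ∃ (E₀ E₁ : QubitOp) (α : ℝ), α ∈ Set.Icc 0 (Real.pi / 2) ∧ IsUnitObs E₀ ∧ IsUnitObs E₁ ∧
      E₁ * E₀ = -(E₀ * E₁) ∧
      A₀ = ((Real.cos α : ℝ) : ℂ) • E₀ + ((Real.sin α : ℝ) : ℂ) • E₁ ∧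
      A₁ = ((Real.cos α : ℝ) : ℂ) • E₀ - ((Real.sin α : ℝ) : ℂ) • E₁ := by
    intro E₀ E₁ u₀ u₁ h e₀ e₁
    refine ⟨E₀, E₁, α, hαm, u₀, u₁, h, ?_, ?_⟩
    · have : A₀ = (2⁻¹ : ℂ) • ((A₀ + A₁) + (A₀ - A₁)) := by module
      rw [this, e₀, e₁, hcos, ← hs]; push_cast; module
    · have : A₁ = (2⁻¹ : ℂ) • ((A₀ + A₁) - (A₀ - A₁)) := by module
      rw [this, e₀, e₁, hcos, ← hs]; push_cast; module
  -- For opposite or equal observables one axis is undetermined, and any anticommuting partner can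
  -- be chosen.
  by_cases hcz : c = 0
  · have hz : A₀ + A₁ = 0 := eq_zero_of_hermitian_mul_self hps (by rw [hp', hcz]; simp)
    have hsz : s = 1 := by nlinarith
    obtain ⟨P, hP, hQP⟩ := exists_anticommuting h₀
    refine fin P A₀ hP h₀ hQP (by rw [hz, hcz]; simp) ?_
    rw [hsz, eq_neg_of_add_eq_zero_right hz]; push_cast; module
  by_cases hsz : s = 0
  · have hz : A₀ - A₁ = 0 := eq_zero_of_hermitian_mul_self hms (by rw [hm', hsz]; simp)
    have hcz : c = 1 := by nlinarith
    obtain ⟨P, hP, hQP⟩ := exists_anticommuting h₀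
    refine fin A₀ P h₀ hP (by rw [hQP, neg_neg]) ?_ (by rw [hz, hsz]; simp)
    rw [hcz, ← sub_eq_zero.mp hz]; push_cast; module
  refine fin (((2 * c : ℝ) : ℂ)⁻¹ • (A₀ + A₁)) (((2 * s : ℝ) : ℂ)⁻¹ • (A₀ - A₁))
    (isUnitObs_inv_smul hps hpt (by simpa using hcz) hp')
    (isUnitObs_inv_smul hms hmt (by simpa using hsz) hm') ?_ ?_ ?_
  · rw [smul_mul_smul_comm, smul_mul_smul_comm, mul_comm, ← smul_neg]
    congr 1
    simp only [mul_add, add_mul, mul_sub, sub_mul, h₀.sq, h₁.sq]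
    abel
  · rw [smul_smul, mul_inv_cancel₀ (by simpa using hcz), one_smul]
  · rw [smul_smul, mul_inv_cancel₀ (by simpa using hsz), one_smul]

/-- A pair of observables of unit length is unitarily equivalent to a reference pair. -/
theorem exists_unitary_conj_refObs {n : ℕ} [NeZero n] (j : Fin n) {A : Fin 2 → QubitOp}
    (hA : ∀ x, IsUnitObs (A x)) :
    ∃ U ∈ Matrix.unitaryGroup (Fin 2) ℂ, ∃ α ∈ Set.Icc 0 (Real.pi / 2),
      ∀ x, U * A x * Uᴴ = refObs j α x := by
  obtain ⟨E₀, E₁, α, hα, u₀, u₁, h, e₀, e₁⟩ := exists_angle_decomposition (hA 0) (hA 1)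
  suffices hU : ∃ U ∈ Matrix.unitaryGroup (Fin 2) ℂ,
      U * E₀ * Uᴴ = axis j 0 ∧ U * E₁ * Uᴴ = axis j 1 by
    obtain ⟨U, hU, f₀, f₁⟩ := hU
    refine ⟨U, hU, α, hα, fun x => ?_⟩
    fin_cases x
    · simp only [Fin.zero_eta, e₀, refObs_zero, mul_add, add_mul, mul_smul_comm, smul_mul_assoc,
        f₀, f₁]
    · simp only [Fin.mk_one, e₁, refObs_one, mul_sub, sub_mul, mul_smul_comm, smul_mul_assoc,
        f₀, f₁]
  by_cases hj : j = 0
  · subst hj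
    rw [axis_zero_zero, axis_zero_one]
    exact exists_unitary_conj_pauli u₀ u₁ h
  -- Away from party 1 the pair is first turned by the map (a, b) ↦ ((a+b)/√2, (a−b)/√2), which is
  -- its own inverse.
  · have ht := inv_sqrt_two_mul_self
    have hstar : star (((√2 : ℝ) : ℂ)⁻¹) = ((√2 : ℝ) : ℂ)⁻¹ := by
      rw [Complex.star_def, ← Complex.ofReal_inv, Complex.conj_ofReal]
    have w₀ : IsUnitObs (((√2 : ℝ) : ℂ)⁻¹ • (E₀ + E₁)) := by
      refine ⟨by rw [Matrix.conjTranspose_smul, hstar]; simp [u₀.herm, u₁.herm],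
        by simp [Matrix.trace_smul, u₀.trace, u₁.trace], ?_⟩
      rw [smul_mul_smul_comm, ht]
      simp only [mul_add, add_mul, u₀.sq, u₁.sq, h]
      module
    have w₁ : IsUnitObs (((√2 : ℝ) : ℂ)⁻¹ • (E₀ - E₁)) := by
      refine ⟨by rw [Matrix.conjTranspose_smul, hstar]; simp [u₀.herm, u₁.herm],
        by simp [Matrix.trace_smul, u₀.trace, u₁.trace], ?_⟩
      rw [smul_mul_smul_comm, ht]
      simp only [mul_sub, sub_mul, u₀.sq, u₁.sq, h]
      module
    obtain ⟨U, hU, f₀, f₁⟩ := exists_unitary_conj_pauli w₀ w₁ (by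
      rw [smul_mul_smul_comm, smul_mul_smul_comm, ← smul_neg]
      congr 1
      simp only [mul_add, mul_sub, sub_mul, add_mul, u₀.sq, u₁.sq, h]
      abel)
    have inv₀ : E₀ = ((√2 : ℝ) : ℂ)⁻¹ • ((((√2 : ℝ) : ℂ)⁻¹ • (E₀ + E₁))
        + (((√2 : ℝ) : ℂ)⁻¹ • (E₀ - E₁))) := by
      rw [← smul_add, smul_smul, ht]; module
    have inv₁ : E₁ = ((√2 : ℝ) : ℂ)⁻¹ • ((((√2 : ℝ) : ℂ)⁻¹ • (E₀ + E₁))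
        - (((√2 : ℝ) : ℂ)⁻¹ • (E₀ - E₁))) := by
      rw [← smul_sub, smul_smul, ht]; module
    refine ⟨U, hU, ?_, ?_⟩
    · rw [inv₀, mul_smul_comm, smul_mul_assoc, mul_add, add_mul, f₀, f₁]
      simp [axis, hj]
    · rw [inv₁, mul_smul_comm, smul_mul_assoc, mul_sub, sub_mul, f₀, f₁]
      simp [axis, hj]

end Observables

/-! ### Observables obtained from pairs of qubit states. -/

section States

/-- With A = C*C and B = D*D the trace is the squared Hilbert–Schmidt norm of CD*. -/
theorem mul_eq_zero_of_trace_mul_eq_zero {A B : QubitOp} (hA : A.PosSemidef)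
    (hB : B.PosSemidef) (h : (A * B).trace = 0) : A * B = 0 := by
  obtain ⟨C, rfl⟩ := exists_eq_conjTranspose_mul_self hA
  obtain ⟨D, rfl⟩ := exists_eq_conjTranspose_mul_self hB
  have h1 : ((C * Dᴴ)ᴴ * (C * Dᴴ)).trace = 0 := by
    rw [← h, Matrix.conjTranspose_mul, Matrix.conjTranspose_conjTranspose, Matrix.trace_mul_comm,
      ← Matrix.trace_mul_comm (Dᴴ * D)]
    rw [Matrix.trace_mul_comm]
    simp only [← mul_assoc]
    rw [Matrix.trace_mul_comm]
    simp only [← mul_assoc]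
  have h2 := Matrix.trace_conjTranspose_mul_self_eq_zero_iff.mp h1
  rw [mul_assoc, ← mul_assoc C, h2, zero_mul, mul_zero]

theorem det_eq_zero_of_mul_eq_zero {A B : QubitOp} (h : A * B = 0) (hB : B ≠ 0) : A.det = 0 := by
  by_contra hdet
  have hu : IsUnit A := (Matrix.isUnit_iff_isUnit_det A).mpr (isUnit_iff_ne_zero.mpr hdet)
  exact hB ((hu.mul_right_eq_zero).mp h)

theorem IsQubitState.ne_zero {ρ : QubitOp} (h : IsQubitState ρ) : ρ ≠ 0 := fun h0 => by
  have := h.2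
  rw [h0] at this
  simp at this

/-- The observable of a sender is a multiple `λ ∈ [0, 1]` of an observable of unit length, and
`λ = 1` for antipodal states. -/
theorem senderObs_eq_smul {ρ : Fin 2 → Fin 2 → QubitOp} (hρ : ∀ x a, IsQubitState (ρ x a))
    (x : Fin 2) :
    ∃ (l : ℝ) (A : QubitOp), 0 ≤ l ∧ l ≤ 1 ∧ IsUnitObs A ∧ senderObs ρ x = (l : ℂ) • A ∧
      ((ρ x 0 * ρ x 1).trace = 0 → l = 1) := by
  set T := senderObs ρ x with hT
  have hTh : Tᴴ = T := by
    rw [hT, senderObs, Matrix.conjTranspose_sub, (hρ x 0).1.isHermitian.eq,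
      (hρ x 1).1.isHermitian.eq]
  have hTt : T.trace = 0 := by
    rw [hT, senderObs, Matrix.trace_sub, (hρ x 0).2, (hρ x 1).2, sub_self]
  -- As T² = −det T, this formula bounds the squared Bloch length by 1. Orthogonal states are both
  -- singular, and then it gives equality.
  have hdet : -T.det = 1 - (ρ x 0).det - (ρ x 1).det - (ρ x 0 * ρ x 1).trace := by
    have t0 := (hρ x 0).2
    have t1 := (hρ x 1).2
    rw [Matrix.trace_fin_two] at t0 t1
    have e0 : ρ x 0 1 1 = 1 - ρ x 0 0 0 := by linear_combination t0
    have e1 : ρ x 1 1 1 = 1 - ρ x 1 0 0 := by linear_combination t1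
    rw [hT, senderObs]
    simp only [Matrix.det_fin_two, Matrix.trace_fin_two, Matrix.mul_apply, Fin.sum_univ_two,
      Matrix.sub_apply, e0, e1]
    ring
  have d0 := (hρ x 0).1.det_nonneg
  have d1 := (hρ x 1).1.det_nonneg
  have tr0 := re_trace_mul_nonneg (hρ x 0).1 (hρ x 1).1
  obtain ⟨t, ht⟩ : ∃ t : ℝ, T * T = (t : ℂ) • (1 : QubitOp) := by
    refine ⟨(-T.det).re, ?_⟩
    have h1 := traceless_mul_self hTt
    have h2 := hermitian_mul_self_apply hTh
    rw [h1]
    congr 1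
    have h3 : -T.det = ((Complex.normSq (T 0 0) + Complex.normSq (T 1 0) : ℝ) : ℂ) := by
      rw [← h2, h1]; simp
    rw [h3, Complex.ofReal_re]
  have ht' : (t : ℂ) = -T.det := by
    have h1 := traceless_mul_self hTt
    rw [ht] at h1
    simpa using congrFun (congrFun h1 0) 0
  have ht0 := nonneg_of_hermitian_mul_self hTh ht
  have ht1 : t ≤ 1 := by
    have h := congrArg Complex.re (ht'.trans hdet)
    simp only [Complex.ofReal_re, Complex.sub_re, Complex.one_re] at h
    have a := (Complex.le_def.mp d0).1
    have b := (Complex.le_def.mp d1).1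
    simp only [Complex.zero_re] at a b
    linarith
  have hanti : (ρ x 0 * ρ x 1).trace = 0 → t = 1 := fun h0 => by
    have hz := mul_eq_zero_of_trace_mul_eq_zero (hρ x 0).1 (hρ x 1).1 h0
    have hz' := mul_eq_zero_of_trace_mul_eq_zero (hρ x 1).1 (hρ x 0).1
      (by rw [Matrix.trace_mul_comm, h0])
    have h := ht'.trans hdet
    rw [h0, det_eq_zero_of_mul_eq_zero hz (hρ x 1).ne_zero,
      det_eq_zero_of_mul_eq_zero hz' (hρ x 0).ne_zero] at h
    simpa using h
  have hsq : √t ^ 2 = t := Real.sq_sqrt ht0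
  by_cases hz : t = 0
  · refine ⟨0, pauliX, le_rfl, zero_le_one, isUnitObs_pauliX, ?_, fun h0 => ?_⟩
    · rw [eq_zero_of_hermitian_mul_self hTh (by rw [ht, hz]; simp)]; simp
    · exact absurd (hanti h0) (by rw [hz]; norm_num)
  · have hst : √t ≠ 0 := by rwa [Real.sqrt_ne_zero ht0]
    refine ⟨√t, ((√t : ℝ) : ℂ)⁻¹ • T, Real.sqrt_nonneg _, Real.sqrt_le_one.mpr ht1,
      isUnitObs_inv_smul hTh hTt hst (by rw [hsq]; exact ht), ?_, fun h0 => ?_⟩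
    · rw [smul_smul, mul_inv_cancel₀ (by simpa using hst), one_smul]
    · rw [hanti h0, Real.sqrt_one]

end States

/-! ### Reduction to extremal observables. -/

section Extremal

/-- Compatibility of a function of an observable with the mixture
`λ B = (1 + λ)/2 · B + (1 - λ)/2 · (-B)`. -/
def IsMixtureAffine {E : Type*} [AddCommGroup E] [Module ℂ E] (F : QubitOp → E) : Prop :=
  ∀ (l : ℝ) (B : QubitOp),
    F ((l : ℂ) • B) = (((1 + l) / 2 : ℝ) : ℂ) • F B + (((1 - l) / 2 : ℝ) : ℂ) • F (-B)

section

variable {E : Type*} [AddCommGroup E] [Module ℂ E] {F G : QubitOp → E}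

theorem isMixtureAffine_const (e : E) : IsMixtureAffine fun _ => e := fun l B => by
  push_cast; module

theorem isMixtureAffine_id : IsMixtureAffine fun B : QubitOp => B := fun l B => by
  push_cast; module

theorem IsMixtureAffine.add (hF : IsMixtureAffine F) (hG : IsMixtureAffine G) :
    IsMixtureAffine fun B => F B + G B := fun l B => by
  simp only [hF l B, hG l B]; module

theorem IsMixtureAffine.sub (hF : IsMixtureAffine F) (hG : IsMixtureAffine G) :
    IsMixtureAffine fun B => F B - G B := fun l B => by
  simp only [hF l B, hG l B]; module

theorem IsMixtureAffine.const_smul (hF : IsMixtureAffine F) (c : ℂ) :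
    IsMixtureAffine fun B => c • F B := fun l B => by
  simp only [hF l B]; module

theorem IsMixtureAffine.sum {ι : Type*} {F : ι → QubitOp → E} (S : Finset ι)
    (hF : ∀ i ∈ S, IsMixtureAffine (F i)) : IsMixtureAffine fun B => ∑ i ∈ S, F i B := fun l B => by
  simp only [Finset.smul_sum, ← Finset.sum_add_distrib]
  exact Finset.sum_congr rfl fun i hi => hF i hi l B

theorem IsMixtureAffine.tensorOp {n : ℕ} {F : QubitOp → Fin n → QubitOp} {j : Fin n}
    (hj : IsMixtureAffine fun B => F B j) (hk : ∀ k, k ≠ j → ∀ B, F B k = F 0 k) :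
    IsMixtureAffine fun B => tensorOp (F B) := fun l B => by
  have h : ∀ B, F B = Function.update (F 0) j (F B j) := fun B => by
    funext k
    by_cases h : k = j
    · subst h; simp
    · rw [Function.update_of_ne h, hk k h]
  have := hj l B
  simp only at this
  show GHZTest.tensorOp (F ((l : ℂ) • B)) = _
  rw [h ((l : ℂ) • B), this, tensorOp_update_add, tensorOp_update_smul, tensorOp_update_smul,
    ← h B, ← h (-B)]

end

variable {n : ℕ} [NeZero n]

theorem isMixtureAffine_update (A : Fin n × Fin 2 → QubitOp) (p q : Fin n × Fin 2) :
    IsMixtureAffine fun B => Function.update A p B q := by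
  by_cases h : q = p
  · subst h; simpa using isMixtureAffine_id
  · simpa [h] using isMixtureAffine_const (A q)

/-- A single observable enters each product in at most one tensor factor, and there only through
itself or a sum or difference with a fixed one. -/
theorem isMixtureAffine_successOpOf (A : Fin n × Fin 2 → QubitOp) (p : Fin n × Fin 2)
    (s : Fin n → Fin 2) :
    IsMixtureAffine fun B => successOpOf (fun j x => Function.update A p B (j, x)) s := by
  have hne : ∀ k, k ≠ p.1 → ∀ x B, Function.update A p B (k, x) = A (k, x) := fun k hk x B =>
    Function.update_of_ne (fun h => hk (by rw [← h])) _ _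
  unfold successOpOf
  refine IsMixtureAffine.add (IsMixtureAffine.const_smul (IsMixtureAffine.tensorOp (j := p.1) ?_ ?_)
    _) (IsMixtureAffine.sum _ fun j _ => IsMixtureAffine.const_smul
      (IsMixtureAffine.tensorOp (j := p.1) ?_ ?_) _)
  · split_ifs
    · exact (isMixtureAffine_update _ _ _).add (isMixtureAffine_update _ _ _)
    · exact isMixtureAffine_update _ _ _
  · intro k hk B
    split_ifs with h
    · subst h; simp only [hne _ hk]
    · simp only [hne _ hk]
  · split_ifs
    · exact (isMixtureAffine_update _ _ _).sub (isMixtureAffine_update _ _ _)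
    · exact isMixtureAffine_update _ _ _
    · exact isMixtureAffine_const _
  · intro k hk B
    split_ifs with h h'
    · subst h; simp only [hne _ hk]
    · subst h'; simp only [hne _ hk]
    · rfl

/-- The score `∑ₛ Re Tr (W_s M_s)` as a function of the observables of the senders. -/
def score (M : (Fin n → Fin 2) → NQubitOp n) (A : Fin n × Fin 2 → QubitOp) : ℝ :=
  ∑ s, reTraceMul (M s) (successOpOf (fun j x => A (j, x)) s)

/-- Observables of length at most one can be replaced by observables of unit length without
decreasing the score. -/
theorem exists_unit_score_le (M : (Fin n → Fin 2) → NQubitOp n) {A : Fin n × Fin 2 → QubitOp}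
    (hA : ∀ p, ∃ (l : ℝ) (B : QubitOp), 0 ≤ l ∧ l ≤ 1 ∧ IsUnitObs B ∧ A p = (l : ℂ) • B) :
    ∃ A' : Fin n × Fin 2 → QubitOp, (∀ p, IsUnitObs (A' p)) ∧ score M A ≤ score M A' := by
  suffices h : ∀ T : Finset (Fin n × Fin 2), ∃ A' : Fin n × Fin 2 → QubitOp,
      (∀ p ∈ T, IsUnitObs (A' p)) ∧ (∀ p ∉ T, A' p = A p) ∧ score M A ≤ score M A' by
    obtain ⟨A', h1, -, h3⟩ := h Finset.univ
    exact ⟨A', fun p => h1 p (Finset.mem_univ p), h3⟩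
  intro T
  induction T using Finset.induction_on with
  | empty => exact ⟨A, by simp, by simp, le_rfl⟩
  | insert p T hp ih =>
    obtain ⟨A', h1, h2, h3⟩ := ih
    obtain ⟨l, B, hl0, hl1, hB, hAB⟩ := hA p
    have hmix : score M A' = (1 + l) / 2 * score M (Function.update A' p B)
        + (1 - l) / 2 * score M (Function.update A' p (-B)) := by
      have hself : A' = Function.update A' p ((l : ℂ) • B) := by
        rw [← hAB, ← h2 p hp, Function.update_eq_self]
      conv_lhs => rw [hself]
      simp only [score, Finset.mul_sum, ← Finset.sum_add_distrib]
      refine Finset.sum_congr rfl fun s _ => ?_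
      have := isMixtureAffine_successOpOf A' p s l B
      simp only at this
      rw [this, map_add, reTraceMul_ofReal_smul, reTraceMul_ofReal_smul]
    have step : ∀ C, IsUnitObs C → score M A ≤ score M (Function.update A' p C) →
        ∃ A' : Fin n × Fin 2 → QubitOp, (∀ q ∈ insert p T, IsUnitObs (A' q)) ∧
          (∀ q ∉ insert p T, A' q = A q) ∧ score M A ≤ score M A' := by
      intro C hC hle
      refine ⟨Function.update A' p C, fun q hq => ?_, fun q hq => ?_, hle⟩
      · by_cases hqp : q = p
        · subst hqp; simpa using hC
        · rw [Function.update_of_ne hqp]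
          exact h1 q (Finset.mem_of_mem_insert_of_ne hq hqp)
      · rw [Finset.mem_insert, not_or] at hq
        rw [Function.update_of_ne hq.1, h2 q hq.2]
    by_cases hc : score M A ≤ score M (Function.update A' p B)
    · exact step B hB hc
    · refine step (-B) hB.neg ?_
      -- Two candidates strictly below the target would contradict the mixture identity `hmix`.
      by_contra hc'
      push Not at hc hc'
      have e1 := mul_le_mul_of_nonneg_left hc.le (show 0 ≤ (1 + l) / 2 by linarith)
      have e2 := mul_le_mul_of_nonneg_left hc'.le (show 0 ≤ (1 - l) / 2 by linarith)
      rcases hl0.eq_or_lt with h0 | h0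
      · rw [← h0] at hmix; linarith
      · have := mul_lt_mul_of_pos_left hc (show 0 < (1 + l) / 2 by linarith)
        linarith

end Extremal

/-! ### The local channel and its dual. -/

section Channel

variable {n : ℕ} [NeZero n]

/-- The channel `X ↦ dephasing (U X Uᴴ)` of party `j`. -/
def rotatedDephasing (j : Fin n) (α : ℝ) (U : QubitOp) : QubitOp →ₗ[ℂ] QubitOp :=
  dephasingLin j α ∘ₗ LinearMap.mulRight ℂ Uᴴ ∘ₗ LinearMap.mulLeft ℂ U

theorem rotatedDephasing_apply (j : Fin n) (α : ℝ) (U X : QubitOp) :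
    rotatedDephasing j α U X = dephasing j α (U * X * Uᴴ) := rfl

theorem rotatedDephasing_eq_sum (j : Fin n) {α : ℝ} (hα : α ∈ Set.Icc 0 (Real.pi / 2))
    (U X : QubitOp) : rotatedDephasing j α U X
      = ∑ i, (dephasingKraus j α i * U) * X * (dephasingKraus j α i * U)ᴴ := by
  rw [rotatedDephasing_apply, ← sum_dephasingKraus hα]
  refine Finset.sum_congr rfl fun i _ => ?_
  rw [Matrix.conjTranspose_mul, dephasingKraus_conjTranspose]
  simp only [mul_assoc]

theorem isQubitChannel_rotatedDephasing (j : Fin n) {α : ℝ}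
    (hα : α ∈ Set.Icc 0 (Real.pi / 2)) {U : QubitOp} (hU : U ∈ Matrix.unitaryGroup (Fin 2) ℂ) :
    IsQubitChannel (rotatedDephasing j α U) := by
  refine ⟨2, fun i => dephasingKraus j α i * U, ?_, rotatedDephasing_eq_sum j hα U⟩
  have h1 := sum_dephasingKraus (j := j) hα 1
  have hd : dephasing j α 1 = 1 := by
    rw [dephasing, mul_one, dephasingAxis_mul_self]; push_cast; module
  have hUU : Uᴴ * U = 1 := Matrix.mem_unitaryGroup_iff'.mp hU
  have : ∀ i, (dephasingKraus j α i * U)ᴴ * (dephasingKraus j α i * U)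
      = Uᴴ * (dephasingKraus j α i * 1 * dephasingKraus j α i) * U := fun i => by
    rw [Matrix.conjTranspose_mul, dephasingKraus_conjTranspose]
    simp only [mul_assoc, one_mul]
  simp only [this]
  rw [← Finset.sum_mul, ← Finset.mul_sum, h1, hd, mul_one, hUU]

theorem reTraceMul_conj (V X M : NQubitOp n) :
    reTraceMul (V * M * Vᴴ) X = reTraceMul M (Vᴴ * X * V) := by
  rw [reTraceMul_apply, reTraceMul_apply]
  congr 1
  rw [← mul_assoc, ← mul_assoc, Matrix.trace_mul_comm]
  simp only [mul_assoc]

/-- The local channel acts on the measurement as the dual dephasing acts on the target. -/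
theorem re_trace_mul_localMap {α : Fin n → ℝ} (hα : ∀ j, α j ∈ Set.Icc 0 (Real.pi / 2))
    (U : Fin n → QubitOp) (P M : NQubitOp n) :
    ((P * localMap (fun j => rotatedDephasing j (α j) (U j)) M).trace).re
      = reTraceMul (tensorOp U * M * (tensorOp U)ᴴ) (dephaseAll α P) := by
  rw [localMap_eq_sum_kraus _ (fun j i => dephasingKraus j (α j) i * U j)
    (fun j X => rotatedDephasing_eq_sum j (hα j) (U j) X), dephaseAll, map_sum, Finset.mul_sum,
    Matrix.trace_sum, Complex.re_sum]
  refine Finset.sum_congr rfl fun f _ => ?_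
  rw [← tensorOp_mul, reTraceMul_apply]
  congr 1
  rw [Matrix.conjTranspose_mul]
  generalize tensorOp (fun j => dephasingKraus j (α j) (f j)) = T
  generalize tensorOp U = V
  rw [mul_assoc Tᴴ, mul_assoc Tᴴ, Matrix.trace_mul_comm Tᴴ]
  simp only [mul_assoc]

theorem successOpOf_conj {U : Fin n → QubitOp} (hU : ∀ j, U j ∈ Matrix.unitaryGroup (Fin 2) ℂ)
    (A : Fin n → Fin 2 → QubitOp) (s : Fin n → Fin 2) :
    (tensorOp U)ᴴ * successOpOf (fun j x => U j * A j x * (U j)ᴴ) s * tensorOp U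
      = successOpOf A s := by
  have hUU : ∀ j, (U j)ᴴ * U j = 1 := fun j => Matrix.mem_unitaryGroup_iff'.mp (hU j)
  have hconj : ∀ j (X : QubitOp), (U j)ᴴ * (U j * X * (U j)ᴴ) * U j = X := fun j X => by
    rw [← mul_assoc, ← mul_assoc, hUU, one_mul, mul_assoc, hUU, mul_one]
  have ht : ∀ F : Fin n → QubitOp, (tensorOp U)ᴴ * tensorOp F * tensorOp U
      = tensorOp (fun j => (U j)ᴴ * F j * U j) := fun F => by
    rw [tensorOp_conjTranspose, tensorOp_mul, tensorOp_mul]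
  simp only [successOpOf, mul_add, add_mul, Finset.mul_sum, Finset.sum_mul, mul_smul_comm,
    smul_mul_assoc, ht]
  refine congrArg₂ (· + ·) (congrArg _ (congrArg tensorOp (funext fun k => ?_)))
    (Finset.sum_congr rfl fun j _ => congrArg _ (congrArg tensorOp (funext fun k => ?_)))
  · split_ifs with h
    · subst h; rw [mul_add, add_mul, hconj, hconj]
    · exact hconj k _
  · split_ifs with h h'
    · subst h; rw [mul_sub, sub_mul, hconj, hconj]
    · subst h'; exact hconj k _
    · rw [mul_one, hUU]

end Channel

/-! ### Boundedness of the fidelity over local channels. -/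

section Boundedness

/-- Trace preservation bounds each column of the stacked Kraus operators in ℓ²; the entry is an
inner product of two such rows of coefficients. -/
theorem norm_channel_single_apply_le {Φ : QubitOp →ₗ[ℂ] QubitOp} (hΦ : IsQubitChannel Φ)
    (c d a b : Fin 2) : ‖Φ (Matrix.single c d 1) a b‖ ≤ 1 := by
  obtain ⟨m, K, hK, hΦK⟩ := hΦ
  have hcol : ∀ a c : Fin 2, ∑ i, ‖K i a c‖ ^ 2 ≤ 1 := fun a c => by
    have h := congrArg Complex.re (congrFun (congrFun hK c) c)
    rw [Matrix.one_apply_eq, Complex.one_re, Matrix.sum_apply, Complex.re_sum] at h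
    rw [← h]
    refine Finset.sum_le_sum fun i _ => ?_
    rw [Matrix.mul_apply, Complex.re_sum]
    have : ∀ e, ((K i)ᴴ c e * K i e c).re = ‖K i e c‖ ^ 2 := fun e => by
      rw [Matrix.conjTranspose_apply, Complex.star_def, ← Complex.normSq_eq_conj_mul_self,
        Complex.ofReal_re, Complex.normSq_eq_norm_sq]
    simp only [this]
    exact Finset.single_le_sum (f := fun e => ‖K i e c‖ ^ 2) (fun e _ => by positivity)
      (Finset.mem_univ a)
  have he : Φ (Matrix.single c d 1) a b = ∑ i, K i a c * star (K i b d) := by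
    rw [hΦK, Matrix.sum_apply]
    refine Finset.sum_congr rfl fun i _ => ?_
    simp [Matrix.mul_apply, Matrix.single_apply, Matrix.conjTranspose_apply, ite_and]
  rw [he]
  refine (norm_sum_le _ _).trans ?_
  have : ∀ i, ‖K i a c * star (K i b d)‖ ≤ (‖K i a c‖ ^ 2 + ‖K i b d‖ ^ 2) / 2 := fun i => by
    rw [norm_mul, norm_star]
    linarith [sq_nonneg (‖K i a c‖ - ‖K i b d‖)]
  refine (Finset.sum_le_sum fun i _ => this i).trans ?_
  rw [← Finset.sum_div, Finset.sum_add_distrib]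
  linarith [hcol a c, hcol b d]

variable {n : ℕ} [NeZero n]

theorem norm_localMap_apply_le {Φ : Fin n → (QubitOp →ₗ[ℂ] QubitOp)}
    (hΦ : ∀ j, IsQubitChannel (Φ j)) (X : NQubitOp n) (a b : Fin n → Fin 2) :
    ‖localMap Φ X a b‖ ≤ ∑ c, ∑ d, ‖X c d‖ := by
  rw [localMap, Matrix.sum_apply]
  refine (norm_sum_le _ _).trans (Finset.sum_le_sum fun c _ => ?_)
  rw [Matrix.sum_apply]
  refine (norm_sum_le _ _).trans (Finset.sum_le_sum fun d _ => ?_)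
  rw [Matrix.smul_apply, smul_eq_mul, norm_mul, tensorOp_apply, norm_prod]
  refine mul_le_of_le_one_right (norm_nonneg _) ?_
  exact Finset.prod_le_one (fun j _ => norm_nonneg _)
    fun j _ => norm_channel_single_apply_le (hΦ j) _ _ _ _

/-- A real `sSup` is an upper bound only for bounded sets, so a bound uniform in the channels is
required. -/
theorem fidelityUnder_le_avgFidelity (M : (Fin n → Fin 2) → NQubitOp n)
    {Φ : Fin n → (QubitOp →ₗ[ℂ] QubitOp)} (hΦ : ∀ j, IsQubitChannel (Φ j)) :
    fidelityUnder M Φ ≤ avgFidelity M := by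
  refine le_csSup ⟨(∑ s, ∑ a, ∑ b, ‖ghzProj s a b‖ * ∑ c, ∑ d, ‖M s c d‖) / 2 ^ n, ?_⟩
    ⟨Φ, hΦ, rfl⟩
  rintro f ⟨Ψ, hΨ, rfl⟩
  rw [fidelityUnder]
  gcongr with s
  refine (Complex.re_le_norm _).trans ?_
  rw [Matrix.trace]
  refine (norm_sum_le _ _).trans (Finset.sum_le_sum fun a _ => ?_)
  rw [Matrix.diag_apply, Matrix.mul_apply]
  refine (norm_sum_le _ _).trans (Finset.sum_le_sum fun b _ => ?_)
  rw [norm_mul]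
  exact mul_le_mul_of_nonneg_left (norm_localMap_apply_le hΨ _ _ _) (norm_nonneg _)

end Boundedness

/-! ### From the operator inequality to the fidelity bound. -/

section SelfTesting

variable {n : ℕ} [NeZero n]

/-- The operator bound is applied with B the rotated POVM element; rotating back turns the reference
observables into the chosen unit observables. Nonnegativity of r carries the lower bound on the
score over to the fidelity. -/
theorem le_fidelityUnder_of_operator_bound (hn : 2 ≤ n) {r μ : ℝ} (hr : 0 ≤ r)
    (key : ∀ (B : NQubitOp n), B.PosSemidef → ∀ (α : Fin n → ℝ),
      (∀ j, α j ∈ Set.Icc 0 (Real.pi / 2)) → ∀ s : Fin n → Fin 2,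
      r * reTraceMul B (successOpOf (fun j => refObs j (α j)) s) + μ * reTraceMul B 1
        ≤ reTraceMul B (dephaseAll α (ghzProj s)))
    {ρ : Fin n → Fin 2 → Fin 2 → QubitOp} {M : (Fin n → Fin 2) → NQubitOp n} {ε : ℝ}
    (hρ : ∀ j x a, IsQubitState (ρ j x a)) (hM : IsPOVM M) (hε : 1 - ε ≤ successMetric ρ M) :
    ∃ (Λ : Fin n → (QubitOp →ₗ[ℂ] QubitOp)) (U : Fin n → QubitOp) (α : Fin n → ℝ),
      (∀ j, IsQubitChannel (Λ j)) ∧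
      (∀ j, U j ∈ Matrix.unitaryGroup (Fin 2) ℂ) ∧
      (∀ j, α j ∈ Set.Icc 0 (Real.pi / 2)) ∧
      (∀ j X, Λ j X = dephasing j (α j) (U j * X * (U j)ᴴ)) ∧
      ((∀ j x, (ρ j x 0 * ρ j x 1).trace = 0) →
        ∀ j x, U j * senderObs (ρ j) x * (U j)ᴴ = refObs j (α j) x) ∧
      (r * ((n : ℝ) - 1) * (2 * √2) + μ) - r * ((n : ℝ) - 1) * (2 * √2) * ε
        ≤ fidelityUnder M Λ := by
  obtain ⟨A, hA, hanti, hscore⟩ : ∃ A : Fin n × Fin 2 → QubitOp, (∀ p, IsUnitObs (A p)) ∧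
      ((∀ j x, (ρ j x 0 * ρ j x 1).trace = 0) → ∀ j x, A (j, x) = senderObs (ρ j) x) ∧
      score M (fun p => senderObs (ρ p.1) p.2) ≤ score M A := by
    -- Antipodal messages already give unit observables and are kept unchanged, because the claim on
    -- the angles refers to them; only otherwise is the extremal replacement used.
    by_cases h : ∀ j x, (ρ j x 0 * ρ j x 1).trace = 0
    · refine ⟨fun p => senderObs (ρ p.1) p.2, fun p => ?_, fun _ _ _ => rfl, le_rfl⟩
      obtain ⟨l, A, -, -, hA, he, h1⟩ := senderObs_eq_smul (hρ p.1) p.2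
      show IsUnitObs (senderObs (ρ p.1) p.2)
      rw [he, h1 (h p.1 p.2), Complex.ofReal_one, one_smul]
      exact hA
    · obtain ⟨A, hA, hle⟩ := exists_unit_score_le M (A := fun p => senderObs (ρ p.1) p.2)
        fun p => by
          obtain ⟨l, A, h0, h1, hA, he, -⟩ := senderObs_eq_smul (hρ p.1) p.2
          exact ⟨l, A, h0, h1, hA, he⟩
      exact ⟨A, hA, fun h' => absurd h' h, hle⟩
  choose U hU α hα hUα using fun j : Fin n =>
    exists_unitary_conj_refObs j (A := fun x => A (j, x)) fun x => hA (j, x)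
  refine ⟨fun j => rotatedDephasing j (α j) (U j), U, α,
    fun j => isQubitChannel_rotatedDephasing j (hα j) (hU j), hU, hα, fun j X => rfl,
    fun h j x => ?_, ?_⟩
  · rw [← hanti h j x]; exact hUα j x
  have hn' : (1 : ℝ) ≤ (n : ℝ) - 1 := by
    have : (2 : ℝ) ≤ n := by exact_mod_cast hn
    linarith
  have h2n : (0 : ℝ) < 2 ^ n := by positivity
  have hUU : (tensorOp U)ᴴ * tensorOp U = 1 := by
    rw [tensorOp_conjTranspose, tensorOp_mul, ← tensorOp_one]
    congr 1; funext j
    exact Matrix.mem_unitaryGroup_iff'.mp (hU j)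
  have hs : ∀ s, r * reTraceMul (M s) (successOpOf (fun j x => A (j, x)) s)
      + μ * reTraceMul (M s) 1
      ≤ ((ghzProj s * localMap (fun j => rotatedDephasing j (α j) (U j)) (M s)).trace).re := by
    intro s
    rw [re_trace_mul_localMap hα]
    have h := key (tensorOp U * M s * (tensorOp U)ᴴ)
      ((hM.1 s).mul_mul_conjTranspose_same _) α hα s
    have href : (fun j => refObs j (α j)) = fun j x => U j * A (j, x) * (U j)ᴴ := by
      funext j x; exact (hUα j x).symm
    rwa [reTraceMul_conj _ _ (M s), reTraceMul_conj _ _ (M s), href,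
      successOpOf_conj hU (fun j x => A (j, x)), mul_one, hUU] at h
  have hsum := Finset.sum_le_sum fun s (_ : s ∈ Finset.univ) => hs s
  rw [Finset.sum_add_distrib, ← Finset.mul_sum, ← Finset.mul_sum] at hsum
  have hone : ∑ s, reTraceMul (M s) 1 = 2 ^ n := by
    simp only [reTraceMul_apply, one_mul]
    rw [← Complex.re_sum, ← Matrix.trace_sum, hM.2, Matrix.trace_one]
    simp only [Fintype.card_pi, Fintype.card_fin, Finset.prod_const, Finset.card_univ]
    rw [Complex.natCast_re]; push_cast; rfl
  have hmetric : successMetric ρ M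
      = 1 / (2 ^ n * ((n : ℝ) - 1) * (2 * √2)) * score M (fun p => senderObs (ρ p.1) p.2) := by
    rw [successMetric, score]
    congr 1
    refine Finset.sum_congr rfl fun s _ => ?_
    rw [reTraceMul_apply, Matrix.trace_mul_comm, successOp_eq]
  rw [hone] at hsum
  have hpos : 0 < 2 ^ n * ((n : ℝ) - 1) * (2 * √2) := by positivity
  rw [hmetric, one_div, inv_mul_eq_div, le_div_iff₀ hpos] at hε
  have h3 := mul_le_mul_of_nonneg_left (hε.trans hscore) hr
  rw [fidelityUnder, le_div_iff₀ h2n]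
  refine le_trans ?_ hsum
  have h4 : r * score M A = r * ∑ s, reTraceMul (M s) (successOpOf (fun j x => A (j, x)) s) := rfl
  linarith

end SelfTesting

end

end GHZTest

open GHZTest in
theorem theorem2 (n : ℕ) [NeZero n] (hn : 2 ≤ n) :
    ∃ r μ : ℝ, r * ((n : ℝ) - 1) * (2 * √2) + μ = 1 ∧
      (n = 2 → r = (4 + 5 * √2) / 16 ∧ μ = -(1 + 2 * √2) / 4) ∧
      ∀ (ρ : Fin n → Fin 2 → Fin 2 → QubitOp) (M : (Fin n → Fin 2) → NQubitOp n) (ε : ℝ),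
        (∀ j x a, IsQubitState (ρ j x a)) → IsPOVM M → 1 - ε ≤ successMetric ρ M →
        (∃ (Λ : Fin n → (QubitOp →ₗ[ℂ] QubitOp)) (U : Fin n → QubitOp) (α : Fin n → ℝ),
          (∀ j, IsQubitChannel (Λ j)) ∧
          (∀ j, U j ∈ Matrix.unitaryGroup (Fin 2) ℂ) ∧
          (∀ j, α j ∈ Set.Icc 0 (Real.pi / 2)) ∧
          (∀ j X, Λ j X = dephasing j (α j) (U j * X * (U j)ᴴ)) ∧
          ((∀ j x, (ρ j x 0 * ρ j x 1).trace = 0) →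
            ∀ j x, U j * senderObs (ρ j) x * (U j)ᴴ = refObs j (α j) x) ∧
          (r * ((n : ℝ) - 1) * (2 * √2) + μ) - r * ((n : ℝ) - 1) * (2 * √2) * ε
            ≤ fidelityUnder M Λ) ∧
        (r * ((n : ℝ) - 1) * (2 * √2) + μ) - r * ((n : ℝ) - 1) * (2 * √2) * ε
          ≤ avgFidelity M ∧
        (n = 2 → 1 - (4 + 5 * √2) / (4 * √2) * ε ≤ avgFidelity M) := by
  have hS : √2 * √2 = 2 := Real.mul_self_sqrt (by norm_num)
  suffices h : ∃ r μ : ℝ, 0 ≤ r ∧ r * ((n : ℝ) - 1) * (2 * √2) + μ = 1 ∧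
      (n = 2 → r = (4 + 5 * √2) / 16 ∧ μ = -(1 + 2 * √2) / 4) ∧
      ∀ (B : NQubitOp n), B.PosSemidef → ∀ (α : Fin n → ℝ),
      (∀ j, α j ∈ Set.Icc 0 (Real.pi / 2)) → ∀ s : Fin n → Fin 2,
      r * reTraceMul B (successOpOf (fun j => refObs j (α j)) s) + μ * reTraceMul B 1
        ≤ reTraceMul B (dephaseAll α (ghzProj s)) by
    obtain ⟨r, μ, hr, h1, h2, key⟩ := h
    refine ⟨r, μ, h1, h2, fun ρ M ε hρ hM hε => ?_⟩
    have hmain := le_fidelityUnder_of_operator_bound hn hr key hρ hM hε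
    have havg : (r * ((n : ℝ) - 1) * (2 * √2) + μ) - r * ((n : ℝ) - 1) * (2 * √2) * ε
        ≤ avgFidelity M := by
      obtain ⟨Λ, U, α, hΛ, -, -, -, -, hle⟩ := hmain
      exact hle.trans (fidelityUnder_le_avgFidelity M hΛ)
    refine ⟨hmain, havg, fun hn2 => ?_⟩
    have hc : r * ((n : ℝ) - 1) * (2 * √2) = (4 + 5 * √2) / (4 * √2) := by
      rw [(h2 hn2).1, hn2, eq_div_iff (by positivity)]
      push_cast
      linear_combination (4 + 5 * √2) / 2 * hS
    rwa [h1, hc] at havg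
  -- Only two parties use the optimized constants; otherwise r is the crude slope and the
  -- normalization determines μ.
  by_cases hn2 : n = 2
  · subst hn2
    refine ⟨(4 + 5 * √2) / 16, -(1 + 2 * √2) / 4, by positivity, ?_, fun _ => ⟨rfl, rfl⟩,
      fun B hB α hα s => ghzProj_fidelity_two hB hα s⟩
    push_cast
    linear_combination 5 / 8 * hS
  · have hn' : (1 : ℝ) ≤ (n : ℝ) - 1 := by
      have : (2 : ℝ) ≤ n := by exact_mod_cast hn
      linarith
    exact ⟨crudeSlope n, 1 - crudeSlope n * ((n : ℝ) - 1) * (2 * √2),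
      by unfold crudeSlope; positivity, by ring, fun h => absurd h hn2,
      fun B hB α hα s => ghzProj_fidelity_many hn hB hα s⟩
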